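/- Let $\gamma>0$, let $V\subset\mathbb R$ be an open neighbourhood of $0$, let $\Delta=[1/2,1]$, and let $\mathcal B$ be the space of continuous functions $f$ on $(0,1]$ with $\|f\|_{\mathcal B}=\sup_{x\in(0,1]}|x^\gamma f(x)|<\infty$. A prime denotes the derivative in $x$. **Setup.** For $\varepsilon\in V$ let $T_\varepsilon:[0,1]\to[0,1]$ be non-singular with respect to Lebesgue measure $m$, with two increasing onto branches $[0,1/2]\to[0,1]$ and $[1/2,1]\to[0,1]$ whose inverses are $g_{0,\varepsilon}$ and $g_{1,\varepsilon}$. For the words $\omega=10^n$, $n\ge 0$, put $g_{\omega,\varepsilon}=g_{1,\varepsilon}\circ g_{0,\varepsilon}^{\,n}$. "The order-$j$ partial derivatives of $g_\varepsilon$ commute on $S$" means that $g_\varepsilon$ and $\partial_\varepsilon g_\varepsilon$ are $C^j$ in $x\in S$, that $\partial_\varepsilon g_\varepsilon^{(j)}$ exists and equals $(\partial_\varepsilon g_\varepsilon)^{(j)}$, and that it is continuous in $(\varepsilon,x)\in V\times S$. Let $\hat T_\varepsilon:\Delta\to\Delta$ be the first return map of $T_\varepsilon$ to $\Delta$. Assume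 (inducing scheme): - for $i=0,1$ the order-$j$ partial derivatives of $g_{i,\varepsilon}$ commute on $[0,1]$ for $j=0,1$ and on $(0,1]$ for $j=2$; for every $\omega$ those of $g_{\omega,\varepsilon}$ commute on $[0,1]$ for $j=0,1$; - $\sup_\omega\sup_{\varepsilon\in V}\sup_{[0,1]}|g_{\omega,\varepsilon}'|<\infty$ and $\sup_\omega\sup_{\varepsilon\in V}\sup_{[0,1]}|\partial_\varepsilon g_{\omega,\varepsilon}|<\infty$; - $\sum_\omega\sup_{\varepsilon\in V}\|g_{\omega,\varepsilon}'\|_{\mathcal B}<\infty$ and $\sum_\omega\sup_{\varepsilon\in V}\|\partial_\varepsilon g_{\omega,\varepsilon}'\|_{\mathcal B}<\infty$. Assume (uniform expansion of the induced maps): - for every $\varepsilon\in V$ the open intervals $g_{\omega,\varepsilon}((1/2,1))$ form a partition of $\Delta$ modulo null sets, $\hat T_\varepsilon$ is $C^3$ on each of them with inverse branch $g_{\omega,\varepsilon}$, and $|\hat T_\varepsilon'|\ge r_\varepsilon$ on all of them for some $r_\varepsilon>1$; - for every $\omega$ and $j=0,1,2$ the order-$j$ partial derivatives of $g_{\omega,\varepsilon}$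 commute on $\Delta$; - $\sum_\omega\sup_{\varepsilon\in V}\sup_{\Delta}|g_{\omega,\varepsilon}'|<\infty$, $\ \sup_\omega\sup_{\varepsilon\in V}\sup_\Delta|g_{\omega,\varepsilon}''/g_{\omega,\varepsilon}'|<\infty$, and $\sum_\omega\sup_{\varepsilon\in V}\sup_\Delta|\partial_\varepsilon g_{\omega,\varepsilon}^{(i)}|<\infty$ for $i=1,2$. For $\varepsilon\in V$ let $\hat h_\varepsilon\ge0$ be a density, continuous on $\Delta$, of a $\hat T_\varepsilon$-invariant measure, with $\int_\Delta\hat h_\varepsilon\,dm=1$, and assume $\hat h:=\hat h_0\in C^2(\Delta)$. Let $h_\varepsilon\ge0$ be the density of an absolutely continuous $T_\varepsilon$-invariant measure on $[0,1]$, finite or infinite, normalized by $\int_\Delta h_\varepsilon\,dm=1$. **Operators.** Let $\hat L\Phi=\sum_\omega\Phi\circ g_{\omega,0}\,g_{\omega,0}'$ on $\Delta$ be the Perron–Frobenius operator of $\hat T:=\hat T_0$, let $C^1_0$ be the space of $C^1$ functions on $\Delta$ with zero average, and put $$F_\varepsilon\Phi=1_\Delta\Phi+(1-1_\Delta)\sum_\omega\Phi\circ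 g_{\omega,\varepsilon}\,g_{\omega,\varepsilon}',\qquad Q\Phi=(1-1_\Delta)\sum_\omega\bigl(\Phi'\circ g_{\omega,0}\,a_\omega g_{\omega,0}'+\Phi\circ g_{\omega,0}\,b_\omega\bigr),$$ $$a_\omega=\partial_\varepsilon g_{\omega,\varepsilon}\big|_{\varepsilon=0},\quad b_\omega=\partial_\varepsilon g_{\omega,\varepsilon}'\big|_{\varepsilon=0},\quad A_0=-\frac{\partial_\varepsilon\hat T_\varepsilon}{\hat T_\varepsilon'}\Big|_{\varepsilon=0},\quad B_0=\Bigl(\frac{\partial_\varepsilon\hat T_\varepsilon\,\hat T_\varepsilon''}{\hat T_\varepsilon'^2}-\frac{\partial_\varepsilon\hat T_\varepsilon'}{\hat T_\varepsilon'}\Bigr)\Big|_{\varepsilon=0}.$$ **Conclusion.** For every $\varepsilon\in V$, $F_\varepsilon\hat h_\varepsilon\in\mathcal B$ and $h_\varepsilon=F_\varepsilon\hat h_\varepsilon$ almost everywhere; take this version of $h_\varepsilon$ and put $h=h_0$. The operator $I-\hat L$ is a bijection of $C^1_0$ onto itself. The $\varepsilon$-derivatives in $A_0$ and $B_0$ exist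 at every point of the intervals $g_{\omega,0}((1/2,1))$, the series $\hat L(A_0\hat h'+B_0\hat h)$ converges on $(1/2,1)$, and its sum extends to an element of $C^1_0$. There is $h^*\in\mathcal B$ with $$\lim_{\varepsilon\to0}\Bigl\|\frac{h_\varepsilon-h}{\varepsilon}-h^*\Bigr\|_{\mathcal B}=0,$$ and on $(0,1]$ $$h^*=F_0\,(I-\hat L)^{-1}\hat L\bigl(A_0\hat h'+B_0\hat h\bigr)+Q\hat h ,$$ where $(I-\hat L)^{-1}$ is the inverse on $C^1_0$ and the series defining $F_0$ and $Q$ here converge on $(0,1/2)$. -/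

import Mathlib

open Set MeasureTheory Filter Topology
open scoped ENNReal

noncomputable section

namespace LinearResponse

/-! ### Norms and function spaces -/

/-- The supremum of `|f|` over `S`, as an extended nonnegative number. -/
def supNorm (S : Set ℝ) (f : ℝ → ℝ) : ℝ≥0∞ := ⨆ x ∈ S, ‖f x‖ₑ

/-- The norm of `𝓑`: the supremum of `|x ^ γ f(x)|` over `x ∈ (0, 1]`. -/
def normB (γ : ℝ) (f : ℝ → ℝ) : ℝ≥0∞ := supNorm (Ioc 0 1) (fun x => x ^ γ * f x)

/-- `f` is an element of `𝓑`: continuous on `(0, 1]`, with finite weighted norm. -/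
def MemB (γ : ℝ) (f : ℝ → ℝ) : Prop := ContinuousOn f (Ioc 0 1) ∧ normB γ f < ⊤

/-- `f` is of class `C¹` on `[a, b]` and has zero average there. -/
def MemC10 (a b : ℝ) (f : ℝ → ℝ) : Prop :=
  ContDiffOn ℝ 1 f (Icc a b) ∧ ∫ x in Icc a b, f x = 0

/-! ### Maps, first returns and invariant densities -/

/-- `R(x) = inf {n ≥ 1 : Tⁿ x ∈ D}`. -/
def returnTime (T : ℝ → ℝ) (D : Set ℝ) (x : ℝ) : ℕ := sInf {n : ℕ | 1 ≤ n ∧ T^[n] x ∈ D}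

/-- The first return map `x ↦ T^{R(x)} x` to `D`. -/
def firstReturn (T : ℝ → ℝ) (D : Set ℝ) (x : ℝ) : ℝ := T^[returnTime T D x] x

/-- `f ≥ 0` is the Lebesgue density on `I` of a measure invariant under `S : I → I`.
The measure is `σ`-finite, and may be infinite. -/
def IsInvariantDensity (S : ℝ → ℝ) (I : Set ℝ) (f : ℝ → ℝ) : Prop :=
  AEMeasurable f (volume.restrict I) ∧ (∀ᵐ x ∂(volume.restrict I), 0 ≤ f x) ∧
    ∀ A : Set ℝ, MeasurableSet A →
      (volume.restrict I).withDensity (fun x => ENNReal.ofReal (f x)) (S ⁻¹' A) =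
        (volume.restrict I).withDensity (fun x => ENNReal.ofReal (f x)) A

/-- The inverse branch `g_ω = g₁ ∘ g₀ⁿ` of the word `ω = 10ⁿ`. -/
def wordBranch (g₀ g₁ : ℝ → ℝ → ℝ) (n : ℕ) (ε x : ℝ) : ℝ := g₁ ε ((g₀ ε)^[n] x)

/-- For the order `j` of differentiation in `x ∈ S`: the partial derivatives `∂_ε g^{(j)}` and
`(∂_ε g)^{(j)}` exist, are equal, and are continuous in `(ε, x) ∈ V × S`. -/
structure CommutingPartials (V S : Set ℝ) (j : ℕ) (g : ℝ → ℝ → ℝ) : Prop where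
  contDiffOn : ∀ ε ∈ V, ContDiffOn ℝ j (g ε) S
  contDiffOn_eps : ∀ ε ∈ V, ContDiffOn ℝ j (fun x => deriv (fun e => g e x) ε) S
  comm : ∀ ε ∈ V, ∀ x ∈ S,
    HasDerivAt (fun e => iteratedDerivWithin j (g e) S x)
      (iteratedDerivWithin j (fun y => deriv (fun e => g e y) ε) S x) ε
  continuousOn :
    ContinuousOn (fun p : ℝ × ℝ => deriv (fun e => iteratedDerivWithin j (g e) S p.2) p.1)
      (V ×ˢ S)

/-! ### The two setups -/

/-- A family of interval maps `T ε`, `ε ∈ V`, with two onto increasing branches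
`T₀ ε : [0, 1/2] → [0, 1]` and `T₁ ε : [1/2, 1] → [0, 1]`, their inverses `g₀ ε` and `g₁ ε`, and
the words `10ⁿ` of the inducing scheme on `[1/2, 1]`. -/
structure InducingScheme (V : Set ℝ) (γ : ℝ) (T T₀ T₁ g₀ g₁ : ℝ → ℝ → ℝ) : Prop where
  isOpen : IsOpen V
  zero_mem : (0 : ℝ) ∈ V
  gamma_pos : 0 < γ
  strictMono₀ : ∀ ε ∈ V, StrictMonoOn (T₀ ε) (Icc 0 (1 / 2))
  bijOn₀ : ∀ ε ∈ V, BijOn (T₀ ε) (Icc 0 (1 / 2)) (Icc 0 1)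
  strictMono₁ : ∀ ε ∈ V, StrictMonoOn (T₁ ε) (Icc (1 / 2) 1)
  bijOn₁ : ∀ ε ∈ V, BijOn (T₁ ε) (Icc (1 / 2) 1) (Icc 0 1)
  eq_left : ∀ ε ∈ V, ∀ x ∈ Ico (0 : ℝ) (1 / 2), T ε x = T₀ ε x
  eq_right : ∀ ε ∈ V, ∀ x ∈ Ioc (1 / 2 : ℝ) 1, T ε x = T₁ ε x
  eq_half : ∀ ε ∈ V, T ε (1 / 2) = T₀ ε (1 / 2) ∨ T ε (1 / 2) = T₁ ε (1 / 2)
  inv₀ : ∀ ε ∈ V, ∀ x ∈ Icc (0 : ℝ) (1 / 2), g₀ ε (T₀ ε x) = x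
  inv₁ : ∀ ε ∈ V, ∀ x ∈ Icc (1 / 2 : ℝ) 1, g₁ ε (T₁ ε x) = x
  nonsingular : ∀ ε ∈ V, ∀ A : Set ℝ, MeasurableSet A → volume A = 0 →
    volume (Icc 0 1 ∩ T ε ⁻¹' A) = 0
  comm₀ : ∀ j ≤ 1, CommutingPartials V (Icc 0 1) j (g₀)
  comm₁ : ∀ j ≤ 1, CommutingPartials V (Icc 0 1) j (g₁)
  comm₀_two : CommutingPartials V (Ioc 0 1) 2 g₀
  comm₁_two : CommutingPartials V (Ioc 0 1) 2 g₁
  comm_word : ∀ n, ∀ j ≤ 1, CommutingPartials V (Icc 0 1) j (wordBranch g₀ g₁ n)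
  bound_deriv : ⨆ n, ⨆ ε ∈ V,
    supNorm (Icc 0 1) (fun x => derivWithin (wordBranch g₀ g₁ n ε) (Icc 0 1) x) < ⊤
  bound_eps : ⨆ n, ⨆ ε ∈ V,
    supNorm (Icc 0 1) (fun x => deriv (fun e => wordBranch g₀ g₁ n e x) ε) < ⊤
  sum_deriv : ∑' n, ⨆ ε ∈ V,
    normB γ (fun x => derivWithin (wordBranch g₀ g₁ n ε) (Icc 0 1) x) < ⊤
  sum_eps_deriv : ∑' n, ⨆ ε ∈ V,
    normB γ (fun x => deriv (fun e => derivWithin (wordBranch g₀ g₁ n e) (Icc 0 1) x) ε) < ⊤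

/-- A family of uniformly expanding maps `S ε` of `[a, b]`, `ε ∈ V`, with countably many onto
increasing branches. `g ω ε` is the inverse branch; the partition of `[a, b]` modulo null sets
consists of the open intervals `g ω ε '' (a, b)`. -/
structure ExpandingFamily {Ω : Type} [Countable Ω] (V : Set ℝ) (a b : ℝ)
    (S : ℝ → ℝ → ℝ) (g : Ω → ℝ → ℝ → ℝ) : Prop where
  mapsTo : ∀ ε ∈ V, ∀ ω, MapsTo (g ω ε) (Icc a b) (Icc a b)
  strictMono : ∀ ε ∈ V, ∀ ω, StrictMonoOn (g ω ε) (Icc a b)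
  right_inv : ∀ ε ∈ V, ∀ ω, ∀ x ∈ Ioo a b, S ε (g ω ε x) = x
  disjoint : ∀ ε ∈ V, Pairwise fun ω ω' => Disjoint (g ω ε '' Ioo a b) (g ω' ε '' Ioo a b)
  cover : ∀ ε ∈ V, volume (Icc a b \ ⋃ ω, g ω ε '' Ioo a b) = 0
  smooth : ∀ ε ∈ V, ∀ ω, ContDiffOn ℝ 3 (S ε) (g ω ε '' Ioo a b)
  expanding : ∀ ε ∈ V, ∃ r > 1, ∀ ω, ∀ y ∈ g ω ε '' Ioo a b, r ≤ |deriv (S ε) y|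
  comm : ∀ ω, ∀ j ≤ 2, CommutingPartials V (Icc a b) j (g ω)
  sum_deriv : ∑' ω, ⨆ ε ∈ V,
    supNorm (Icc a b) (fun x => derivWithin (g ω ε) (Icc a b) x) < ⊤
  distortion : ⨆ ω, ⨆ ε ∈ V, supNorm (Icc a b) (fun x =>
    iteratedDerivWithin 2 (g ω ε) (Icc a b) x / derivWithin (g ω ε) (Icc a b) x) < ⊤
  sum_eps_deriv : ∀ i ∈ ({1, 2} : Set ℕ), ∑' ω, ⨆ ε ∈ V,
    supNorm (Icc a b) (fun x => deriv (fun e => iteratedDerivWithin i (g ω e) (Icc a b) x) ε) < ⊤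

/-! ### Operators -/

/-- `Σ_ω Φ ∘ g_ω · g_ω'`, the derivative being taken in `I`. For the inverse branches of a map
of `I` this is its Perron–Frobenius operator. -/
def transfer {Ω : Type} (I : Set ℝ) (g : Ω → ℝ → ℝ) (Φ : ℝ → ℝ) (x : ℝ) : ℝ :=
  ∑' ω, Φ (g ω x) * derivWithin (g ω) I x

/-- `F Φ = 1_Δ Φ + (1 - 1_Δ) Σ_ω Φ ∘ g_ω · g_ω'` on `[0, 1]`, with `Δ = [1/2, 1]`. -/
def opF (g : ℕ → ℝ → ℝ) (Φ : ℝ → ℝ) (x : ℝ) : ℝ :=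
  (Icc (1 / 2) 1).indicator Φ x + (Icc (1 / 2) 1)ᶜ.indicator (transfer (Icc 0 1) g Φ) x

/-- The term `Φ' ∘ g_ω · a_ω g_ω' + Φ ∘ g_ω · b_ω` of `Q Φ`, where `a_ω` and `b_ω` are the
`ε`-derivatives at `0` of `g_ω` and of `g_ω'`. -/
def termQ (g : ℕ → ℝ → ℝ → ℝ) (Φ : ℝ → ℝ) (n : ℕ) (x : ℝ) : ℝ :=
  derivWithin Φ (Icc (1 / 2) 1) (g n 0 x) * deriv (fun e => g n e x) 0 *
      derivWithin (g n 0) (Icc 0 1) x +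
    Φ (g n 0 x) * deriv (fun e => derivWithin (g n e) (Icc 0 1) x) 0

/-- `Q Φ = (1 - 1_Δ) Σ_ω (Φ' ∘ g_ω · a_ω g_ω' + Φ ∘ g_ω · b_ω)`. -/
def opQ (g : ℕ → ℝ → ℝ → ℝ) (Φ : ℝ → ℝ) (x : ℝ) : ℝ :=
  (Icc (1 / 2) 1)ᶜ.indicator (fun y => ∑' n, termQ g Φ n y) x

/-- `A₀ = -(∂_ε S / S')` at `ε = 0`. -/
def coefA (S : ℝ → ℝ → ℝ) (x : ℝ) : ℝ := -(deriv (fun e => S e x) 0 / deriv (S 0) x)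

/-- `B₀ = ∂_ε S · S'' / S'² - ∂_ε S' / S'` at `ε = 0`. -/
def coefB (S : ℝ → ℝ → ℝ) (x : ℝ) : ℝ :=
  deriv (fun e => S e x) 0 * deriv (deriv (S 0)) x / deriv (S 0) x ^ 2 -
    deriv (fun e => deriv (S e) x) 0 / deriv (S 0) x

/-- `u = (I - L)⁻¹ f` on the space of `C¹` functions on `[a, b]` with zero average: `u` belongs to
that space and solves `u - L u = f` on `[a, b]`, where `L` is the Perron–Frobenius operator. -/
def IsResolvent {Ω : Type} (a b : ℝ) (g : Ω → ℝ → ℝ) (f u : ℝ → ℝ) : Prop :=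
  MemC10 a b u ∧ ∀ x ∈ Icc a b, u x - transfer (Icc a b) g u x = f x

end LinearResponse

end

/-!
Write `L_ε` for the operator `Φ ↦ Σ_ω Φ ∘ g_ω · g_ω'` of the induced map, `ĥ_ε` for its invariant
density and `q` for the derivative of `L_ε ĥ_0` at `ε = 0`.

*Resolvent.* By bounded distortion `L_ε` maps a cone of functions with Lipschitz logarithm into a
strictly smaller one. Two functions of the cone with equal mass can be coupled: at each step a
definite fraction of both becomes the same constant, and what is left stays in the cone
(`ExpandingBranches.exists_coupling`). So the iterates of `L_ε` contract the `C¹` functions of zero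
average exponentially, with constants that depend only on the expansion and the distortion
(`exists_contraction`), and the Neumann series inverts `I - L_ε` there, with a bound uniform in `ε`
near `0` (`ExpandingBranches.exists_resolvent`, `exists_resolvent_bound`). By density of the `C¹`
functions, an integrable fixed function of zero average vanishes
(`ExpandingBranches.ae_eq_zero`), so that invariant densities are unique.

*Densities.* An invariant measure `μ` of the full map satisfies `μ A = μ (g₀ A) + μ (g₁ A)`.
Iterating on the first summand gives `μ A = Σ_ω μ (g_ω A)` plus a remainder `lim μ (g₀ⁿ A)`. For
`A = (1/2, 1)` the series already carries the whole, finite mass because the `g_ω A` partition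
`[1/2, 1]`, so the remainder vanishes; it then vanishes for every `A` in some `g₀ᵏ (1/2, 1)`, and
these sets fill `[0, 1]` (`TwoBranches.measure_eq_tsum`, `TwoBranches.volume_diff_iUnion`). Hence
`h_ε = Σ_ω h_ε ∘ g_ω · g_ω'` on `[0, 1]`; on `[1/2, 1]` this is the fixed point equation of `L_ε`,
and uniqueness identifies `h_ε` with `ĥ_ε` there (`TwoBranches.ae_eq_branchSum`).

*Response.* With `u = (I - L_0)⁻¹ q` the difference `v = (ĥ_ε - ĥ_0) / ε - u` solves
`v - L_ε v = ((L_ε - L_0) ĥ_0 / ε - q) + (L_ε - L_0) u`. The right-hand side tends to zero in `C¹`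
by termwise differentiation of dominated series, so `v` tends to zero uniformly by the resolvent
bound (`BranchFamily.induced_response`). Because `ĥ_ε = L_ε ĥ_ε` and `u = L_0 u + q` on `[1/2, 1]`,
the functions `F_ε ĥ_ε` and `F_0 u + Q ĥ_0` are given by the same series on all of `(0, 1]`
(`opF_eq_branchSum`, `opF_add_opQ_eq`), with no gluing at `1/2`, and the weighted bounds on the
branches carry the convergence over to `(0, 1]` (`BranchFamily.weighted_response`).

*Coefficients.* The value of the induced map at a fixed point `y` of the image of `g_ω` solves
`g_{ω,ε}(z) = y`, so the implicit function theorem gives the derivatives in `A₀` and `B₀`, and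
`A₀ ∘ g_ω = a_ω`, `B₀ ∘ g_ω · g_ω' = b_ω` (`BranchFamily.coef_eq`). This turns `q` into
`L_0 (A₀ ĥ_0' + B₀ ĥ_0)`.
-/

namespace LinearResponse

section

/-! ### Continuously differentiable functions on a compact interval -/

/-- `u` is of class `C¹` on `[a, b]` with derivative `u'`, one-sided at the endpoints. -/
structure IsC1 (a b : ℝ) (u u' : ℝ → ℝ) : Prop where
  hasDeriv : ∀ x ∈ Icc a b, HasDerivWithinAt u (u' x) (Icc a b) x
  cont_deriv : ContinuousOn u' (Icc a b)

variable {a b : ℝ} {u u' v v' : ℝ → ℝ}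

theorem IsC1.continuousOn (h : IsC1 a b u u') : ContinuousOn u (Icc a b) :=
  fun x hx => (h.hasDeriv x hx).continuousWithinAt

theorem IsC1.derivWithin_eq (hab : a < b) (h : IsC1 a b u u') {x : ℝ} (hx : x ∈ Icc a b) :
    derivWithin u (Icc a b) x = u' x :=
  (h.hasDeriv x hx).derivWithin (uniqueDiffOn_Icc hab x hx)

theorem IsC1.contDiffOn (hab : a < b) (h : IsC1 a b u u') : ContDiffOn ℝ 1 u (Icc a b) := by
  rw [contDiffOn_one_iff_derivWithin (uniqueDiffOn_Icc hab)]
  refine ⟨fun x hx => (h.hasDeriv x hx).differentiableWithinAt, ?_⟩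
  exact h.cont_deriv.congr fun x hx => h.derivWithin_eq hab hx

theorem isC1_of_contDiffOn (hab : a < b) (h : ContDiffOn ℝ 1 u (Icc a b)) :
    IsC1 a b u (derivWithin u (Icc a b)) := by
  rw [contDiffOn_one_iff_derivWithin (uniqueDiffOn_Icc hab)] at h
  exact ⟨fun x hx => (h.1 x hx).hasDerivWithinAt, h.2⟩

theorem IsC1.add (h : IsC1 a b u u') (k : IsC1 a b v v') :
    IsC1 a b (fun x => u x + v x) (fun x => u' x + v' x) :=
  ⟨fun x hx => (h.hasDeriv x hx).add (k.hasDeriv x hx), h.cont_deriv.add k.cont_deriv⟩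

theorem IsC1.sub (h : IsC1 a b u u') (k : IsC1 a b v v') :
    IsC1 a b (fun x => u x - v x) (fun x => u' x - v' x) :=
  ⟨fun x hx => (h.hasDeriv x hx).sub (k.hasDeriv x hx), h.cont_deriv.sub k.cont_deriv⟩

theorem IsC1.div_const (h : IsC1 a b u u') (c : ℝ) :
    IsC1 a b (fun x => u x / c) (fun x => u' x / c) :=
  ⟨fun x hx => (h.hasDeriv x hx).div_const c, h.cont_deriv.div_const c⟩

theorem isC1_const (c : ℝ) : IsC1 a b (fun _ => c) (fun _ => 0) :=
  ⟨fun _ _ => hasDerivWithinAt_const _ _ _, continuousOn_const⟩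

theorem IsC1.congr (h : IsC1 a b u u') (huv : EqOn v u (Icc a b)) : IsC1 a b v u' :=
  ⟨fun x hx => (h.hasDeriv x hx).congr huv (huv hx), h.cont_deriv⟩

theorem IsC1.integrableOn (h : IsC1 a b u u') : IntegrableOn u (Icc a b) :=
  h.continuousOn.integrableOn_Icc

/-- A bound for `u` and `u'` on the compact interval. -/
theorem IsC1.exists_bound (h : IsC1 a b u u') :
    ∃ B, 0 ≤ B ∧ ∀ x ∈ Icc a b, |u x| ≤ B ∧ |u' x| ≤ B := by
  obtain ⟨B₁, h₁⟩ := isCompact_Icc.exists_bound_of_continuousOn h.continuousOn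
  obtain ⟨B₂, h₂⟩ := isCompact_Icc.exists_bound_of_continuousOn h.cont_deriv
  refine ⟨max 0 (max B₁ B₂), le_max_left _ _, fun x hx => ⟨?_, ?_⟩⟩
  · exact (h₁ x hx).trans ((le_max_left _ _).trans (le_max_right _ _))
  · exact (h₂ x hx).trans ((le_max_right _ _).trans (le_max_right _ _))

/-- Termwise differentiation on a compact interval, up to the endpoints. The endpoints are reached
because the sum of the derivatives extends continuously to them. -/
theorem IsC1.tsum (hab : a < b) {f f' : ℕ → ℝ → ℝ} {M : ℕ → ℝ} (hM : Summable M)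
    (h : ∀ n, IsC1 a b (f n) (f' n)) (hf : ∀ n, ∀ x ∈ Icc a b, |f n x| ≤ M n)
    (hf' : ∀ n, ∀ x ∈ Icc a b, |f' n x| ≤ M n) :
    IsC1 a b (fun x => ∑' n, f n x) (fun x => ∑' n, f' n x) := by
  have hc : ContinuousOn (fun x => ∑' n, f n x) (Icc a b) :=
    continuousOn_tsum (fun n => (h n).continuousOn) hM hf
  have hc' : ContinuousOn (fun x => ∑' n, f' n x) (Icc a b) :=
    continuousOn_tsum (fun n => (h n).cont_deriv) hM hf'
  have hi : ∀ x ∈ Ioo a b, HasDerivAt (fun x => ∑' n, f n x) (∑' n, f' n x) x := by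
    intro x hx
    refine hasDerivAt_tsum_of_isPreconnected hM isOpen_Ioo isPreconnected_Ioo
      (fun n y hy => ?_) (fun n y hy => hf' n y (Ioo_subset_Icc_self hy)) hx ?_ hx
    · exact ((h n).hasDeriv y (Ioo_subset_Icc_self hy)).hasDerivAt (Icc_mem_nhds hy.1 hy.2)
    · exact Summable.of_norm_bounded hM fun n => hf n x (Ioo_subset_Icc_self hx)
  refine ⟨fun x hx => ?_, hc'⟩
  have hcl : closure (Ioo a b) = Icc a b := closure_Ioo hab.ne
  have key := hasFDerivWithinAt_closure_of_tendsto_fderiv (f := fun x => ∑' n, f n x)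
    (s := Ioo a b) (x := x)
    (f' := ContinuousLinearMap.toSpanSingleton ℝ (∑' n, f' n x))
    (fun y hy => (hi y hy).differentiableAt.differentiableWithinAt) (convex_Ioo a b) isOpen_Ioo
    (fun y hy => (hc y (hcl ▸ hy)).mono Ioo_subset_Icc_self) ?_
  · rw [hcl] at key
    simpa using key.hasDerivWithinAt
  · have h1 : Tendsto (fun y => ContinuousLinearMap.toSpanSingleton ℝ (∑' n, f' n y))
        (𝓝[Ioo a b] x) (𝓝 (ContinuousLinearMap.toSpanSingleton ℝ (∑' n, f' n x))) :=
      ((ContinuousLinearMap.toSpanSingletonCLE (𝕜 := ℝ) (E := ℝ)).continuous.tendsto _).comp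
        ((hc' x hx).mono Ioo_subset_Icc_self)
    refine h1.congr' ?_
    filter_upwards [self_mem_nhdsWithin] with y hy
    exact (hi y hy).hasFDerivAt.fderiv.symm

/-! ### Series converging uniformly in a parameter -/

/-- Tannery's theorem, uniformly over a set `S`. -/
theorem tannery_uniform {ι : Type*} {l : Filter ι} {S : Set ℝ} {k : ℕ → ι → ℝ → ℝ} {M : ℕ → ℝ}
    (hM : Summable M) (hk : ∀ᶠ i in l, ∀ n, ∀ x ∈ S, |k n i x| ≤ M n)
    (hlim : ∀ n, ∀ η > 0, ∀ᶠ i in l, ∀ x ∈ S, |k n i x| ≤ η) :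
    ∀ η > 0, ∀ᶠ i in l, ∀ x ∈ S, |∑' n, k n i x| ≤ η := by
  rcases S.eq_empty_or_nonempty with rfl | ⟨x₀, hx₀⟩
  · simp
  intro η hη
  rcases l.eq_or_neBot with rfl | hl
  · simp
  have hM0 : ∀ n, 0 ≤ M n := fun n => by
    obtain ⟨i, hi⟩ := hk.exists
    exact (abs_nonneg _).trans (hi n x₀ hx₀)
  -- the suprema over `S` of the terms form a dominated family
  set s : ι → ℕ → ℝ := fun i n => ⨆ x : S, |k n i x| with hs
  have hle : ∀ i n, (∀ x ∈ S, |k n i x| ≤ M n) → ∀ x ∈ S, |k n i x| ≤ s i n := by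
    intro i n h x hx
    exact le_ciSup (f := fun x : S => |k n i x|)
      ⟨M n, by rintro _ ⟨y, rfl⟩; exact h y y.2⟩ ⟨x, hx⟩
  have hs0 : ∀ i n, 0 ≤ s i n := fun i n => Real.iSup_nonneg fun _ => abs_nonneg _
  have hT : Tendsto (fun i => ∑' n, s i n) l (𝓝 (∑' _ : ℕ, (0 : ℝ))) := by
    refine tendsto_tsum_of_dominated_convergence hM (fun n => ?_) ?_
    · rw [Metric.tendsto_nhds]
      intro δ hδ
      filter_upwards [hlim n (δ / 2) (half_pos hδ)] with i hi
      rw [Real.dist_0_eq_abs, abs_of_nonneg (hs0 i n)]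
      exact (Real.iSup_le (fun x : S => hi x x.2) (half_pos hδ).le).trans_lt (half_lt_self hδ)
    · filter_upwards [hk] with i hi n
      rw [Real.norm_of_nonneg (hs0 i n)]
      exact Real.iSup_le (fun x : S => hi n x x.2) (hM0 n)
  rw [tsum_zero] at hT
  filter_upwards [hk, hT.eventually (gt_mem_nhds hη)] with i hi hlt x hx
  have hsum : Summable (s i) :=
    Summable.of_nonneg_of_le (hs0 i) (fun n => Real.iSup_le (fun x : S => hi n x x.2) (hM0 n)) hM
  have h1 : ∀ n, ‖k n i x‖ ≤ s i n := fun n => hle i n (hi n) x hx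
  exact (tsum_of_norm_bounded hsum.hasSum h1).trans (le_of_lt hlt)

/-- Continuity in the parameter, uniformly over a compact set. -/
theorem eventually_abs_sub_le {V S : Set ℝ} (hV : IsOpen V) (h0 : (0 : ℝ) ∈ V) (hS : IsCompact S)
    {f : ℝ → ℝ → ℝ} (hf : ContinuousOn (fun p : ℝ × ℝ => f p.1 p.2) (V ×ˢ S)) {η : ℝ}
    (hη : 0 < η) : ∀ᶠ ε in 𝓝 0, ∀ x ∈ S, |f ε x - f 0 x| ≤ η := by
  obtain ⟨v, hv, h⟩ := hS.mem_uniformity_of_prod (f := f) (s := V) hf h0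
    (Metric.dist_mem_uniformity hη)
  rw [hV.nhdsWithin_eq h0] at hv
  filter_upwards [hv] with ε hε x hx
  exact (h ε hε x hx).le

/-- Series with dominated, jointly continuous terms depend continuously on the parameter, uniformly
over a compact set. -/
theorem tsum_sub_le {V S : Set ℝ} (hV : IsOpen V) (h0 : (0 : ℝ) ∈ V) (hS : IsCompact S)
    {f : ℕ → ℝ → ℝ → ℝ} {M : ℕ → ℝ} (hM : Summable M)
    (hc : ∀ n, ContinuousOn (fun p : ℝ × ℝ => f n p.1 p.2) (V ×ˢ S))
    (hf : ∀ n, ∀ ε ∈ V, ∀ x ∈ S, |f n ε x| ≤ M n) :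
    ∀ η > 0, ∀ᶠ ε in 𝓝 0, ∀ x ∈ S, |∑' n, f n ε x - ∑' n, f n 0 x| ≤ η := by
  intro η hη
  have hV' : ∀ᶠ ε in 𝓝 (0 : ℝ), ε ∈ V := hV.mem_nhds h0
  have := tannery_uniform (l := 𝓝 (0 : ℝ)) (S := S) (k := fun n ε x => f n ε x - f n 0 x)
    (M := fun n => 2 * M n) (hM.mul_left 2) ?_ ?_ η hη
  · filter_upwards [this, hV'] with ε hε hεV x hx
    have hs : ∀ e ∈ V, Summable fun n => f n e x := fun e he =>
      Summable.of_norm_bounded hM fun n => hf n e he x hx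
    rw [← (hs ε hεV).tsum_sub (hs 0 h0)]
    exact hε x hx
  · filter_upwards [hV'] with ε hε n x hx
    have := abs_sub (f n ε x) (f n 0 x)
    linarith [hf n ε hε x hx, hf n 0 h0 x hx]
  · intro n δ hδ
    exact eventually_abs_sub_le hV h0 hS (hc n) hδ

/-- The mean value inequality in the parameter. -/
theorem abs_slope_sub_le {r : ℝ} {f f' : ℝ → ℝ} {c C : ℝ}
    (hf : ∀ ε ∈ Metric.ball (0 : ℝ) r, HasDerivAt f (f' ε) ε)
    (hC : ∀ ε ∈ Metric.ball (0 : ℝ) r, |f' ε - c| ≤ C) {ε : ℝ} (hε : ε ∈ Metric.ball (0 : ℝ) r)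
    (hne : ε ≠ 0) : |(f ε - f 0) / ε - c| ≤ C := by
  have h0 : (0 : ℝ) ∈ Metric.ball (0 : ℝ) r :=
    Metric.mem_ball_self (Metric.pos_of_mem_ball hε)
  have := (convex_ball (0 : ℝ) r).norm_image_sub_le_of_norm_hasDerivWithin_le
    (f := fun e => f e - c * e) (f' := fun e => f' e - c) (C := C)
    (fun e he => ((hf e he).sub (by simpa using (hasDerivAt_id e).const_mul c)).hasDerivWithinAt)
    hC h0 hε
  have h2 : (f ε - f 0) / ε - c = (f ε - c * ε - (f 0 - c * 0)) / ε := by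
    field_simp
    ring
  rw [h2, abs_div, div_le_iff₀ (abs_pos.2 hne)]
  simpa using this

/-- Series with dominated, jointly continuous derivatives in the parameter may be differentiated
termwise at `0`, uniformly over a compact set. -/
theorem tsum_slope_sub_le {V S : Set ℝ} (hV : IsOpen V) (h0 : (0 : ℝ) ∈ V) (hS : IsCompact S)
    {f f' : ℕ → ℝ → ℝ → ℝ} {M : ℕ → ℝ} (hM : Summable M)
    (hd : ∀ n, ∀ ε ∈ V, ∀ x ∈ S, HasDerivAt (fun e => f n e x) (f' n ε x) ε)
    (hc : ∀ n, ContinuousOn (fun p : ℝ × ℝ => f' n p.1 p.2) (V ×ˢ S))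
    (hf' : ∀ n, ∀ ε ∈ V, ∀ x ∈ S, |f' n ε x| ≤ M n)
    (hs : ∀ ε ∈ V, ∀ x ∈ S, Summable fun n => f n ε x) :
    ∀ η > 0, ∀ᶠ ε in 𝓝[≠] 0, ∀ x ∈ S,
      |(∑' n, f n ε x - ∑' n, f n 0 x) / ε - ∑' n, f' n 0 x| ≤ η := by
  intro η hη
  obtain ⟨r, hr, hrV⟩ := Metric.isOpen_iff.1 hV 0 h0
  have hball : ∀ᶠ ε in 𝓝[≠] (0 : ℝ), ε ∈ Metric.ball (0 : ℝ) r ∧ ε ≠ 0 :=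
    Filter.Eventually.and (nhdsWithin_le_nhds (Metric.ball_mem_nhds 0 hr)) self_mem_nhdsWithin
  have := tannery_uniform (l := 𝓝[≠] (0 : ℝ)) (S := S)
    (k := fun n ε x => (f n ε x - f n 0 x) / ε - f' n 0 x)
    (M := fun n => 2 * M n) (hM.mul_left 2) ?_ ?_ η hη
  · filter_upwards [this, hball] with ε hε hεV x hx
    have h1 := (((hs ε (hrV hεV.1) x hx).sub (hs 0 h0 x hx)).div_const ε)
    have h2 : Summable fun n => f' n 0 x := Summable.of_norm_bounded hM fun n => hf' n 0 h0 x hx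
    rw [← (hs ε (hrV hεV.1) x hx).tsum_sub (hs 0 h0 x hx), ← tsum_div_const, ← h1.tsum_sub h2]
    exact hε x hx
  · filter_upwards [hball] with ε hε n x hx
    refine abs_slope_sub_le (fun e he => hd n e (hrV he) x hx) (fun e he => ?_) hε.1 hε.2
    have := abs_sub (f' n e x) (f' n 0 x)
    linarith [hf' n e (hrV he) x hx, hf' n 0 h0 x hx]
  · intro n δ hδ
    obtain ⟨ρ, hρ, h1⟩ := Metric.eventually_nhds_iff_ball.1
      (eventually_abs_sub_le hV h0 hS (hc n) hδ)
    have hb : ∀ᶠ ε in 𝓝[≠] (0 : ℝ), ε ∈ Metric.ball (0 : ℝ) (min r ρ) ∧ ε ≠ 0 :=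
      Filter.Eventually.and (nhdsWithin_le_nhds (Metric.ball_mem_nhds 0 (lt_min hr hρ)))
        self_mem_nhdsWithin
    filter_upwards [hb] with ε hε x hx
    refine abs_slope_sub_le (fun e he => hd n e (hrV ?_) x hx) (fun e he => ?_) hε.1 hε.2
    · exact Metric.ball_subset_ball (min_le_left _ _) he
    · exact h1 e (Metric.ball_subset_ball (min_le_right _ _) he) x hx

end

section

/-! ### The transfer operator of a full-branch expanding map -/

/-- The operator `Φ ↦ Σ_n Φ ∘ g_n · w_n`. With `w_n = g_n'` this is `transfer`. -/
noncomputable def branchSum (g w : ℕ → ℝ → ℝ) (Φ : ℝ → ℝ) (x : ℝ) : ℝ := ∑' n, Φ (g n x) * w n x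

/-- The inverse branches `g n` of a piecewise increasing map of `[a, b]` with full branches,
expanding at rate `lam⁻¹`, with distortion at most `D`. The functions `g₁ n` and `g₂ n` are the
first two derivatives of `g n`. -/
structure ExpandingBranches (a b lam D : ℝ) (g g₁ g₂ : ℕ → ℝ → ℝ) : Prop where
  lt : a < b
  mapsTo : ∀ n, MapsTo (g n) (Icc a b) (Icc a b)
  isC1 : ∀ n, IsC1 a b (g n) (g₁ n)
  isC1' : ∀ n, IsC1 a b (g₁ n) (g₂ n)
  nonneg : ∀ n, ∀ x ∈ Icc a b, 0 ≤ g₁ n x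
  le : ∀ n, ∀ x ∈ Icc a b, g₁ n x ≤ lam
  lam_lt : lam < 1
  dist_nonneg : 0 ≤ D
  dist : ∀ n, ∀ x ∈ Icc a b, |g₂ n x| ≤ D * g₁ n x
  exists_bound : ∃ M : ℕ → ℝ, Summable M ∧ ∀ n, ∀ x ∈ Icc a b, g₁ n x ≤ M n
  strictMono : ∀ n, StrictMonoOn (g n) (Icc a b)
  disjoint : Pairwise fun n m => Disjoint (g n '' Ioo a b) (g m '' Ioo a b)
  cover : volume (Icc a b \ ⋃ n, g n '' Ioo a b) = 0

theorem abs_mul_le_of_nonneg {x y B M : ℝ} (hx : |x| ≤ B) (hy : 0 ≤ y) (hyM : y ≤ M) :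
    |x * y| ≤ B * M := by
  rw [abs_mul, abs_of_nonneg hy]
  exact mul_le_mul hx hyM hy ((abs_nonneg _).trans hx)

variable {a b lam D : ℝ} {g g₁ g₂ : ℕ → ℝ → ℝ} {u u' v v' : ℝ → ℝ}

namespace ExpandingBranches

theorem lam_nonneg (h : ExpandingBranches a b lam D g g₁ g₂) : 0 ≤ lam :=
  (h.nonneg 0 a (left_mem_Icc.2 h.lt.le)).trans (h.le 0 a (left_mem_Icc.2 h.lt.le))

theorem iUnion_ae_eq (h : ExpandingBranches a b lam D g g₁ g₂) :
    (⋃ n, g n '' Ioo a b : Set ℝ) =ᵐ[volume] Icc a b :=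
  (LE.le.eventuallyLE (iUnion_subset fun n =>
    ((h.mapsTo n).mono_left Ioo_subset_Icc_self).image_subset)).antisymm (ae_le_set.2 h.cover)

theorem measurableSet_image (h : ExpandingBranches a b lam D g g₁ g₂) (n : ℕ) :
    MeasurableSet (g n '' Ioo a b) :=
  measurableSet_Ioo.image_of_continuousOn_injOn
    ((h.isC1 n).continuousOn.mono Ioo_subset_Icc_self)
    ((h.strictMono n).injOn.mono Ioo_subset_Icc_self)

/-- Change of variables on each branch. -/
theorem setLIntegral_eq_tsum (h : ExpandingBranches a b lam D g g₁ g₂) (H : ℝ → ℝ≥0∞) :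
    ∫⁻ x in Icc a b, H x = ∑' n, ∫⁻ x in Icc a b, ENNReal.ofReal (g₁ n x) * H (g n x) := by
  rw [← setLIntegral_congr h.iUnion_ae_eq, lintegral_iUnion h.measurableSet_image h.disjoint]
  refine tsum_congr fun n => ?_
  rw [lintegral_image_eq_lintegral_deriv_mul_of_monotoneOn measurableSet_Ioo (f' := g₁ n)
    (fun x hx => ((h.isC1 n).hasDeriv x (Ioo_subset_Icc_self hx)).mono Ioo_subset_Icc_self)
    ((h.strictMono n).monotoneOn.mono Ioo_subset_Icc_self)]
  exact setLIntegral_congr Ioo_ae_eq_Icc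

theorem hasSum_setIntegral (h : ExpandingBranches a b lam D g g₁ g₂)
    (hu : IntegrableOn u (Icc a b)) :
    HasSum (fun n => ∫ x in Icc a b, u (g n x) * g₁ n x) (∫ x in Icc a b, u x) := by
  have h1 := hasSum_integral_iUnion (f := u) (μ := volume) h.measurableSet_image h.disjoint
    (hu.congr_set_ae h.iUnion_ae_eq)
  rw [setIntegral_congr_set h.iUnion_ae_eq] at h1
  have h2 : ∀ n, ∫ x in g n '' Ioo a b, u x = ∫ x in Icc a b, u (g n x) * g₁ n x := fun n => by
    rw [integral_image_eq_integral_deriv_smul_of_monotoneOn measurableSet_Ioo (f' := g₁ n)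
      (fun x hx => ((h.isC1 n).hasDeriv x (Ioo_subset_Icc_self hx)).mono Ioo_subset_Icc_self)
      ((h.strictMono n).monotoneOn.mono Ioo_subset_Icc_self), integral_Icc_eq_integral_Ioo]
    simp only [smul_eq_mul, mul_comm]
  simpa only [h2] using h1

theorem summable_term (h : ExpandingBranches a b lam D g g₁ g₂) (hu : ContinuousOn u (Icc a b))
    {x : ℝ} (hx : x ∈ Icc a b) : Summable fun n => u (g n x) * g₁ n x := by
  obtain ⟨M, hM, hgM⟩ := h.exists_bound
  obtain ⟨B, hB⟩ := isCompact_Icc.exists_bound_of_continuousOn hu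
  exact Summable.of_norm_bounded (hM.mul_left B) fun n =>
    abs_mul_le_of_nonneg (hB _ (h.mapsTo n hx)) (h.nonneg n x hx) (hgM n x hx)

theorem integral_branchSum (h : ExpandingBranches a b lam D g g₁ g₂)
    (hu : ContinuousOn u (Icc a b)) :
    ∫ x in Icc a b, branchSum g g₁ u x = ∫ x in Icc a b, u x := by
  obtain ⟨M, hM, hgM⟩ := h.exists_bound
  obtain ⟨B, hB⟩ := isCompact_Icc.exists_bound_of_continuousOn hu
  refine HasSum.unique ?_ (h.hasSum_setIntegral hu.integrableOn_Icc)
  refine hasSum_integral_of_dominated_convergence (fun n _ => B * M n) (fun n => ?_) (fun n => ?_)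
    (ae_of_all _ fun _ => hM.mul_left B) ?_ ?_
  · exact ((hu.comp (h.isC1 n).continuousOn (h.mapsTo n)).mul
      (h.isC1' n).continuousOn).aestronglyMeasurable measurableSet_Icc
  · filter_upwards [ae_restrict_mem measurableSet_Icc] with x hx
    exact abs_mul_le_of_nonneg (hB _ (h.mapsTo n hx)) (h.nonneg n x hx) (hgM n x hx)
  · exact integrable_const _
  · filter_upwards [ae_restrict_mem measurableSet_Icc] with x hx
    exact (h.summable_term hu hx).hasSum

theorem branchSum_congr (h : ExpandingBranches a b lam D g g₁ g₂) (huv : EqOn u v (Icc a b)) :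
    EqOn (branchSum g g₁ u) (branchSum g g₁ v) (Icc a b) := fun x hx =>
  tsum_congr fun n => by rw [huv (h.mapsTo n hx)]

theorem branchSum_add (h : ExpandingBranches a b lam D g g₁ g₂) (hu : ContinuousOn u (Icc a b))
    (hv : ContinuousOn v (Icc a b)) {x : ℝ} (hx : x ∈ Icc a b) :
    branchSum g g₁ (fun y => u y + v y) x = branchSum g g₁ u x + branchSum g g₁ v x := by
  simp only [branchSum, add_mul]
  exact (h.summable_term hu hx).tsum_add (h.summable_term hv hx)

theorem branchSum_sub (h : ExpandingBranches a b lam D g g₁ g₂) (hu : ContinuousOn u (Icc a b))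
    (hv : ContinuousOn v (Icc a b)) {x : ℝ} (hx : x ∈ Icc a b) :
    branchSum g g₁ (fun y => u y - v y) x = branchSum g g₁ u x - branchSum g g₁ v x := by
  simp only [branchSum, sub_mul]
  exact (h.summable_term hu hx).tsum_sub (h.summable_term hv hx)

theorem isC1_term (h : ExpandingBranches a b lam D g g₁ g₂) (hu : IsC1 a b u u') (n : ℕ) :
    IsC1 a b (fun x => u (g n x) * g₁ n x)
      (fun x => u' (g n x) * g₁ n x * g₁ n x + u (g n x) * g₂ n x) := by
  refine ⟨fun x hx => ?_, ?_⟩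
  · exact ((hu.hasDeriv _ (h.mapsTo n hx)).comp x ((h.isC1 n).hasDeriv x hx) (h.mapsTo n)).mul
      ((h.isC1' n).hasDeriv x hx)
  · have hg := (h.isC1 n).continuousOn
    have hg₁ := (h.isC1' n).continuousOn
    exact (((hu.cont_deriv.comp hg (h.mapsTo n)).mul hg₁).mul hg₁).add
      ((hu.continuousOn.comp hg (h.mapsTo n)).mul (h.isC1' n).cont_deriv)

theorem abs_deriv_term_le (h : ExpandingBranches a b lam D g g₁ g₂) {B B' : ℝ} {n : ℕ} {x : ℝ}
    (hx : x ∈ Icc a b) (hu : |u (g n x)| ≤ B) (hu' : |u' (g n x)| ≤ B') :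
    |u' (g n x) * g₁ n x * g₁ n x + u (g n x) * g₂ n x| ≤ (lam * B' + D * B) * g₁ n x := by
  have h1 := h.nonneg n x hx
  have h2 : |u' (g n x) * g₁ n x * g₁ n x| ≤ B' * lam * g₁ n x :=
    abs_mul_le_of_nonneg (abs_mul_le_of_nonneg hu' h1 (h.le n x hx)) h1 le_rfl
  have h3 : |u (g n x) * g₂ n x| ≤ B * (D * g₁ n x) := by
    rw [abs_mul]
    exact mul_le_mul hu (h.dist n x hx) (abs_nonneg _) ((abs_nonneg _).trans hu)
  calc _ ≤ B' * lam * g₁ n x + B * (D * g₁ n x) := (abs_add_le _ _).trans (add_le_add h2 h3)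
    _ = _ := by ring

theorem isC1_branchSum (h : ExpandingBranches a b lam D g g₁ g₂) (hu : IsC1 a b u u') :
    IsC1 a b (branchSum g g₁ u)
      (fun x => ∑' n, (u' (g n x) * g₁ n x * g₁ n x + u (g n x) * g₂ n x)) := by
  obtain ⟨M, hM, hgM⟩ := h.exists_bound
  obtain ⟨B, hB0, hB⟩ := hu.exists_bound
  have hlam := h.lam_nonneg
  have hD := h.dist_nonneg
  have hM0 : ∀ n, 0 ≤ M n := fun n =>
    (h.nonneg n a (left_mem_Icc.2 h.lt.le)).trans (hgM n a (left_mem_Icc.2 h.lt.le))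
  have hK : 0 ≤ lam * B + D * B := by positivity
  refine IsC1.tsum h.lt (hM.mul_left (B + (lam * B + D * B))) (fun n => h.isC1_term hu n)
    (fun n x hx => ?_) (fun n x hx => ?_)
  · refine (abs_mul_le_of_nonneg (hB _ (h.mapsTo n hx)).1 (h.nonneg n x hx) (hgM n x hx)).trans ?_
    exact mul_le_mul_of_nonneg_right (by linarith) (hM0 n)
  · refine (h.abs_deriv_term_le hx (hB _ (h.mapsTo n hx)).1 (hB _ (h.mapsTo n hx)).2).trans ?_
    exact mul_le_mul (by linarith) (hgM n x hx) (h.nonneg n x hx) (by linarith)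

end ExpandingBranches

/-! ### Contraction by coupling in a cone -/

/-- The cone of functions whose logarithm is `α`-Lipschitz on `[a, b]`. -/
structure LogCone (a b α : ℝ) (u u' : ℝ → ℝ) : Prop where
  isC1 : IsC1 a b u u'
  le : ∀ x ∈ Icc a b, |u' x| ≤ α * u x

namespace LogCone

variable {α : ℝ}

theorem nonneg (hα : 0 < α) (h : LogCone a b α u u') {x : ℝ} (hx : x ∈ Icc a b) : 0 ≤ u x :=
  nonneg_of_mul_nonneg_right ((abs_nonneg _).trans (h.le x hx)) hα

/-- The Harnack inequality in the cone. -/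
theorem le_exp_mul (hα : 0 < α) (h : LogCone a b α u u') {x y : ℝ}
    (hx : x ∈ Icc a b) (hy : y ∈ Icc a b) : Real.exp (-(α * (b - a))) * u x ≤ u y := by
  -- `u e^{αx}` is increasing and `u e^{-αx}` is decreasing
  have hmono : MonotoneOn (fun z => u z * Real.exp (α * z)) (Icc a b) := by
    refine monotoneOn_of_hasDerivWithinAt_nonneg (f' := fun z => u' z * Real.exp (α * z) +
      u z * (Real.exp (α * z) * α)) (convex_Icc a b) (h.isC1.continuousOn.mul (by fun_prop))
      (fun z hz => ?_) fun z hz => ?_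
    · refine ((h.isC1.hasDeriv z (interior_subset hz)).mono interior_subset).mul ?_
      simpa using ((hasDerivAt_id z).const_mul α).exp.hasDerivWithinAt
    · have h1 := neg_le_of_abs_le (h.le z (interior_subset hz))
      have h2 := Real.exp_pos (α * z)
      nlinarith
  have hanti : AntitoneOn (fun z => u z * Real.exp (-(α * z))) (Icc a b) := by
    refine antitoneOn_of_hasDerivWithinAt_nonpos (f' := fun z => u' z * Real.exp (-(α * z)) +
      u z * (Real.exp (-(α * z)) * -α)) (convex_Icc a b) (h.isC1.continuousOn.mul (by fun_prop))
      (fun z hz => ?_) fun z hz => ?_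
    · refine ((h.isC1.hasDeriv z (interior_subset hz)).mono interior_subset).mul ?_
      simpa using ((hasDerivAt_id z).const_mul α).neg.exp.hasDerivWithinAt
    · have h1 := le_of_abs_le (h.le z (interior_subset hz))
      have h2 := Real.exp_pos (-(α * z))
      nlinarith
  have hux := h.nonneg hα hx
  rcases le_total x y with hxy | hxy
  · have h1 : u x * Real.exp (α * x) ≤ u y * Real.exp (α * y) := hmono hx hy hxy
    have h2 : u x * Real.exp (α * (x - y)) ≤ u y := by
      rw [mul_sub, Real.exp_sub, ← mul_div_assoc, div_le_iff₀ (Real.exp_pos _)]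
      exact h1
    refine le_trans ?_ h2
    rw [mul_comm]
    refine mul_le_mul_of_nonneg_left (Real.exp_le_exp.2 ?_) hux
    nlinarith [hx.1, hy.2]
  · have h1 : u x * Real.exp (-(α * x)) ≤ u y * Real.exp (-(α * y)) := hanti hy hx hxy
    have h2 : u x * Real.exp (α * (y - x)) ≤ u y := by
      have : Real.exp (α * (y - x)) = Real.exp (-(α * x)) / Real.exp (-(α * y)) := by
        rw [← Real.exp_sub]
        ring_nf
      rw [this, ← mul_div_assoc, div_le_iff₀ (Real.exp_pos _)]
      exact h1
    refine le_trans ?_ h2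
    rw [mul_comm]
    refine mul_le_mul_of_nonneg_left (Real.exp_le_exp.2 ?_) hux
    nlinarith [hy.1, hx.2]

theorem le_integral (hab : a < b) (hα : 0 < α) (h : LogCone a b α u u') {x : ℝ}
    (hx : x ∈ Icc a b) :
    Real.exp (-(α * (b - a))) * u x * (b - a) ≤ ∫ y in Icc a b, u y := by
  have := setIntegral_mono_on (μ := volume) (s := Icc a b)
    (f := fun _ => Real.exp (-(α * (b - a))) * u x) (g := u) (integrableOn_const (by simp))
    h.isC1.integrableOn measurableSet_Icc fun y hy => h.le_exp_mul hα hx hy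
  simpa [hab.le, mul_comm] using this

theorem integral_le (hab : a < b) (hα : 0 < α) (h : LogCone a b α u u') {x : ℝ}
    (hx : x ∈ Icc a b) :
    Real.exp (-(α * (b - a))) * (∫ y in Icc a b, u y) ≤ u x * (b - a) := by
  have := setIntegral_mono_on (μ := volume) (s := Icc a b)
    (f := fun y => Real.exp (-(α * (b - a))) * u y) (g := fun _ => u x)
    (h.isC1.integrableOn.const_mul _) (integrableOn_const (by simp))
    measurableSet_Icc fun y hy => h.le_exp_mul hα hy hx
  rw [integral_const_mul] at this
  simpa [hab.le, mul_comm] using this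

/-- The transfer operator maps the cone of aperture `α` into the cone of aperture `lam * α + D`. -/
theorem branchSum (hα : 0 < α) (hg : ExpandingBranches a b lam D g g₁ g₂)
    (h : LogCone a b α u u') :
    LogCone a b (lam * α + D) (branchSum g g₁ u)
      (fun x => ∑' n, (u' (g n x) * g₁ n x * g₁ n x + u (g n x) * g₂ n x)) := by
  refine ⟨hg.isC1_branchSum h.isC1, fun x hx => ?_⟩
  have hs := (hg.summable_term h.isC1.continuousOn hx).mul_left (lam * α + D)
  rw [LinearResponse.branchSum, ← tsum_mul_left, ← Real.norm_eq_abs]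
  refine tsum_of_norm_bounded hs.hasSum fun n => ?_
  have hm := hg.mapsTo n hx
  refine (hg.abs_deriv_term_le hx (abs_of_nonneg (h.nonneg hα hm)).le (h.le _ hm)).trans_eq ?_
  ring

end LogCone

/-- One step of the coupling: a definite part of the mass of a function in the cone is constant,
and what remains is again in the cone. -/
theorem ExpandingBranches.exists_coupling {α σ : ℝ} (hα : 0 < α)
    (hσ : lam * α + D ≤ σ * α) (hσ1 : σ < 1) (hg : ExpandingBranches a b lam D g g₁ g₂)
    (h : LogCone a b α u u') :
    ∃ w w', LogCone a b α w w' ∧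
      ∫ x in Icc a b, w x =
        (1 - (1 - σ) * Real.exp (-(α * (b - a)))) * ∫ x in Icc a b, u x ∧
      ∀ x ∈ Icc a b, branchSum g g₁ u x =
        w x + (1 - σ) * (Real.exp (-(α * (b - a))) * (∫ x in Icc a b, u x)) / (b - a) := by
  have hab := hg.lt
  have hba : 0 < b - a := sub_pos.2 hab
  set c := (1 - σ) * (Real.exp (-(α * (b - a))) * (∫ x in Icc a b, u x)) / (b - a) with hc
  have hP := h.branchSum hα hg
  have hmass := hg.integral_branchSum h.isC1.continuousOn
  have hP0 : ∀ x ∈ Icc a b, 0 ≤ branchSum g g₁ u x := fun x hx =>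
    tsum_nonneg fun n => mul_nonneg (h.nonneg hα (hg.mapsTo n hx)) (hg.nonneg n x hx)
  have hPα : LogCone a b α (branchSum g g₁ u) _ := ⟨hP.isC1, fun x hx => (hP.le x hx).trans
    (mul_le_mul_of_nonneg_right (hσ.trans (mul_le_of_le_one_left hα.le hσ1.le)) (hP0 x hx))⟩
  refine ⟨fun x => branchSum g g₁ u x - c, _, ⟨(hP.isC1.sub (isC1_const c)), fun x hx => ?_⟩,
    ?_, fun x _ => by ring⟩
  · rw [sub_zero]
    refine (hP.le x hx).trans ?_
    have h1 := hPα.integral_le hab hα hx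
    rw [hmass] at h1
    have h2 : c ≤ (1 - σ) * branchSum g g₁ u x := by
      rw [hc, div_le_iff₀ hba, mul_assoc]
      exact mul_le_mul_of_nonneg_left h1 (by linarith)
    have h3 := mul_le_mul_of_nonneg_right hσ (hPα.nonneg hα hx)
    nlinarith
  · rw [integral_sub hP.isC1.integrableOn (by simp), hmass]
    simp only [integral_const, MeasurableSet.univ, measureReal_restrict_apply, univ_inter,
      Real.volume_real_Icc_of_le hab.le, smul_eq_mul]
    rw [hc]
    field_simp

end

section

variable {a b lam D : ℝ} {g g₁ g₂ : ℕ → ℝ → ℝ} {u u' v v' : ℝ → ℝ}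

/-- Two functions of the cone with equal mass are coupled up to an exponentially small mass. -/
theorem ExpandingBranches.iterate_coupling {α σ : ℝ} (hα : 0 < α)
    (hσ : lam * α + D ≤ σ * α) (hσ1 : σ < 1) (hg : ExpandingBranches a b lam D g g₁ g₂)
    (hu : LogCone a b α u u') (hv : LogCone a b α v v')
    (huv : ∫ x in Icc a b, u x = ∫ x in Icc a b, v x) {w : ℝ → ℝ}
    (hw : ∀ x ∈ Icc a b, w x = u x - v x) (n : ℕ) :
    ∃ p p' q q', LogCone a b α p p' ∧ LogCone a b α q q' ∧
      ∫ x in Icc a b, p x =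
        (1 - (1 - σ) * Real.exp (-(α * (b - a)))) ^ n * ∫ x in Icc a b, u x ∧
      ∫ x in Icc a b, q x = ∫ x in Icc a b, p x ∧
      ∀ x ∈ Icc a b, (branchSum g g₁)^[n] w x = p x - q x := by
  induction n with
  | zero => exact ⟨u, u', v, v', hu, hv, by simp, huv.symm, hw⟩
  | succ n ih =>
    obtain ⟨p, p', q, q', hp, hq, hpm, hqm, h⟩ := ih
    obtain ⟨p₁, p₁', hp₁, hp₁m, hpp⟩ := hg.exists_coupling hα hσ hσ1 hp
    obtain ⟨q₁, q₁', hq₁, hq₁m, hqq⟩ := hg.exists_coupling hα hσ hσ1 hq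
    refine ⟨p₁, p₁', q₁, q₁', hp₁, hq₁, ?_, ?_, fun x hx => ?_⟩
    · rw [hp₁m, hpm]
      ring
    · rw [hp₁m, hq₁m, hqm]
    · rw [Function.iterate_succ_apply', hg.branchSum_congr h hx,
        hg.branchSum_sub hp.isC1.continuousOn hq.isC1.continuousOn hx, hpp x hx, hqq x hx, hqm]
      ring

/-- The transfer operator contracts the `C¹` functions of zero average exponentially, with
constants that depend only on the expansion and the distortion. -/
theorem exists_contraction (hab : a < b) (hlam : 0 ≤ lam) (hlam1 : lam < 1) (hD : 0 ≤ D) :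
    ∃ C θ : ℝ, 0 ≤ C ∧ 0 ≤ θ ∧ θ < 1 ∧ ∀ g g₁ g₂ : ℕ → ℝ → ℝ,
      ExpandingBranches a b lam D g g₁ g₂ → ∀ (w w' : ℝ → ℝ) (B : ℝ), IsC1 a b w w' →
        (∀ x ∈ Icc a b, |w x| ≤ B ∧ |w' x| ≤ B) → ∫ x in Icc a b, w x = 0 →
          ∀ n, ∃ d, IsC1 a b ((branchSum g g₁)^[n] w) d ∧
            ∀ x ∈ Icc a b, |(branchSum g g₁)^[n] w x| ≤ C * B * θ ^ n ∧
              |d x| ≤ C * B * θ ^ n := by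
  have hba : 0 < b - a := sub_pos.2 hab
  -- the aperture `α` is so large that the operator maps the cone strictly inside itself
  set α : ℝ := 2 * D / (1 - lam) + 1 with hαdef
  have h1l : 0 < 1 - lam := by linarith
  have hα : 0 < α := by positivity
  set σ : ℝ := (1 + lam) / 2 with hσdef
  have hσ : lam * α + D ≤ σ * α := by
    have : (1 - lam) * α = 2 * D + (1 - lam) := by
      rw [hαdef]
      field_simp
    rw [hσdef]
    nlinarith
  have hσ1 : σ < 1 := by rw [hσdef]; linarith
  have hσ0 : 0 ≤ σ := by rw [hσdef]; linarith
  set κ : ℝ := Real.exp (-(α * (b - a))) with hκ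
  have hκ0 : 0 < κ := Real.exp_pos _
  have hκ1 : κ ≤ 1 := Real.exp_le_one_iff.2 (by nlinarith [mul_pos hα hba])
  refine ⟨κ⁻¹ * (1 + 1 / α) * (1 + 2 * α), 1 - (1 - σ) * κ, by positivity, by nlinarith,
    by nlinarith [mul_pos (sub_pos.2 hσ1) hκ0], fun g g₁ g₂ hg w w' B hw hB hw0 n => ?_⟩
  set θ := 1 - (1 - σ) * κ with hθ
  have hθ0 : 0 ≤ θ := by rw [hθ]; nlinarith
  have hB0 : 0 ≤ B := (abs_nonneg _).trans (hB a (left_mem_Icc.2 hab.le)).1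
  -- `w + K` lies in the cone, as does the constant `K`
  set K := B * (1 + 1 / α) with hK
  have hαK : α * K = α * B + B := by
    rw [hK]
    field_simp
  have hK0 : 0 ≤ K := by positivity
  have hu : LogCone a b α (fun x => w x + K) (fun x => w' x + 0) := by
    refine ⟨hw.add (isC1_const K), fun x hx => ?_⟩
    rw [add_zero, mul_add, hαK]
    nlinarith [(hB x hx).2, neg_le_of_abs_le (hB x hx).1]
  have hv : LogCone a b α (fun _ => K) (fun _ => 0) :=
    ⟨isC1_const K, fun x _ => by rw [abs_zero]; positivity⟩
  have hvm : ∫ _ in Icc a b, K = K * (b - a) := by simp [hab.le, mul_comm]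
  have hum : ∫ x in Icc a b, (w x + K) = K * (b - a) := by
    rw [integral_add hw.integrableOn (integrableOn_const (by simp)), hw0, hvm, zero_add]
  obtain ⟨p, p', q, q', hp, hq, hpm, hqm, h⟩ := hg.iterate_coupling hα hσ hσ1 hu hv
    (hum.trans hvm.symm) (w := w) (fun x _ => by ring) n
  have key : ∀ {r r' : ℝ → ℝ}, LogCone a b α r r' →
      ∫ x in Icc a b, r x = θ ^ n * (K * (b - a)) → ∀ x ∈ Icc a b, r x ≤ κ⁻¹ * (K * θ ^ n) := by
    intro r r' hr hrm x hx
    have h1 := hr.le_integral hab hα hx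
    rw [hrm] at h1
    rw [← div_eq_inv_mul, le_div_iff₀ hκ0]
    refine le_of_mul_le_mul_right (h1.trans_eq' ?_ |>.trans_eq ?_) hba <;> ring
  rw [hum] at hpm
  have hpb := key hp hpm
  have hqb := key hq (hqm.trans hpm)
  have hT : 0 ≤ κ⁻¹ * (K * θ ^ n) := by positivity
  refine ⟨fun x => p' x - q' x, (hp.isC1.sub hq.isC1).congr h, fun x hx => ?_⟩
  have hC : κ⁻¹ * (1 + 1 / α) * (1 + 2 * α) * B * θ ^ n = (1 + 2 * α) * (κ⁻¹ * (K * θ ^ n)) := by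
    rw [hK]
    ring
  have hp0 := hp.nonneg hα hx
  have hq0 := hq.nonneg hα hx
  have hp1 := hpb x hx
  have hq1 := hqb x hx
  constructor
  · rw [h x hx, hC, abs_le]
    constructor <;> nlinarith
  · rw [hC]
    refine (abs_sub _ _).trans ?_
    nlinarith [hp.le x hx, hq.le x hx]

/-! ### The resolvent on `C¹` functions of zero average -/

theorem ExpandingBranches.integral_iterate (hg : ExpandingBranches a b lam D g g₁ g₂) {n : ℕ}
    (hc : ∀ n, ContinuousOn ((branchSum g g₁)^[n] u) (Icc a b)) :
    ∫ x in Icc a b, (branchSum g g₁)^[n] u x = ∫ x in Icc a b, u x := by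
  induction n with
  | zero => rfl
  | succ n ih =>
    simp only [Function.iterate_succ_apply']
    rw [hg.integral_branchSum (hc n), ih]

/-- The Neumann series solves `w - L w = f`. -/
theorem ExpandingBranches.exists_resolvent (hg : ExpandingBranches a b lam D g g₁ g₂)
    {f f' : ℝ → ℝ} (hf : IsC1 a b f f') (hf0 : ∫ x in Icc a b, f x = 0) :
    ∃ w w', IsC1 a b w w' ∧ ∫ x in Icc a b, w x = 0 ∧
      ∀ x ∈ Icc a b, w x - branchSum g g₁ w x = f x := by
  obtain ⟨C, θ, hC, hθ0, hθ1, hcon⟩ :=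
    exists_contraction hg.lt hg.lam_nonneg hg.lam_lt hg.dist_nonneg
  obtain ⟨B, hB0, hB⟩ := hf.exists_bound
  choose d hd hdb using hcon g g₁ g₂ hg f f' B hf hB hf0
  obtain ⟨M, hM, hgM⟩ := hg.exists_bound
  have hM0 : ∀ n, 0 ≤ M n := fun n =>
    (hg.nonneg n a (left_mem_Icc.2 hg.lt.le)).trans (hgM n a (left_mem_Icc.2 hg.lt.le))
  have hgeo : Summable fun n => C * B * θ ^ n := (summable_geometric_of_lt_one hθ0 hθ1).mul_left _
  have hsum : ∀ x ∈ Icc a b, Summable fun n => (branchSum g g₁)^[n] f x := fun x hx =>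
    Summable.of_norm_bounded hgeo fun n => (hdb n x hx).1
  have hw := IsC1.tsum hg.lt hgeo hd (fun n x hx => (hdb n x hx).1) fun n x hx => (hdb n x hx).2
  refine ⟨_, _, hw, ?_, fun x hx => ?_⟩
  · have h1 := hasSum_integral_of_dominated_convergence (μ := volume.restrict (Icc a b))
      (F := fun n => (branchSum g g₁)^[n] f) (f := fun x => ∑' n, (branchSum g g₁)^[n] f x)
      (fun n _ => C * B * θ ^ n)
      (fun n => (hd n).continuousOn.aestronglyMeasurable measurableSet_Icc)
      (fun n => (ae_restrict_mem measurableSet_Icc).mono fun x hx => (hdb n x hx).1)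
      (ae_of_all _ fun _ => hgeo) (integrable_const _)
      ((ae_restrict_mem measurableSet_Icc).mono fun x hx => (hsum x hx).hasSum)
    have h2 : ∀ n, ∫ x in Icc a b, (branchSum g g₁)^[n] f x = 0 := fun n =>
      (hg.integral_iterate fun n => (hd n).continuousOn).trans hf0
    simp only [h2] at h1
    exact h1.unique hasSum_zero
  · have h1 : branchSum g g₁ (fun x => ∑' n, (branchSum g g₁)^[n] f x) x =
        ∑' n, (branchSum g g₁)^[n + 1] f x := by
      have hs : Summable (Function.uncurry fun k n => (branchSum g g₁)^[n] f (g k x) * g₁ k x) := by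
        refine Summable.of_norm_bounded
          (hM.mul_of_nonneg hgeo hM0 fun n => by positivity) fun p => ?_
        rw [mul_comm (M p.1)]
        exact abs_mul_le_of_nonneg (hdb p.2 _ (hg.mapsTo p.1 hx)).1 (hg.nonneg p.1 x hx)
          (hgM p.1 x hx)
      simp only [branchSum, ← tsum_mul_right, Function.iterate_succ_apply']
      exact hs.tsum_comm.symm
    rw [h1, (hsum x hx).tsum_eq_zero_add]
    simp

/-- A bound for the resolvent that is uniform over families with the same expansion and
distortion. -/
theorem exists_resolvent_bound (hab : a < b) (hlam : 0 ≤ lam) (hlam1 : lam < 1) (hD : 0 ≤ D) :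
    ∃ C : ℝ, 0 ≤ C ∧ ∀ g g₁ g₂ : ℕ → ℝ → ℝ, ExpandingBranches a b lam D g g₁ g₂ →
      ∀ (w w' f f' : ℝ → ℝ) (B : ℝ), IsC1 a b w w' → ∫ x in Icc a b, w x = 0 → IsC1 a b f f' →
        (∀ x ∈ Icc a b, |f x| ≤ B ∧ |f' x| ≤ B) →
          (∀ x ∈ Icc a b, w x - branchSum g g₁ w x = f x) → ∀ x ∈ Icc a b, |w x| ≤ C * B := by
  obtain ⟨C, θ, hC, hθ0, hθ1, hcon⟩ := exists_contraction hab hlam hlam1 hD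
  refine ⟨C * (1 - θ)⁻¹, mul_nonneg hC (inv_nonneg.2 (by linarith)), ?_⟩
  intro g g₁ g₂ hg w w' f f' B hw hw0 hf hfB hwf x hx
  have hf0 : ∫ x in Icc a b, f x = 0 := by
    rw [← setIntegral_congr_fun measurableSet_Icc hwf,
      integral_sub hw.integrableOn (hg.isC1_branchSum hw).integrableOn,
      hg.integral_branchSum hw.continuousOn, sub_self]
  obtain ⟨Bw, -, hBw⟩ := hw.exists_bound
  choose d hd hdb using hcon g g₁ g₂ hg f f' B hf hfB hf0
  choose e he heb using hcon g g₁ g₂ hg w w' Bw hw hBw hw0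
  have hstep : ∀ n, ∀ y ∈ Icc a b, (branchSum g g₁)^[n] w y - (branchSum g g₁)^[n + 1] w y =
      (branchSum g g₁)^[n] f y := by
    intro n
    induction n with
    | zero => exact hwf
    | succ n ih =>
      intro y hy
      rw [Function.iterate_succ_apply' _ n f, ← hg.branchSum_congr ih hy,
        hg.branchSum_sub (he n).continuousOn (he (n + 1)).continuousOn hy]
      simp only [Function.iterate_succ_apply']
  have hlim : Tendsto (fun n => (branchSum g g₁)^[n] w x) atTop (𝓝 0) := by
    refine squeeze_zero_norm (fun n => (heb n x hx).1) ?_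
    simpa using (tendsto_pow_atTop_nhds_zero_of_lt_one hθ0 hθ1).const_mul (C * Bw)
  have hgeo := (hasSum_geometric_of_lt_one hθ0 hθ1).mul_left (C * B)
  have htel : HasSum (fun n => (branchSum g g₁)^[n] f x) (w x) := by
    have hs : Summable fun n => (branchSum g g₁)^[n] f x :=
      Summable.of_norm_bounded hgeo.summable fun n => (hdb n x hx).1
    rw [hs.hasSum_iff_tendsto_nat]
    have h1 : ∀ N, ∑ n ∈ Finset.range N, (branchSum g g₁)^[n] f x =
        w x - (branchSum g g₁)^[N] w x := fun N => by
      rw [← Finset.sum_congr rfl fun n _ => hstep n x hx,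
        Finset.sum_range_sub' (fun n => (branchSum g g₁)^[n] w x)]
      rfl
    simp only [h1]
    simpa using hlim.const_sub (w x)
  rw [← htel.tsum_eq, ← Real.norm_eq_abs]
  refine (tsum_of_norm_bounded hgeo fun n => (hdb n x hx).1).trans_eq ?_
  ring

/-! ### Uniqueness of integrable invariant densities -/

theorem aemeasurable_term (hg : ExpandingBranches a b lam D g g₁ g₂) {H : ℝ → ℝ≥0∞}
    (hH : Measurable H) (n : ℕ) :
    AEMeasurable (fun x => ENNReal.ofReal (g₁ n x) * H (g n x)) (volume.restrict (Icc a b)) :=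
  ((hg.isC1' n).continuousOn.aemeasurable measurableSet_Icc).ennreal_ofReal.mul
    (hH.comp_aemeasurable ((hg.isC1 n).continuousOn.aemeasurable measurableSet_Icc))

theorem ExpandingBranches.ae_summable (hg : ExpandingBranches a b lam D g g₁ g₂)
    (hu : Measurable u) (hi : IntegrableOn u (Icc a b)) :
    ∀ᵐ x ∂volume.restrict (Icc a b), Summable fun n => u (g n x) * g₁ n x := by
  have h1 : ∫⁻ x in Icc a b, ∑' n, ENNReal.ofReal (g₁ n x) * ‖u (g n x)‖ₑ ≠ ⊤ := by
    rw [lintegral_tsum (aemeasurable_term hg hu.enorm), ← hg.setLIntegral_eq_tsum fun x => ‖u x‖ₑ]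
    exact hi.2.ne
  filter_upwards [ae_lt_top' (AEMeasurable.tsum (aemeasurable_term hg hu.enorm)) h1,
    ae_restrict_mem measurableSet_Icc] with x hx hxI
  have h2 : ∀ n, ‖u (g n x) * g₁ n x‖ₑ = ENNReal.ofReal (g₁ n x) * ‖u (g n x)‖ₑ := fun n => by
    rw [enorm_mul, mul_comm, Real.enorm_of_nonneg (hg.nonneg n x hxI)]
  simp only [← h2] at hx
  have h3 := tsum_enorm_ne_top_iff_summable_nnnorm.1 hx.ne
  exact Summable.of_nnnorm h3

theorem ContinuousOn.measurable_indicator_Icc (hu : ContinuousOn u (Icc a b)) :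
    Measurable ((Icc a b).indicator u) := by
  classical
  rw [← piecewise_eq_indicator]
  exact hu.measurable_piecewise continuousOn_const measurableSet_Icc

/-- The transfer operator is a contraction of `L¹`. -/
theorem ExpandingBranches.lintegral_branchSum_le (hg : ExpandingBranches a b lam D g g₁ g₂)
    (hu : Measurable ((Icc a b).indicator u)) :
    ∫⁻ x in Icc a b, ‖branchSum g g₁ u x‖ₑ ≤ ∫⁻ x in Icc a b, ‖u x‖ₑ := by
  set v := (Icc a b).indicator u with hv
  have huv : EqOn v u (Icc a b) := fun x hx => indicator_of_mem hx u
  have h1 : ∫⁻ x in Icc a b, ‖u x‖ₑ =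
      ∫⁻ x in Icc a b, ∑' n, ENNReal.ofReal (g₁ n x) * ‖v (g n x)‖ₑ := by
    rw [lintegral_tsum (aemeasurable_term hg hu.enorm), ← hg.setLIntegral_eq_tsum fun x => ‖v x‖ₑ]
    exact setLIntegral_congr_fun measurableSet_Icc fun x hx => by rw [huv hx]
  rw [h1]
  refine setLIntegral_mono' measurableSet_Icc fun x hx => ?_
  rw [branchSum]
  refine (enorm_tsum_le_tsum_enorm).trans_eq (tsum_congr fun n => ?_)
  rw [enorm_mul, mul_comm, Real.enorm_of_nonneg (hg.nonneg n x hx), huv (hg.mapsTo n hx)]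

/-- The `C¹` functions of zero average are dense in the integrable functions of zero average. -/
theorem exists_isC1_lintegral_le (hab : a < b) {f : ℝ → ℝ} (hf : IntegrableOn f (Icc a b))
    (hf0 : ∫ x in Icc a b, f x = 0) {η : ℝ} (hη : 0 < η) :
    ∃ w w', IsC1 a b w w' ∧ ∫ x in Icc a b, w x = 0 ∧ ∫ x in Icc a b, ‖f x - w x‖ ≤ η := by
  have hba : 0 < b - a := sub_pos.2 hab
  obtain ⟨k, hk, hki⟩ := Integrable.exists_boundedContinuous_integral_sub_le hf
    (show 0 < η / 4 by positivity)
  obtain ⟨p, hp⟩ := exists_polynomial_near_of_continuousOn a b k k.continuous.continuousOn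
    (η / 4 / (b - a)) (by positivity)
  have hpi : IntegrableOn (fun x => p.eval x) (Icc a b) :=
    p.continuous.continuousOn.integrableOn_Icc
  have hfp : IntegrableOn (fun x => ‖f x - p.eval x‖) (Icc a b) := (hf.sub hpi).norm
  have hfk : IntegrableOn (fun x => ‖f x - k x‖) (Icc a b) := (hf.sub hki).norm
  have hkp : IntegrableOn (fun x => ‖k x - p.eval x‖) (Icc a b) := (hki.sub hpi).norm
  have h1 : ∫ x in Icc a b, ‖f x - p.eval x‖ ≤ η / 2 := by
    have h2 : ∫ x in Icc a b, ‖k x - p.eval x‖ ≤ η / 4 := by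
      have := setIntegral_mono_on (μ := volume) (s := Icc a b) (f := fun x => ‖k x - p.eval x‖)
        (g := fun _ => η / 4 / (b - a)) hkp (integrableOn_const (by simp))
        measurableSet_Icc fun x hx => by
          rw [norm_sub_rev]
          exact (hp x hx).le
      refine this.trans_eq ?_
      simp only [integral_const, MeasurableSet.univ, measureReal_restrict_apply, univ_inter,
        Real.volume_real_Icc_of_le hab.le, smul_eq_mul]
      field_simp
    have h3 : ∫ x in Icc a b, ‖f x - p.eval x‖ ≤
        ∫ x in Icc a b, (‖f x - k x‖ + ‖k x - p.eval x‖) :=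
      integral_mono hfp (hfk.add hkp) fun x =>
        norm_sub_le_norm_sub_add_norm_sub _ _ _
    rw [integral_add hfk hkp] at h3
    linarith
  set c := (∫ x in Icc a b, p.eval x) / (b - a) with hc
  have hcint : ∫ _ in Icc a b, c = ∫ x in Icc a b, p.eval x := by
    simp only [integral_const, MeasurableSet.univ, measureReal_restrict_apply, univ_inter,
        Real.volume_real_Icc_of_le hab.le, smul_eq_mul]
    rw [hc]
    field_simp
  have hci : IntegrableOn (fun _ : ℝ => c) (Icc a b) := integrableOn_const (by simp)
  have habs : ∫ _ in Icc a b, ‖c‖ ≤ η / 2 := by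
    have h2 : |∫ x in Icc a b, p.eval x| ≤ η / 2 := by
      refine le_trans ?_ h1
      have h3 : ∫ x in Icc a b, (f x - p.eval x) = _ := integral_sub hf hpi
      rw [hf0, zero_sub] at h3
      rw [← abs_neg, ← h3]
      exact norm_integral_le_integral_norm fun x => f x - p.eval x
    refine le_trans (le_of_eq ?_) h2
    simp only [integral_const, MeasurableSet.univ, measureReal_restrict_apply, univ_inter,
        Real.volume_real_Icc_of_le hab.le, smul_eq_mul]
    rw [hc, Real.norm_eq_abs, abs_div, abs_of_pos hba]
    field_simp
  have hpC : IsC1 a b (fun x => p.eval x) (fun x => p.derivative.eval x) :=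
    ⟨fun x _ => (p.hasDerivAt x).hasDerivWithinAt, p.derivative.continuous.continuousOn⟩
  refine ⟨_, _, hpC.sub (isC1_const c), ?_, ?_⟩
  · rw [integral_sub hpi hci, hcint, sub_self]
  · have h3 : ∫ x in Icc a b, ‖f x - (p.eval x - c)‖ ≤
        ∫ x in Icc a b, (‖f x - p.eval x‖ + ‖c‖) :=
      integral_mono (hf.sub (hpi.sub hci)).norm (hfp.add hci.norm) fun x => by
        rw [← sub_add]
        exact norm_add_le _ _
    rw [integral_add hfp hci.norm] at h3
    linarith

/-- An integrable function of zero average that is fixed by the transfer operator vanishes: the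
operator contracts `L¹` and tends to zero on a dense set. -/
theorem ExpandingBranches.ae_eq_zero (hg : ExpandingBranches a b lam D g g₁ g₂) {f : ℝ → ℝ}
    (hfm : Measurable f) (hf : IntegrableOn f (Icc a b)) (hf0 : ∫ x in Icc a b, f x = 0)
    (hfix : ∀ᵐ x ∂volume.restrict (Icc a b), f x = branchSum g g₁ f x) :
    f =ᵐ[volume.restrict (Icc a b)] 0 := by
  obtain ⟨C, θ, hC, hθ0, hθ1, hcon⟩ :=
    exists_contraction hg.lt hg.lam_nonneg hg.lam_lt hg.dist_nonneg
  have hsum := hg.ae_summable hfm hf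
  have key : ∀ η > 0, ∫⁻ x in Icc a b, ‖f x‖ₑ ≤ ENNReal.ofReal η := by
    intro η hη
    obtain ⟨w, w', hw, hw0, hfw⟩ := exists_isC1_lintegral_le hg.lt hf hf0 hη
    obtain ⟨B, hB0, hB⟩ := hw.exists_bound
    choose d hd hdb using hcon g g₁ g₂ hg w w' B hw hB hw0
    have hind : ∀ n, Measurable ((Icc a b).indicator fun x => f x - (branchSum g g₁)^[n] w x) := by
      intro n
      have h1 : ((Icc a b).indicator fun x => f x - (branchSum g g₁)^[n] w x) =
          (Icc a b).indicator f - (Icc a b).indicator ((branchSum g g₁)^[n] w) :=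
        indicator_sub' (Icc a b) f ((branchSum g g₁)^[n] w)
      rw [h1]
      exact (hfm.indicator measurableSet_Icc).sub
        (ContinuousOn.measurable_indicator_Icc (hd n).continuousOn)
    have hstep : ∀ n, ∫⁻ x in Icc a b, ‖f x - (branchSum g g₁)^[n] w x‖ₑ ≤ ENNReal.ofReal η := by
      intro n
      induction n with
      | zero =>
        exact (ofReal_integral_norm_eq_lintegral_enorm (hf.sub hw.integrableOn)).symm.trans_le
          (ENNReal.ofReal_le_ofReal hfw)
      | succ n ih =>
        refine le_trans (le_of_eq ?_) ((hg.lintegral_branchSum_le (hind n)).trans ih)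
        refine lintegral_congr_ae ?_
        filter_upwards [hfix, hsum, ae_restrict_mem measurableSet_Icc] with x hx hsx hxI
        rw [hx, Function.iterate_succ_apply']
        simp only [branchSum, sub_mul]
        rw [hsx.tsum_sub (hg.summable_term (hd n).continuousOn hxI)]
    have hbound : ∀ n, ∫⁻ x in Icc a b, ‖f x‖ₑ ≤
        ENNReal.ofReal η + ENNReal.ofReal (C * B * θ ^ n) * ENNReal.ofReal (b - a) := by
      intro n
      calc ∫⁻ x in Icc a b, ‖f x‖ₑ ≤ ∫⁻ x in Icc a b, (‖f x - (branchSum g g₁)^[n] w x‖ₑ +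
            ‖(branchSum g g₁)^[n] w x‖ₑ) := by
            refine lintegral_mono fun x => ?_
            simpa using enorm_add_le (f x - (branchSum g g₁)^[n] w x) ((branchSum g g₁)^[n] w x)
        _ = _ := lintegral_add_right' _
            ((hd n).continuousOn.aemeasurable measurableSet_Icc).enorm
        _ ≤ _ := by
            refine add_le_add (hstep n) ?_
            refine (setLIntegral_mono' measurableSet_Icc (g := fun _ => ENNReal.ofReal
              (C * B * θ ^ n)) fun x hx => ?_).trans_eq (by simp)
            rw [Real.enorm_eq_ofReal_abs]
            exact ENNReal.ofReal_le_ofReal (hdb n x hx).1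
    have hlim : Tendsto (fun n => ENNReal.ofReal η + ENNReal.ofReal (C * B * θ ^ n) *
        ENNReal.ofReal (b - a)) atTop (𝓝 (ENNReal.ofReal η)) := by
      have h1 := (tendsto_pow_atTop_nhds_zero_of_lt_one hθ0 hθ1).const_mul (C * B)
      have h2 := (ENNReal.Tendsto.mul_const (ENNReal.tendsto_ofReal h1)
        (Or.inr (ENNReal.ofReal_ne_top (r := b - a)))).const_add (ENNReal.ofReal η)
      simpa using h2
    exact ge_of_tendsto' hlim hbound
  have h0 : ∫⁻ x in Icc a b, ‖f x‖ₑ = 0 := by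
    refine le_antisymm (ENNReal.le_of_forall_pos_le_add fun ε hε _ => ?_) zero_le
    simpa using key ε hε
  rw [lintegral_eq_zero_iff hfm.enorm] at h0
  filter_upwards [h0] with x hx
  simpa using hx

end

section

/-! ### Unfolding an invariant measure along the inducing scheme -/

/-- The inverse branches `g₀ : [0, 1] → [0, 1/2]` and `g₁ : [0, 1] → [1/2, 1]` of a map `T` of
`[0, 1]`. The value of `T` at the common endpoint `1/2` is left free. -/
structure TwoBranches (T g₀ g₁ : ℝ → ℝ) : Prop where
  strictMono₀ : StrictMonoOn g₀ (Icc 0 1)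
  image₀ : g₀ '' Icc 0 1 = Icc 0 (1 / 2)
  cont₀ : ContinuousOn g₀ (Icc 0 1)
  strictMono₁ : StrictMonoOn g₁ (Icc 0 1)
  image₁ : g₁ '' Icc 0 1 = Icc (1 / 2) 1
  cont₁ : ContinuousOn g₁ (Icc 0 1)
  right_inv₀ : ∀ y ∈ Icc (0 : ℝ) 1, g₀ y ≠ 1 / 2 → T (g₀ y) = y
  right_inv₁ : ∀ y ∈ Icc (0 : ℝ) 1, g₁ y ≠ 1 / 2 → T (g₁ y) = y

/-- A left inverse of an increasing bijection is increasing, onto, and also a right inverse. -/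
theorem strictMonoOn_image_eq_of_leftInverse {T g : ℝ → ℝ} {s t : Set ℝ}
    (hT : StrictMonoOn T s) (hb : BijOn T s t) (hg : ∀ x ∈ s, g (T x) = x) :
    StrictMonoOn g t ∧ g '' t = s ∧ ∀ y ∈ t, T (g y) = y := by
  refine ⟨fun x hx y hy hxy => ?_, ?_, fun y hy => ?_⟩
  · obtain ⟨p, hp, rfl⟩ := hb.surjOn hx
    obtain ⟨q, hq, rfl⟩ := hb.surjOn hy
    rw [hg p hp, hg q hq]
    exact (hT.lt_iff_lt hp hq).1 hxy
  · rw [← hb.image_eq, image_image]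
    exact (image_congr hg).trans (image_id s)
  · obtain ⟨p, hp, rfl⟩ := hb.surjOn hy
    rw [hg p hp]

namespace TwoBranches

variable {T g₀ g₁ : ℝ → ℝ}

theorem mapsTo₀ (h : TwoBranches T g₀ g₁) : MapsTo g₀ (Icc 0 1) (Icc 0 (1 / 2)) :=
  mapsTo_iff_image_subset.2 h.image₀.subset

theorem mapsTo₁ (h : TwoBranches T g₀ g₁) : MapsTo g₁ (Icc 0 1) (Icc (1 / 2) 1) :=
  mapsTo_iff_image_subset.2 h.image₁.subset

theorem mapsTo_self (h : TwoBranches T g₀ g₁) : MapsTo g₀ (Icc 0 1) (Icc 0 1) :=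
  h.mapsTo₀.mono_right (Icc_subset_Icc_right (by norm_num))

theorem mapsTo_iterate (h : TwoBranches T g₀ g₁) (n : ℕ) : MapsTo g₀^[n] (Icc 0 1) (Icc 0 1) :=
  h.mapsTo_self.iterate n

theorem continuousOn_iterate (h : TwoBranches T g₀ g₁) (n : ℕ) :
    ContinuousOn g₀^[n] (Icc 0 1) := by
  induction n with
  | zero => exact continuousOn_id
  | succ n ih =>
    rw [Function.iterate_succ']
    exact h.cont₀.comp ih (h.mapsTo_iterate n)

theorem strictMonoOn_iterate (h : TwoBranches T g₀ g₁) (n : ℕ) :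
    StrictMonoOn g₀^[n] (Icc 0 1) := by
  induction n with
  | zero => exact strictMono_id.strictMonoOn _
  | succ n ih =>
    rw [Function.iterate_succ']
    exact h.strictMono₀.comp ih (h.mapsTo_iterate n)

theorem left_apply_one (h : TwoBranches T g₀ g₁) : g₀ 1 = 1 / 2 := by
  have h1 : (1 : ℝ) ∈ Icc (0 : ℝ) 1 := by norm_num
  obtain ⟨y, hy, hy2⟩ : (1 / 2 : ℝ) ∈ g₀ '' Icc 0 1 := h.image₀ ▸ (by norm_num)
  exact le_antisymm (h.mapsTo₀ h1).2 (hy2 ▸ h.strictMono₀.monotoneOn hy h1 hy.2)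

theorem right_apply_zero (h : TwoBranches T g₀ g₁) : g₁ 0 = 1 / 2 := by
  have h1 : (0 : ℝ) ∈ Icc (0 : ℝ) 1 := by norm_num
  obtain ⟨y, hy, hy2⟩ : (1 / 2 : ℝ) ∈ g₁ '' Icc 0 1 := h.image₁ ▸ (by norm_num)
  exact le_antisymm (hy2 ▸ h.strictMono₁.monotoneOn h1 hy hy.1) (h.mapsTo₁ h1).1

/-- The points `g₀ⁿ(1)` tend to `0`, as the word branches fill `[1/2, 1]`. -/
theorem exists_iterate_lt (h : TwoBranches T g₀ g₁)
    (hcov : volume (Icc (1 / 2 : ℝ) 1 \ ⋃ n : ℕ, (fun x => g₁ (g₀^[n] x)) '' Ioo (1 / 2) 1) = 0)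
    {x : ℝ} (hx : x ∈ Ioc (0 : ℝ) 1) : ∃ n : ℕ, g₀^[n] 1 < x := by
  by_contra! hcon
  have hxI : x ∈ Icc (0 : ℝ) 1 := Ioc_subset_Icc_self hx
  have h1I : (1 : ℝ) ∈ Icc (0 : ℝ) 1 := by norm_num
  have hlt : (1 / 2 : ℝ) < g₁ x := h.right_apply_zero ▸ h.strictMono₁ (by norm_num) hxI hx.1
  -- otherwise the nonempty interval `(g₁ 0, g₁ x)` is not covered
  have hsub : Ioo (1 / 2 : ℝ) (g₁ x) ⊆
      Icc (1 / 2 : ℝ) 1 \ ⋃ n : ℕ, (fun x => g₁ (g₀^[n] x)) '' Ioo (1 / 2) 1 := by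
    intro y hy
    refine ⟨⟨hy.1.le, hy.2.le.trans (h.mapsTo₁ hxI).2⟩, fun hmem => ?_⟩
    obtain ⟨n, w, hw, rfl⟩ := mem_iUnion.1 hmem
    have hwI : w ∈ Icc (0 : ℝ) 1 := ⟨by linarith [hw.1], hw.2.le⟩
    have h2 : g₀^[n] w < x :=
      (h.strictMono₁.lt_iff_lt (h.mapsTo_iterate n hwI) hxI).1 hy.2
    have h3 : g₀^[n] (g₀ 1) < g₀^[n] w := by
      rw [h.left_apply_one]
      exact h.strictMonoOn_iterate n (by norm_num) hwI hw.1
    have h4 := hcon (n + 1)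
    rw [Function.iterate_succ_apply] at h4
    linarith
  have := measure_mono_null hsub hcov
  rw [Real.volume_Ioo, ENNReal.ofReal_eq_zero] at this
  linarith

/-- The images of `(1/2, 1)` under the iterates of `g₀` fill `[0, 1]`: only `0` and the points
`g₀ⁿ(1)` are missing. -/
theorem volume_diff_iUnion (h : TwoBranches T g₀ g₁)
    (hcov : volume (Icc (1 / 2 : ℝ) 1 \ ⋃ n : ℕ, (fun x => g₁ (g₀^[n] x)) '' Ioo (1 / 2) 1) = 0) :
    volume (Icc (0 : ℝ) 1 \ ⋃ k : ℕ, g₀^[k] '' Ioo (1 / 2) 1) = 0 := by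
  have hc : (({0} : Set ℝ) ∪ range fun n => g₀^[n] 1).Countable :=
    (countable_singleton 0).union (countable_range _)
  refine measure_mono_null (fun x hx => ?_) (hc.measure_zero volume)
  by_contra hcon
  simp only [mem_union, mem_singleton_iff, mem_range, not_or, not_exists] at hcon
  refine hx.2 (mem_iUnion.2 ?_)
  have hx0 : 0 < x := lt_of_le_of_ne hx.1.1 (Ne.symm hcon.1)
  classical
  have hex := h.exists_iterate_lt hcov ⟨hx0, hx.1.2⟩
  obtain ⟨m, hm⟩ : ∃ m, Nat.find hex = m + 1 := Nat.exists_eq_succ_of_ne_zero fun h0 => by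
    have := Nat.find_spec hex
    rw [h0] at this
    exact absurd hx.1.2 (not_le.2 this)
  have h1 : g₀^[m + 1] 1 < x := hm ▸ Nat.find_spec hex
  have h2 : x < g₀^[m] 1 :=
    lt_of_le_of_ne (not_lt.1 (Nat.find_min hex (by omega))) (Ne.symm (hcon.2 m))
  rw [Function.iterate_succ_apply, h.left_apply_one] at h1
  exact ⟨m, intermediate_value_Ioo (by norm_num)
    ((h.continuousOn_iterate m).mono (Icc_subset_Icc_left (by norm_num))) ⟨h1, h2⟩⟩

theorem measurableSet_image_iterate (h : TwoBranches T g₀ g₁) {A : Set ℝ} (hA : MeasurableSet A)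
    (hAI : A ⊆ Icc 0 1) (n : ℕ) : MeasurableSet (g₀^[n] '' A) :=
  hA.image_of_continuousOn_injOn ((h.continuousOn_iterate n).mono hAI)
    ((h.strictMonoOn_iterate n).injOn.mono hAI)

variable {μ : Measure ℝ}

/-- An invariant measure distributes the mass of a set over its preimages under the two
branches. -/
theorem measure_eq_add (h : TwoBranches T g₀ g₁) (hμ : μ ≪ volume.restrict (Icc 0 1))
    (hinv : ∀ A, MeasurableSet A → μ (T ⁻¹' A) = μ A) {A : Set ℝ} (hA : MeasurableSet A)
    (hAI : A ⊆ Icc 0 1) : μ A = μ (g₀ '' A) + μ (g₁ '' A) := by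
  have hhalf : μ {1 / 2} = 0 := hμ (by simp)
  have hcompl : μ (Icc 0 1)ᶜ = 0 := hμ (by simp)
  have hm₁ : MeasurableSet (g₁ '' A) :=
    hA.image_of_continuousOn_injOn (h.cont₁.mono hAI) (h.strictMono₁.injOn.mono hAI)
  have hdisj : AEDisjoint μ (g₀ '' A) (g₁ '' A) := by
    refine measure_mono_null ?_ hhalf
    rintro _ ⟨⟨x, hx, rfl⟩, y, hy, hxy⟩
    exact le_antisymm (h.mapsTo₀ (hAI hx)).2 (hxy ▸ (h.mapsTo₁ (hAI hy)).1)
  rw [← hinv A hA, ← measure_union₀ hm₁.nullMeasurableSet hdisj]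
  -- the two sides differ only in `1/2` and outside of `[0, 1]`
  refine measure_congr ?_
  have hnull : ∀ᵐ x ∂μ, x ∈ Icc (0 : ℝ) 1 ∧ x ≠ 1 / 2 := by
    refine (ae_iff.2 ?_ : ∀ᵐ x ∂μ, x ∈ Icc (0 : ℝ) 1).and (ae_iff.2 ?_)
    · exact hcompl
    · simpa using hhalf
  filter_upwards [hnull] with x hx
  refine propext ⟨fun (hxA : T x ∈ A) => ?_, ?_⟩
  · rcases lt_or_gt_of_ne hx.2 with hlt | hgt
    · obtain ⟨y, hy, rfl⟩ : x ∈ g₀ '' Icc 0 1 := h.image₀ ▸ ⟨hx.1.1, hlt.le⟩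
      rw [h.right_inv₀ y hy hx.2] at hxA
      exact Or.inl ⟨y, hxA, rfl⟩
    · obtain ⟨y, hy, rfl⟩ : x ∈ g₁ '' Icc 0 1 := h.image₁ ▸ ⟨hgt.le, hx.1.2⟩
      rw [h.right_inv₁ y hy hx.2] at hxA
      exact Or.inr ⟨y, hxA, rfl⟩
  · rintro (⟨y, hy, rfl⟩ | ⟨y, hy, rfl⟩)
    · change T (g₀ y) ∈ A
      rwa [h.right_inv₀ y (hAI hy) hx.2]
    · change T (g₁ y) ∈ A
      rwa [h.right_inv₁ y (hAI hy) hx.2]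

theorem measure_eq_sum_add (h : TwoBranches T g₀ g₁) (hμ : μ ≪ volume.restrict (Icc 0 1))
    (hinv : ∀ A, MeasurableSet A → μ (T ⁻¹' A) = μ A) {A : Set ℝ} (hA : MeasurableSet A)
    (hAI : A ⊆ Icc 0 1) (n : ℕ) :
    μ A = ∑ k ∈ Finset.range n, μ ((fun x => g₁ (g₀^[k] x)) '' A) + μ (g₀^[n] '' A) := by
  induction n with
  | zero => simp
  | succ n ih =>
    rw [ih, Finset.sum_range_succ, add_assoc, h.measure_eq_add hμ hinv
      (h.measurableSet_image_iterate hA hAI n) ((h.mapsTo_iterate n).mono_left hAI).image_subset,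
      image_image, image_image, Function.iterate_succ', add_comm (μ ((fun x => g₁ _) '' A))]
    rfl

/-- The mass of a set is the total mass of its preimages under the word branches. Nothing escapes
to the fixed point `0`, even for an infinite measure: the mass of `(1/2, 1)` that has not returned
after `n` steps is a tail of a convergent series. -/
theorem measure_eq_tsum (h : TwoBranches T g₀ g₁) (hμ : μ ≪ volume.restrict (Icc 0 1))
    (hinv : ∀ A, MeasurableSet A → μ (T ⁻¹' A) = μ A) (hfin : μ (Icc (1 / 2) 1) ≠ ⊤)
    (hdisj : Pairwise fun n m : ℕ => Disjoint ((fun x => g₁ (g₀^[n] x)) '' Ioo (1 / 2) 1)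
      ((fun x => g₁ (g₀^[m] x)) '' Ioo (1 / 2) 1))
    (hcov : volume (Icc (1 / 2 : ℝ) 1 \ ⋃ n : ℕ, (fun x => g₁ (g₀^[n] x)) '' Ioo (1 / 2) 1) = 0)
    (k : ℕ) {A : Set ℝ} (hA : MeasurableSet A) (hAk : A ⊆ g₀^[k] '' Ioo (1 / 2) 1) :
    μ A = ∑' n : ℕ, μ ((fun x => g₁ (g₀^[n] x)) '' A) := by
  have hac : μ ≪ volume := hμ.trans Measure.restrict_le_self.absolutelyContinuous
  have hJI : Ioo (1 / 2 : ℝ) 1 ⊆ Icc 0 1 := fun x hx => ⟨by linarith [hx.1], hx.2.le⟩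
  have hAI : A ⊆ Icc 0 1 := hAk.trans ((h.mapsTo_iterate k).mono_left hJI).image_subset
  have hJ : μ (Ioo (1 / 2) 1) = μ (Icc (1 / 2) 1) :=
    measure_congr (hac.ae_eq Ioo_ae_eq_Icc)
  have hsumJ : ∑' n : ℕ, μ ((fun x => g₁ (g₀^[n] x)) '' Ioo (1 / 2) 1) = μ (Ioo (1 / 2) 1) := by
    rw [hJ, ← measure_iUnion hdisj fun n => ?_]
    · refine measure_congr (hac.ae_eq ?_)
      refine (LE.le.eventuallyLE (iUnion_subset fun n => ?_)).antisymm (ae_le_set.2 hcov)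
      exact MapsTo.image_subset fun x hx => h.mapsTo₁ (h.mapsTo_iterate n (hJI hx))
    · rw [← image_image g₁]
      have hsub := ((h.mapsTo_iterate n).mono_left hJI).image_subset
      exact (h.measurableSet_image_iterate measurableSet_Ioo hJI n).image_of_continuousOn_injOn
        (h.cont₁.mono hsub) (h.strictMono₁.injOn.mono hsub)
  have hrem : Tendsto (fun n => μ (g₀^[n] '' Ioo (1 / 2) 1)) atTop (𝓝 0) := by
    have h1 := ENNReal.summable.hasSum.tendsto_sum_nat
      (f := fun n => μ ((fun x => g₁ (g₀^[n] x)) '' Ioo (1 / 2) 1))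
    rw [hsumJ] at h1
    have h2 := ENNReal.Tendsto.sub (tendsto_const_nhds (x := μ (Ioo (1 / 2 : ℝ) 1))) h1
      (Or.inl (hJ ▸ hfin))
    rw [tsub_self] at h2
    refine h2.congr fun n => ?_
    have h3 := h.measure_eq_sum_add hμ hinv measurableSet_Ioo hJI n
    refine ENNReal.sub_eq_of_eq_add_rev (ne_top_of_le_ne_top (hJ ▸ hfin) ?_) h3
    rw [h3]
    exact le_self_add
  have hremA : Tendsto (fun n => μ (g₀^[n] '' A)) atTop (𝓝 0) := by
    refine tendsto_of_tendsto_of_tendsto_of_le_of_le tendsto_const_nhds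
      (hrem.comp (tendsto_add_atTop_nat k)) (fun _ => zero_le) fun n => measure_mono ?_
    rw [Function.iterate_add, image_comp]
    exact image_mono hAk
  have hA1 := (ENNReal.summable.hasSum.tendsto_sum_nat
      (f := fun n => μ ((fun x => g₁ (g₀^[n] x)) '' A))).add hremA
  rw [add_zero] at hA1
  exact tendsto_nhds_unique
    (tendsto_const_nhds.congr fun n => h.measure_eq_sum_add hμ hinv hA hAI n) hA1

end TwoBranches

end

section

/-! ### From the mass identity to the densities -/

theorem withDensity_restrict_apply {I A : Set ℝ} (H : ℝ → ℝ≥0∞) (hA : MeasurableSet A)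
    (hAI : A ⊆ I) : (volume.restrict I).withDensity H A = ∫⁻ x in A, H x := by
  rw [withDensity_apply _ hA, Measure.restrict_restrict hA, inter_eq_left.2 hAI]

/-- The mass identity `μ A = Σ μ (f_n A)` expressed by densities. -/
theorem ae_density_eq {c d : ℝ} {E : Set ℝ} {H : ℝ → ℝ≥0∞} (hH : Measurable H)
    (hE : MeasurableSet E) (hEI : E ⊆ Icc c d) {f w : ℕ → ℝ → ℝ} (hf : ∀ n, IsC1 c d (f n) (w n))
    (hmono : ∀ n, StrictMonoOn (f n) (Icc c d)) (hmaps : ∀ n, MapsTo (f n) (Icc c d) (Icc c d))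
    (hmass : ∀ A, MeasurableSet A → A ⊆ E → (volume.restrict (Icc c d)).withDensity H A =
      ∑' n, (volume.restrict (Icc c d)).withDensity H (f n '' A)) :
    ∀ᵐ x ∂volume.restrict E, H x = ∑' n, ENNReal.ofReal (w n x) * H (f n x) := by
  have hmeas : ∀ n, AEMeasurable (fun x => ENNReal.ofReal (w n x) * H (f n x))
      (volume.restrict (Icc c d)) := fun n =>
    ((hf n).cont_deriv.aemeasurable measurableSet_Icc).ennreal_ofReal.mul
      (hH.comp_aemeasurable ((hf n).continuousOn.aemeasurable measurableSet_Icc))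
  have hmeasE : ∀ n, AEMeasurable (fun x => ENNReal.ofReal (w n x) * H (f n x))
      (volume.restrict E) := fun n => (hmeas n).mono_measure (Measure.restrict_mono hEI le_rfl)
  refine ae_eq_of_forall_setLIntegral_eq_of_sigmaFinite₀ hH.aemeasurable
    (AEMeasurable.tsum hmeasE) fun s hs _ => ?_
  have hsE : MeasurableSet (s ∩ E) := hs.inter hE
  have hsI : s ∩ E ⊆ Icc c d := inter_subset_right.trans hEI
  rw [Measure.restrict_restrict hs, ← withDensity_restrict_apply H hsE hsI,
    hmass _ hsE inter_subset_right, lintegral_tsum fun n =>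
      (hmeas n).mono_measure (Measure.restrict_mono hsI le_rfl)]
  refine tsum_congr fun n => ?_
  rw [withDensity_restrict_apply H (hsE.image_of_continuousOn_injOn
    ((hf n).continuousOn.mono hsI) ((hmono n).injOn.mono hsI))
    ((hmaps n).mono_left hsI).image_subset]
  exact lintegral_image_eq_lintegral_deriv_mul_of_monotoneOn hsE
    (fun x hx => ((hf n).hasDeriv x (hsI hx)).mono hsI) ((hmono n).monotoneOn.mono hsI) H

theorem hasSum_of_ofReal_eq_tsum {f : ℕ → ℝ} {r : ℝ} (hf : ∀ n, 0 ≤ f n) (hr : 0 ≤ r)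
    (h : ENNReal.ofReal r = ∑' n, ENNReal.ofReal (f n)) : HasSum f r := by
  have hs : Summable f := by
    have h1 : ∑' n, ‖f n‖ₑ ≠ ⊤ := by
      simp only [fun n => Real.enorm_of_nonneg (hf n), ← h]
      exact ENNReal.ofReal_ne_top
    exact Summable.of_nnnorm (tsum_enorm_ne_top_iff_summable_nnnorm.1 h1)
  rw [← ENNReal.ofReal_tsum_of_nonneg hf hs,
    ENNReal.ofReal_eq_ofReal_iff hr (tsum_nonneg hf)] at h
  exact h ▸ hs.hasSum

/-- An invariant density of a full-branch map is fixed by its transfer operator. -/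
theorem ExpandingBranches.branchSum_eq_self {a b lam D : ℝ} {g g₁ g₂ : ℕ → ℝ → ℝ}
    (hg : ExpandingBranches a b lam D g g₁ g₂) {S f : ℝ → ℝ}
    (hS : ∀ n, ∀ x ∈ Ioo a b, S (g n x) = x) (hf : ContinuousOn f (Icc a b))
    (hinv : IsInvariantDensity S (Icc a b) f) :
    (∀ x ∈ Icc a b, 0 ≤ f x) ∧ ∀ x ∈ Icc a b, f x = branchSum g g₁ f x := by
  obtain ⟨-, hf0, hinv⟩ := hinv
  have hnn : ∀ x ∈ Icc a b, 0 ≤ f x := by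
    have h1 : f =ᵐ[volume.restrict (Icc a b)] fun x => max (f x) 0 := by
      filter_upwards [hf0] with x hx using (max_eq_left hx).symm
    have h2 := Measure.eqOn_Icc_of_ae_eq volume hg.lt.ne h1 hf (hf.sup continuousOn_const)
    exact fun x hx => (h2 hx).symm ▸ le_max_right _ _
  refine ⟨hnn, ?_⟩
  set H : ℝ → ℝ≥0∞ := fun x => ENNReal.ofReal ((Icc a b).indicator f x) with hHdef
  have hH : Measurable H := (ContinuousOn.measurable_indicator_Icc hf).ennreal_ofReal
  have hμ : (volume.restrict (Icc a b)).withDensity (fun x => ENNReal.ofReal (f x)) =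
      (volume.restrict (Icc a b)).withDensity H := by
    refine withDensity_congr_ae ?_
    filter_upwards [ae_restrict_mem measurableSet_Icc] with x hx
    rw [hHdef]
    simp only [indicator_of_mem hx]
  rw [hμ] at hinv
  set μ := (volume.restrict (Icc a b)).withDensity H with hμdef
  have hac : μ ≪ volume.restrict (Icc a b) := withDensity_absolutelyContinuous _ _
  have hmass : ∀ A, MeasurableSet A → A ⊆ Ioo a b → μ A = ∑' n, μ (g n '' A) := by
    intro A hA hAI
    rw [← hinv A hA, ← measure_iUnion]
    · -- up to a null set, the preimage of `A` is the union of its images under the branches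
      refine measure_congr ?_
      have h1 : ∀ᵐ x ∂μ, x ∈ ⋃ n, g n '' Ioo a b := by
        refine hac.ae_le ?_
        filter_upwards [ae_restrict_of_ae hg.iUnion_ae_eq.mem_iff,
          ae_restrict_mem measurableSet_Icc] with x hx hxI using hx.2 hxI
      filter_upwards [h1] with x hx
      obtain ⟨n, y, hy, rfl⟩ := mem_iUnion.1 hx
      refine propext ⟨fun h => ?_, fun h => ?_⟩
      · change S (g n y) ∈ A at h
        rw [hS n y hy] at h
        exact mem_iUnion.2 ⟨n, y, h, rfl⟩
      · obtain ⟨m, z, hz, hzy⟩ := mem_iUnion.1 h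
        change S (g n y) ∈ A
        rw [← hzy, hS m z (hAI hz)]
        exact hz
    · exact fun n m hnm => (hg.disjoint hnm).mono (image_mono hAI) (image_mono hAI)
    · exact fun n => hA.image_of_continuousOn_injOn
        ((hg.isC1 n).continuousOn.mono (hAI.trans Ioo_subset_Icc_self))
        ((hg.strictMono n).injOn.mono (hAI.trans Ioo_subset_Icc_self))
  have hae := ae_density_eq hH measurableSet_Ioo Ioo_subset_Icc_self hg.isC1 hg.strictMono
    hg.mapsTo hmass
  rw [Measure.restrict_congr_set Ioo_ae_eq_Icc] at hae
  have h1 : f =ᵐ[volume.restrict (Icc a b)] branchSum g g₁ f := by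
    filter_upwards [hae, ae_restrict_mem measurableSet_Icc] with x hx hxI
    refine (HasSum.tsum_eq (hasSum_of_ofReal_eq_tsum (fun n => mul_nonneg
      (hnn _ (hg.mapsTo n hxI)) (hg.nonneg n x hxI)) (hnn x hxI) ?_)).symm
    rw [hHdef] at hx
    simp only [indicator_of_mem hxI] at hx
    rw [hx]
    refine tsum_congr fun n => ?_
    rw [indicator_of_mem (hg.mapsTo n hxI), ENNReal.ofReal_mul (hnn _ (hg.mapsTo n hxI)), mul_comm]
  obtain ⟨M, hM, hgM⟩ := hg.exists_bound
  obtain ⟨B, hB⟩ := isCompact_Icc.exists_bound_of_continuousOn hf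
  exact Measure.eqOn_Icc_of_ae_eq volume hg.lt.ne h1 hf
    (continuousOn_tsum (fun n => (hf.comp (hg.isC1 n).continuousOn (hg.mapsTo n)).mul
      (hg.isC1' n).continuousOn) (hM.mul_left B) fun n x hx =>
        abs_mul_le_of_nonneg (hB _ (hg.mapsTo n hx)) (hg.nonneg n x hx) (hgM n x hx))

/-- Two functions fixed by the transfer operator with the same integral agree. -/
theorem ExpandingBranches.ae_eq_of_fixed {a b lam D : ℝ} {g g₁ g₂ : ℕ → ℝ → ℝ}
    (hg : ExpandingBranches a b lam D g g₁ g₂) {f k : ℝ → ℝ} (hfm : Measurable f)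
    (hf : IntegrableOn f (Icc a b))
    (hfix : ∀ᵐ x ∂volume.restrict (Icc a b), f x = branchSum g g₁ f x)
    (hk : ContinuousOn k (Icc a b)) (hkfix : ∀ x ∈ Icc a b, k x = branchSum g g₁ k x)
    (hfk : ∫ x in Icc a b, f x = ∫ x in Icc a b, k x) :
    f =ᵐ[volume.restrict (Icc a b)] k := by
  have hkI : EqOn ((Icc a b).indicator k) k (Icc a b) := fun x hx => indicator_of_mem hx k
  have hkm := ContinuousOn.measurable_indicator_Icc hk
  have hki : IntegrableOn ((Icc a b).indicator k) (Icc a b) :=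
    hk.integrableOn_Icc.congr_fun hkI.symm measurableSet_Icc
  have h0 := hg.ae_eq_zero (hfm.sub hkm) (hf.sub hki) ?_ ?_
  · filter_upwards [h0, ae_restrict_mem measurableSet_Icc] with x hx hxI
    rw [← hkI hxI]
    exact sub_eq_zero.1 hx
  · have h1 := integral_sub hf hki
    rw [setIntegral_congr_fun measurableSet_Icc hkI, hfk, sub_self] at h1
    exact h1
  · filter_upwards [hfix, hg.ae_summable hfm hf, ae_restrict_mem measurableSet_Icc]
      with x hx hsx hxI
    have h1 : branchSum g g₁ (f - (Icc a b).indicator k) x =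
        branchSum g g₁ f x - branchSum g g₁ k x := by
      rw [← hg.branchSum_congr hkI hxI]
      simp only [branchSum, Pi.sub_apply, sub_mul]
      exact hsx.tsum_sub (hg.summable_term (hk.congr hkI) hxI)
    rw [h1, ← hx, ← hkfix x hxI, Pi.sub_apply, hkI hxI]

/-- The density of an invariant measure of a map with two branches is recovered from the invariant
density of the induced map. The normalization of `h` makes the measure of `[1/2, 1]` finite,
although the total mass may be infinite. -/
theorem TwoBranches.ae_eq_branchSum {T g₀ g₁ : ℝ → ℝ} (hT : TwoBranches T g₀ g₁)
    {g w d₂ : ℕ → ℝ → ℝ} {lam D : ℝ} (hgdef : ∀ n x, g n x = g₁ (g₀^[n] x))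
    (hg : ExpandingBranches (1 / 2) 1 lam D g w d₂) (hgI : ∀ n, IsC1 0 1 (g n) (w n))
    {h k : ℝ → ℝ} (hh : IsInvariantDensity T (Icc 0 1) h)
    (hh1 : ∫ x in Icc (1 / 2 : ℝ) 1, h x = 1)
    (hk : ContinuousOn k (Icc (1 / 2) 1)) (hkfix : ∀ x ∈ Icc (1 / 2) 1, k x = branchSum g w k x)
    (hk1 : ∫ x in Icc (1 / 2 : ℝ) 1, k x = 1) :
    h =ᵐ[volume.restrict (Icc 0 1)] branchSum g w k := by
  obtain ⟨hhm, hh0, hinv⟩ := hh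
  have hDI : Icc (1 / 2 : ℝ) 1 ⊆ Icc 0 1 := Icc_subset_Icc_left (by norm_num)
  -- a measurable nonnegative version of `h`
  set f : ℝ → ℝ := fun x => max (hhm.mk h x) 0 with hfdef
  have hfm : Measurable f := hhm.measurable_mk.max measurable_const
  have hf0 : ∀ x, 0 ≤ f x := fun x => le_max_right _ _
  have hhf : h =ᵐ[volume.restrict (Icc 0 1)] f := by
    filter_upwards [hhm.ae_eq_mk, hh0] with x hx hx0
    rw [hfdef]
    simp only
    rw [← hx, max_eq_left hx0]
  have hhfD : h =ᵐ[volume.restrict (Icc (1 / 2) 1)] f :=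
    ae_restrict_of_ae_restrict_of_subset hDI hhf
  have hfi : IntegrableOn f (Icc (1 / 2) 1) := by
    -- the integral of a function that is not integrable would be `0`, not `1`
    refine Integrable.congr ?_ hhfD
    by_contra hcon
    rw [integral_undef hcon] at hh1
    exact zero_ne_one hh1
  have hf1 : ∫ x in Icc (1 / 2 : ℝ) 1, f x = 1 := (integral_congr_ae hhfD).symm.trans hh1
  set H : ℝ → ℝ≥0∞ := fun x => ENNReal.ofReal (f x) with hHdef
  have hH : Measurable H := hfm.ennreal_ofReal
  have hμ : (volume.restrict (Icc 0 1)).withDensity (fun x => ENNReal.ofReal (h x)) =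
      (volume.restrict (Icc 0 1)).withDensity H :=
    withDensity_congr_ae (hhf.fun_comp ENNReal.ofReal)
  rw [hμ] at hinv
  have hgfun : ∀ n, (fun x => g₁ (g₀^[n] x)) = g n := fun n => funext fun x => (hgdef n x).symm
  have hmono : ∀ n, StrictMonoOn (g n) (Icc 0 1) := fun n => by
    rw [← hgfun n]
    exact hT.strictMono₁.comp (hT.strictMonoOn_iterate n) (hT.mapsTo_iterate n)
  have hmaps : ∀ n, MapsTo (g n) (Icc 0 1) (Icc (1 / 2) 1) := fun n => by
    rw [← hgfun n]
    exact hT.mapsTo₁.comp (hT.mapsTo_iterate n)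
  have hw0 : ∀ n, ∀ x ∈ Icc (0 : ℝ) 1, 0 ≤ w n x := fun n x hx => by
    rw [← (hgI n).derivWithin_eq zero_lt_one hx]
    exact (hmono n).monotoneOn.derivWithin_nonneg
  have hcov := hg.cover
  have hdisj := hg.disjoint
  simp only [← hgfun] at hcov hdisj
  have hfin : (volume.restrict (Icc 0 1)).withDensity H (Icc (1 / 2) 1) ≠ ⊤ := by
    rw [withDensity_restrict_apply H measurableSet_Icc hDI]
    have := hfi.2.ne
    simpa only [fun x => Real.enorm_of_nonneg (hf0 x)] using this
  have hJI : Ioo (1 / 2 : ℝ) 1 ⊆ Icc 0 1 := Ioo_subset_Icc_self.trans hDI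
  have hpiece : ∀ j : ℕ, ∀ᵐ x ∂volume.restrict (g₀^[j] '' Ioo (1 / 2) 1),
      H x = ∑' n, ENNReal.ofReal (w n x) * H (g n x) := fun j =>
    ae_density_eq hH (hT.measurableSet_image_iterate measurableSet_Ioo hJI j)
      ((hT.mapsTo_iterate j).mono_left hJI).image_subset hgI hmono
      (fun n => (hmaps n).mono_right hDI) fun A hA hAj => by
        rw [hT.measure_eq_tsum (withDensity_absolutelyContinuous _ _) hinv hfin hdisj hcov j hA hAj]
        simp only [hgfun]
  have hunion : ∀ᵐ x ∂volume.restrict (Icc (0 : ℝ) 1),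
      H x = ∑' n, ENNReal.ofReal (w n x) * H (g n x) := by
    have h1 := (ae_restrict_iUnion_iff (μ := volume) (fun j : ℕ => g₀^[j] '' Ioo (1 / 2) 1)
      (fun x => H x = ∑' n, ENNReal.ofReal (w n x) * H (g n x))).2 hpiece
    exact h1.filter_mono (ae_mono (Measure.restrict_mono_ae
      (ae_le_set.2 (hT.volume_diff_iUnion hcov))))
  have hsumf : ∀ᵐ x ∂volume.restrict (Icc (0 : ℝ) 1),
      HasSum (fun n => f (g n x) * w n x) (f x) := by
    filter_upwards [hunion, ae_restrict_mem measurableSet_Icc] with x hx hxI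
    refine hasSum_of_ofReal_eq_tsum (fun n => mul_nonneg (hf0 _) (hw0 n x hxI)) (hf0 x) ?_
    rw [← hHdef] at *
    refine hx.trans (tsum_congr fun n => ?_)
    rw [ENNReal.ofReal_mul (hf0 _), mul_comm]
  have hfk : f =ᵐ[volume.restrict (Icc (1 / 2) 1)] k := by
    refine hg.ae_eq_of_fixed hfm hfi ?_ hk hkfix (hf1.trans hk1.symm)
    filter_upwards [ae_restrict_of_ae_restrict_of_subset hDI hsumf] with x hx using hx.tsum_eq.symm
  -- the branches pull null sets back to sets where their derivatives vanish
  have hpull : ∀ n, ∀ᵐ x ∂volume.restrict (Icc (0 : ℝ) 1),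
      f (g n x) * w n x = k (g n x) * w n x := by
    intro n
    set φ : ℝ → ℝ≥0∞ := fun x => ‖f x - (Icc (1 / 2) 1).indicator k x‖ₑ with hφ
    have hφm : Measurable φ := (hfm.sub (ContinuousOn.measurable_indicator_Icc hk)).enorm
    have h1 : ∫⁻ x in Icc (0 : ℝ) 1, ENNReal.ofReal (w n x) * φ (g n x) = 0 := by
      rw [← lintegral_image_eq_lintegral_deriv_mul_of_monotoneOn measurableSet_Icc
        (hgI n).hasDeriv (hmono n).monotoneOn]
      refine le_antisymm ((lintegral_mono_set (hmaps n).image_subset).trans ?_) zero_le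
      refine (lintegral_congr_ae (?_ : φ =ᵐ[_] 0)).trans_le (by simp)
      filter_upwards [hfk, ae_restrict_mem measurableSet_Icc] with x hx hxI
      rw [hφ]
      simp only [indicator_of_mem hxI, hx, sub_self, enorm_zero, Pi.zero_apply]
    have hm : AEMeasurable (fun x => ENNReal.ofReal (w n x) * φ (g n x))
        (volume.restrict (Icc 0 1)) :=
      ((hgI n).cont_deriv.aemeasurable measurableSet_Icc).ennreal_ofReal.mul
        (hφm.comp_aemeasurable ((hgI n).continuousOn.aemeasurable measurableSet_Icc))
    rw [lintegral_eq_zero_iff' hm] at h1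
    filter_upwards [h1, ae_restrict_mem measurableSet_Icc] with x hx hxI
    have h2 := mul_eq_zero.1 hx
    rw [ENNReal.ofReal_eq_zero, hφ, enorm_eq_zero, indicator_of_mem (hmaps n hxI)] at h2
    rcases h2 with h2 | h2
    · rw [le_antisymm h2 (hw0 n x hxI), mul_zero, mul_zero]
    · rw [sub_eq_zero.1 h2]
  filter_upwards [hhf, hsumf, ae_all_iff.2 hpull] with x hx hsx hpx
  rw [hx, ← hsx.tsum_eq]
  exact tsum_congr hpx

end

section

/-! ### Parametrized families of branches -/

/-- A function that is continuous in `x` and differentiable in the parameter, with jointly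
continuous derivative, is jointly continuous. -/
theorem continuousOn_prod_of_hasDerivAt {V S : Set ℝ} (hV : IsOpen V) {f f' : ℝ → ℝ → ℝ}
    (hf : ∀ ε ∈ V, ContinuousOn (f ε) S)
    (hd : ∀ ε ∈ V, ∀ x ∈ S, HasDerivAt (fun e => f e x) (f' ε x) ε)
    (hc : ContinuousOn (fun p : ℝ × ℝ => f' p.1 p.2) (V ×ˢ S)) :
    ContinuousOn (fun p : ℝ × ℝ => f p.1 p.2) (V ×ˢ S) := by
  rintro ⟨ε₀, x₀⟩ ⟨hε₀, hx₀⟩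
  simp only at hε₀ hx₀
  -- near the point, the derivative in the parameter is bounded
  set C := |f' ε₀ x₀| + 1 with hC
  have h1 : ∀ᶠ p in 𝓝[V ×ˢ S] (ε₀, x₀), |f' p.1 p.2| < C :=
    (hc (ε₀, x₀) ⟨hε₀, hx₀⟩).abs.eventually (gt_mem_nhds (by simp [hC]))
  rw [nhdsWithin_prod_eq, hV.nhdsWithin_eq hε₀, Filter.eventually_prod_iff] at h1
  obtain ⟨pa, ha, pb, hb, hab⟩ := h1
  obtain ⟨r, hr, hrball⟩ := Metric.eventually_nhds_iff_ball.1 (ha.and (hV.mem_nhds hε₀))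
  have hbd : ∀ ε ∈ Metric.ball ε₀ r, ∀ x, pb x → x ∈ S → |f ε x - f ε₀ x| ≤ C * |ε - ε₀| := by
    intro ε hε x hx hxS
    exact (convex_ball ε₀ r).norm_image_sub_le_of_norm_hasDerivWithin_le
      (f := fun e => f e x) (f' := fun e => f' e x)
      (fun e he => (hd e (hrball e he).2 x hxS).hasDerivWithinAt)
      (fun e he => (hab (hrball e he).1 hx).le) (Metric.mem_ball_self hr) hε
  have hlim : Tendsto (fun p : ℝ × ℝ => C * |p.1 - ε₀| + |f ε₀ p.2 - f ε₀ x₀|)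
      (𝓝[V ×ˢ S] (ε₀, x₀)) (𝓝 0) := by
    have h2 : Tendsto (fun p : ℝ × ℝ => C * |p.1 - ε₀|) (𝓝[V ×ˢ S] (ε₀, x₀)) (𝓝 0) := by
      have : Continuous fun p : ℝ × ℝ => C * |p.1 - ε₀| := by fun_prop
      simpa using (this.tendsto (ε₀, x₀)).mono_left nhdsWithin_le_nhds
    have h3 : Tendsto (fun p : ℝ × ℝ => f ε₀ p.2) (𝓝[V ×ˢ S] (ε₀, x₀)) (𝓝 (f ε₀ x₀)) := by
      refine (hf ε₀ hε₀ x₀ hx₀).tendsto.comp ?_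
      rw [nhdsWithin_prod_eq]
      exact tendsto_snd
    simpa using h2.add (h3.sub_const (f ε₀ x₀)).abs
  rw [ContinuousWithinAt, tendsto_iff_dist_tendsto_zero]
  refine squeeze_zero' (Eventually.of_forall fun _ => dist_nonneg) ?_ hlim
  have hnear : ∀ᶠ p in 𝓝[V ×ˢ S] (ε₀, x₀), p.1 ∈ Metric.ball ε₀ r ∧ pb p.2 := by
    rw [nhdsWithin_prod_eq, hV.nhdsWithin_eq hε₀]
    exact Filter.Eventually.prod_mk (Metric.ball_mem_nhds ε₀ hr) hb
  filter_upwards [hnear, self_mem_nhdsWithin] with p hp hpS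
  rw [Real.dist_eq]
  calc |f p.1 p.2 - f ε₀ x₀| ≤ |f p.1 p.2 - f ε₀ p.2| + |f ε₀ p.2 - f ε₀ x₀| :=
        abs_sub_le _ _ _
    _ ≤ _ := add_le_add (hbd p.1 hp.1 p.2 hp.2 hpS.2) le_rfl

/-- The word branches `g n ε` of the inducing scheme, with their derivatives: in `x`, the first,
`w`, on `[0, 1]` and the second, `d`, on `[1/2, 1]`; in `ε`, the derivatives `α`, `β`, `δ` of `g`,
`w`, `d`. The sequence `M` dominates them, with the weight `x ^ γ` on `[0, 1]`. -/
structure BranchFamily (V : Set ℝ) (γ A D : ℝ) (M : ℕ → ℝ) (g w d α β δ : ℕ → ℝ → ℝ → ℝ) :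
    Prop where
  isOpen : IsOpen V
  zero_mem : (0 : ℝ) ∈ V
  gamma_pos : 0 < γ
  mapsTo : ∀ n, ∀ ε ∈ V, MapsTo (g n ε) (Icc 0 1) (Icc (1 / 2) 1)
  isC1 : ∀ n, ∀ ε ∈ V, IsC1 0 1 (g n ε) (w n ε)
  isC1_alpha : ∀ n, ∀ ε ∈ V, IsC1 0 1 (α n ε) (β n ε)
  isC1_beta : ∀ n, ∀ ε ∈ V, IsC1 (1 / 2) 1 (β n ε) (δ n ε)
  deriv_g : ∀ n, ∀ ε ∈ V, ∀ x ∈ Icc (0 : ℝ) 1, HasDerivAt (fun e => g n e x) (α n ε x) ε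
  deriv_w : ∀ n, ∀ ε ∈ V, ∀ x ∈ Icc (0 : ℝ) 1, HasDerivAt (fun e => w n e x) (β n ε x) ε
  deriv_d : ∀ n, ∀ ε ∈ V, ∀ x ∈ Icc (1 / 2 : ℝ) 1, HasDerivAt (fun e => d n e x) (δ n ε x) ε
  cont_alpha : ∀ n, ContinuousOn (fun p : ℝ × ℝ => α n p.1 p.2) (V ×ˢ Icc 0 1)
  cont_beta : ∀ n, ContinuousOn (fun p : ℝ × ℝ => β n p.1 p.2) (V ×ˢ Icc 0 1)
  cont_delta : ∀ n, ContinuousOn (fun p : ℝ × ℝ => δ n p.1 p.2) (V ×ˢ Icc (1 / 2) 1)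
  nonneg : ∀ n, ∀ ε ∈ V, ∀ x ∈ Icc (0 : ℝ) 1, 0 ≤ w n ε x
  summable : Summable M
  alpha_le : ∀ n, ∀ ε ∈ V, ∀ x ∈ Icc (0 : ℝ) 1, |α n ε x| ≤ A
  weight_w_le : ∀ n, ∀ ε ∈ V, ∀ x ∈ Icc (0 : ℝ) 1, x ^ γ * w n ε x ≤ M n
  weight_beta_le : ∀ n, ∀ ε ∈ V, ∀ x ∈ Icc (0 : ℝ) 1, x ^ γ * |β n ε x| ≤ M n
  w_le : ∀ n, ∀ ε ∈ V, ∀ x ∈ Icc (1 / 2 : ℝ) 1, w n ε x ≤ M n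
  beta_le : ∀ n, ∀ ε ∈ V, ∀ x ∈ Icc (1 / 2 : ℝ) 1, |β n ε x| ≤ M n
  delta_le : ∀ n, ∀ ε ∈ V, ∀ x ∈ Icc (1 / 2 : ℝ) 1, |δ n ε x| ≤ M n
  expanding : ∀ ε ∈ V, ∃ lam, ExpandingBranches (1 / 2) 1 lam D (fun n => g n ε)
    (fun n => w n ε) (fun n => d n ε)

theorem IsC1.mul {a b : ℝ} {u u' v v' : ℝ → ℝ} (h : IsC1 a b u u') (k : IsC1 a b v v') :
    IsC1 a b (fun x => u x * v x) (fun x => u' x * v x + u x * v' x) :=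
  ⟨fun x hx => (h.hasDeriv x hx).mul (k.hasDeriv x hx),
    (h.cont_deriv.mul k.continuousOn).add (h.continuousOn.mul k.cont_deriv)⟩

theorem IsC1.comp {a b c d : ℝ} {u u' v v' : ℝ → ℝ} (h : IsC1 c d u u') (k : IsC1 a b v v')
    (hm : MapsTo v (Icc a b) (Icc c d)) :
    IsC1 a b (fun x => u (v x)) (fun x => u' (v x) * v' x) :=
  ⟨fun x hx => (h.hasDeriv _ (hm hx)).comp x (k.hasDeriv x hx) hm,
    (h.cont_deriv.comp k.continuousOn hm).mul k.cont_deriv⟩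

theorem IsC1.mono {a b c d : ℝ} {u u' : ℝ → ℝ} (h : IsC1 c d u u') (hs : Icc a b ⊆ Icc c d) :
    IsC1 a b u u' :=
  ⟨fun x hx => (h.hasDeriv x (hs hx)).mono hs, h.cont_deriv.mono hs⟩

theorem half_Icc_subset : Icc (1 / 2 : ℝ) 1 ⊆ Icc 0 1 := Icc_subset_Icc_left (by norm_num)

namespace BranchFamily

variable {V : Set ℝ} {γ A D : ℝ} {M : ℕ → ℝ} {g w d α β δ : ℕ → ℝ → ℝ → ℝ}
  {u u' φ φ' φ'' : ℝ → ℝ}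

theorem cont_g (h : BranchFamily V γ A D M g w d α β δ) (n : ℕ) :
    ContinuousOn (fun p : ℝ × ℝ => g n p.1 p.2) (V ×ˢ Icc 0 1) :=
  continuousOn_prod_of_hasDerivAt h.isOpen (fun ε hε => (h.isC1 n ε hε).continuousOn)
    (h.deriv_g n) (h.cont_alpha n)

theorem cont_w (h : BranchFamily V γ A D M g w d α β δ) (n : ℕ) :
    ContinuousOn (fun p : ℝ × ℝ => w n p.1 p.2) (V ×ˢ Icc 0 1) :=
  continuousOn_prod_of_hasDerivAt h.isOpen (fun ε hε => (h.isC1 n ε hε).cont_deriv)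
    (h.deriv_w n) (h.cont_beta n)

theorem cont_d (h : BranchFamily V γ A D M g w d α β δ) (n : ℕ) :
    ContinuousOn (fun p : ℝ × ℝ => d n p.1 p.2) (V ×ˢ Icc (1 / 2) 1) :=
  continuousOn_prod_of_hasDerivAt h.isOpen (fun ε hε => by
    obtain ⟨lam, hg⟩ := h.expanding ε hε
    exact (hg.isC1' n).cont_deriv) (h.deriv_d n) (h.cont_delta n)

theorem cont_comp (h : BranchFamily V γ A D M g w d α β δ) (hu : ContinuousOn u (Icc (1 / 2) 1))
    (n : ℕ) : ContinuousOn (fun p : ℝ × ℝ => u (g n p.1 p.2)) (V ×ˢ Icc 0 1) :=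
  hu.comp (h.cont_g n) fun p hp => h.mapsTo n p.1 hp.1 hp.2

theorem deriv_comp (h : BranchFamily V γ A D M g w d α β δ) (hu : IsC1 (1 / 2) 1 u u') (n : ℕ)
    {ε : ℝ} (hε : ε ∈ V) {x : ℝ} (hx : x ∈ Icc (0 : ℝ) 1) :
    HasDerivAt (fun e => u (g n e x)) (u' (g n ε x) * α n ε x) ε :=
  ((hu.hasDeriv _ (h.mapsTo n ε hε hx)).comp ε ((h.deriv_g n ε hε x hx).hasDerivWithinAt (s := V))
    fun e he => h.mapsTo n e he hx).hasDerivAt (h.isOpen.mem_nhds hε)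

/-- The bounds on `[1/2, 1]` include `w ≤ 1`, by expansion. -/
theorem w_le_one (h : BranchFamily V γ A D M g w d α β δ) (n : ℕ) {ε : ℝ} (hε : ε ∈ V) {x : ℝ}
    (hx : x ∈ Icc (1 / 2 : ℝ) 1) : w n ε x ≤ 1 := by
  obtain ⟨lam, hg⟩ := h.expanding ε hε
  exact (hg.le n x hx).trans hg.lam_lt.le

theorem d_le (h : BranchFamily V γ A D M g w d α β δ) (n : ℕ) {ε : ℝ} (hε : ε ∈ V) {x : ℝ}
    (hx : x ∈ Icc (1 / 2 : ℝ) 1) : |d n ε x| ≤ D * M n := by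
  obtain ⟨lam, hg⟩ := h.expanding ε hε
  exact (hg.dist n x hx).trans (mul_le_mul_of_nonneg_left (h.w_le n ε hε x hx) hg.dist_nonneg)

theorem D_nonneg (h : BranchFamily V γ A D M g w d α β δ) : 0 ≤ D := by
  obtain ⟨lam, hg⟩ := h.expanding 0 h.zero_mem
  exact hg.dist_nonneg

theorem M_nonneg (h : BranchFamily V γ A D M g w d α β δ) (n : ℕ) : 0 ≤ M n :=
  (abs_nonneg _).trans (h.beta_le n 0 h.zero_mem 1 (by norm_num))

/-- Near `ε = 0` the expansion is uniform: the derivatives of all but finitely many branches are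
small, and those of the others depend continuously on `ε`. -/
theorem exists_uniform (h : BranchFamily V γ A D M g w d α β δ) :
    ∃ lam, 0 ≤ lam ∧ lam < 1 ∧ ∀ᶠ ε in 𝓝 0, ExpandingBranches (1 / 2) 1 lam D
      (fun n => g n ε) (fun n => w n ε) (fun n => d n ε) := by
  obtain ⟨lam₀, hg₀⟩ := h.expanding 0 h.zero_mem
  have hlam₀ := hg₀.lam_lt
  have htail : ∀ᶠ n in atTop, M n < 1 / 2 :=
    h.summable.tendsto_atTop_zero.eventually (gt_mem_nhds (by norm_num))
  obtain ⟨N, hN⟩ := eventually_atTop.1 htail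
  have hfin : ∀ᶠ ε in 𝓝 0, ∀ n ∈ Finset.range N, ∀ x ∈ Icc (1 / 2 : ℝ) 1,
      |w n ε x - w n 0 x| ≤ (1 - lam₀) / 2 := by
    rw [Filter.eventually_all_finset]
    intro n _
    exact eventually_abs_sub_le h.isOpen h.zero_mem isCompact_Icc
      ((h.cont_w n).mono (prod_mono_right half_Icc_subset)) (by linarith)
  refine ⟨max (1 / 2) ((1 + lam₀) / 2), le_max_of_le_left (by norm_num),
    max_lt (by norm_num) (by linarith), ?_⟩
  filter_upwards [hfin, h.isOpen.mem_nhds h.zero_mem] with ε hε hεV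
  obtain ⟨lam, hg⟩ := h.expanding ε hεV
  refine { hg with
    lam_lt := max_lt (by norm_num) (by linarith)
    le := fun n x hx => ?_ }
  by_cases hn : n < N
  · refine le_max_of_le_right ?_
    have h1 := le_of_abs_le (hε n (Finset.mem_range.2 hn) x hx)
    have h2 := hg₀.le n x hx
    linarith
  · exact le_max_of_le_left ((h.w_le n ε hεV x hx).trans (hN n (not_lt.1 hn)).le)

/-! ### Differentiation of the transfer operator in the parameter -/

/-- The `ε`-derivative of the term `φ(g) w` of the transfer operator. -/
theorem deriv_term (h : BranchFamily V γ A D M g w d α β δ) (hφ : IsC1 (1 / 2) 1 φ φ') (n : ℕ)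
    {ε : ℝ} (hε : ε ∈ V) {x : ℝ} (hx : x ∈ Icc (0 : ℝ) 1) :
    HasDerivAt (fun e => φ (g n e x) * w n e x)
      (φ' (g n ε x) * α n ε x * w n ε x + φ (g n ε x) * β n ε x) ε :=
  (h.deriv_comp hφ n hε hx).mul (h.deriv_w n ε hε x hx)

theorem cont_deriv_term (h : BranchFamily V γ A D M g w d α β δ) (hφ : IsC1 (1 / 2) 1 φ φ')
    (n : ℕ) : ContinuousOn (fun p : ℝ × ℝ => φ' (g n p.1 p.2) * α n p.1 p.2 * w n p.1 p.2 +
      φ (g n p.1 p.2) * β n p.1 p.2) (V ×ˢ Icc 0 1) :=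
  (((h.cont_comp hφ.cont_deriv n).mul (h.cont_alpha n)).mul (h.cont_w n)).add
    ((h.cont_comp hφ.continuousOn n).mul (h.cont_beta n))

theorem abs_deriv_term_le (h : BranchFamily V γ A D M g w d α β δ) {B : ℝ}
    (hB : ∀ y ∈ Icc (1 / 2 : ℝ) 1, |φ y| ≤ B ∧ |φ' y| ≤ B) (n : ℕ) {ε : ℝ} (hε : ε ∈ V) {x : ℝ}
    (hx : x ∈ Icc (1 / 2 : ℝ) 1) :
    |φ' (g n ε x) * α n ε x * w n ε x + φ (g n ε x) * β n ε x| ≤ (B * A + B) * M n := by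
  have hxI := half_Icc_subset hx
  have hb := hB _ (h.mapsTo n ε hε hxI)
  have hB0 : 0 ≤ B := (abs_nonneg _).trans hb.1
  have h1 : |φ' (g n ε x) * α n ε x| ≤ B * A := by
    rw [abs_mul]
    exact mul_le_mul hb.2 (h.alpha_le n ε hε x hxI) (abs_nonneg _) hB0
  have h2 := abs_mul_le_of_nonneg h1 (h.nonneg n ε hε x hxI) (h.w_le n ε hε x hx)
  have h3 : |φ (g n ε x) * β n ε x| ≤ B * M n := by
    rw [abs_mul]
    exact mul_le_mul hb.1 (h.beta_le n ε hε x hx) (abs_nonneg _) hB0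
  rw [add_mul]
  exact (abs_add_le _ _).trans (add_le_add h2 h3)

theorem abs_weight_term_le (h : BranchFamily V γ A D M g w d α β δ) {B : ℝ}
    (hB : ∀ y ∈ Icc (1 / 2 : ℝ) 1, |u y| ≤ B) (n : ℕ) {ε : ℝ} (hε : ε ∈ V) {x : ℝ}
    (hx : x ∈ Icc (0 : ℝ) 1) : |x ^ γ * (u (g n ε x) * w n ε x)| ≤ B * M n := by
  rw [mul_left_comm]
  exact abs_mul_le_of_nonneg (hB _ (h.mapsTo n ε hε hx))
    (mul_nonneg (Real.rpow_nonneg hx.1 _) (h.nonneg n ε hε x hx)) (h.weight_w_le n ε hε x hx)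

theorem abs_weight_deriv_term_le (h : BranchFamily V γ A D M g w d α β δ) {B : ℝ}
    (hB : ∀ y ∈ Icc (1 / 2 : ℝ) 1, |φ y| ≤ B ∧ |φ' y| ≤ B) (n : ℕ) {ε : ℝ} (hε : ε ∈ V) {x : ℝ}
    (hx : x ∈ Icc (0 : ℝ) 1) :
    |x ^ γ * (φ' (g n ε x) * α n ε x * w n ε x + φ (g n ε x) * β n ε x)| ≤
      (B * A + B) * M n := by
  have hb := hB _ (h.mapsTo n ε hε hx)
  have hB0 : 0 ≤ B := (abs_nonneg _).trans hb.1
  have hxγ : 0 ≤ x ^ γ := Real.rpow_nonneg hx.1 _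
  have h1 : |φ' (g n ε x) * α n ε x| ≤ B * A := by
    rw [abs_mul]
    exact mul_le_mul hb.2 (h.alpha_le n ε hε x hx) (abs_nonneg _) hB0
  have h2 := abs_mul_le_of_nonneg h1 (mul_nonneg hxγ (h.nonneg n ε hε x hx))
    (h.weight_w_le n ε hε x hx)
  have h3 : |φ (g n ε x) * (x ^ γ * β n ε x)| ≤ B * M n := by
    rw [abs_mul, abs_mul (x ^ γ), abs_of_nonneg hxγ]
    exact mul_le_mul hb.1 (h.weight_beta_le n ε hε x hx) (by positivity) hB0
  rw [add_mul]
  refine le_trans (le_of_eq ?_) ((abs_add_le _ _).trans (add_le_add h2 h3))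
  ring_nf

/-- The mixed derivative of the term `φ(g) w`, in `x` and then in `ε`. -/
theorem deriv_deriv_term (h : BranchFamily V γ A D M g w d α β δ) (hφ : IsC1 (1 / 2) 1 φ φ')
    (hφ' : IsC1 (1 / 2) 1 φ' φ'') (n : ℕ) {ε : ℝ} (hε : ε ∈ V) {x : ℝ}
    (hx : x ∈ Icc (1 / 2 : ℝ) 1) :
    HasDerivAt (fun e => φ' (g n e x) * w n e x * w n e x + φ (g n e x) * d n e x)
      ((φ'' (g n ε x) * α n ε x * w n ε x + φ' (g n ε x) * β n ε x) * w n ε x +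
        φ' (g n ε x) * w n ε x * β n ε x +
        (φ' (g n ε x) * α n ε x * d n ε x + φ (g n ε x) * δ n ε x)) ε := by
  have hxI := half_Icc_subset hx
  exact ((h.deriv_term hφ' n hε hxI).mul (h.deriv_w n ε hε x hxI)).add
    ((h.deriv_comp hφ n hε hxI).mul (h.deriv_d n ε hε x hx))

theorem cont_deriv_deriv_term (h : BranchFamily V γ A D M g w d α β δ)
    (hφ : IsC1 (1 / 2) 1 φ φ') (hφ' : IsC1 (1 / 2) 1 φ' φ'') (n : ℕ) :
    ContinuousOn (fun p : ℝ × ℝ =>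
      (φ'' (g n p.1 p.2) * α n p.1 p.2 * w n p.1 p.2 + φ' (g n p.1 p.2) * β n p.1 p.2) *
          w n p.1 p.2 +
        φ' (g n p.1 p.2) * w n p.1 p.2 * β n p.1 p.2 +
        (φ' (g n p.1 p.2) * α n p.1 p.2 * d n p.1 p.2 + φ (g n p.1 p.2) * δ n p.1 p.2))
      (V ×ˢ Icc (1 / 2) 1) := by
  have hsub : V ×ˢ Icc (1 / 2 : ℝ) 1 ⊆ V ×ˢ Icc 0 1 := prod_mono_right half_Icc_subset
  have hw := (h.cont_w n).mono hsub
  have hα := (h.cont_alpha n).mono hsub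
  have hφg := (h.cont_comp hφ.continuousOn n).mono hsub
  have hφg' := (h.cont_comp hφ.cont_deriv n).mono hsub
  exact ((((h.cont_deriv_term hφ' n).mono hsub).mul hw).add
    ((hφg'.mul hw).mul ((h.cont_beta n).mono hsub))).add
    (((hφg'.mul hα).mul (h.cont_d n)).add (hφg.mul (h.cont_delta n)))

theorem abs_deriv_deriv_term_le (h : BranchFamily V γ A D M g w d α β δ) {B : ℝ}
    (hB : ∀ y ∈ Icc (1 / 2 : ℝ) 1, |φ y| ≤ B ∧ |φ' y| ≤ B)
    (hB' : ∀ y ∈ Icc (1 / 2 : ℝ) 1, |φ' y| ≤ B ∧ |φ'' y| ≤ B) (n : ℕ) {ε : ℝ} (hε : ε ∈ V)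
    {x : ℝ} (hx : x ∈ Icc (1 / 2 : ℝ) 1) :
    |(φ'' (g n ε x) * α n ε x * w n ε x + φ' (g n ε x) * β n ε x) * w n ε x +
        φ' (g n ε x) * w n ε x * β n ε x +
        (φ' (g n ε x) * α n ε x * d n ε x + φ (g n ε x) * δ n ε x)| ≤
      (B * A + B + B + (B * A * D + B)) * M n := by
  have hxI := half_Icc_subset hx
  have hb := hB _ (h.mapsTo n ε hε hxI)
  have hB0 : 0 ≤ B := (abs_nonneg _).trans hb.1
  have hw0 := h.nonneg n ε hε x hxI
  have hw1 := h.w_le_one n hε hx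
  have h1 := abs_mul_le_of_nonneg (h.abs_deriv_term_le hB' n hε hx) hw0 hw1
  have h2 : |φ' (g n ε x) * w n ε x * β n ε x| ≤ B * 1 * M n := by
    rw [abs_mul]
    exact mul_le_mul (abs_mul_le_of_nonneg hb.2 hw0 hw1) (h.beta_le n ε hε x hx) (abs_nonneg _)
      (by positivity)
  have h3 : |φ' (g n ε x) * α n ε x * d n ε x| ≤ B * A * (D * M n) := by
    have hBA : |φ' (g n ε x) * α n ε x| ≤ B * A := by
      rw [abs_mul]
      exact mul_le_mul hb.2 (h.alpha_le n ε hε x hxI) (abs_nonneg _) hB0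
    rw [abs_mul]
    exact mul_le_mul hBA (h.d_le n hε hx) (abs_nonneg _) ((abs_nonneg _).trans hBA)
  have h4 : |φ (g n ε x) * δ n ε x| ≤ B * M n := by
    rw [abs_mul]
    exact mul_le_mul hb.1 (h.delta_le n ε hε x hx) (abs_nonneg _) hB0
  refine (abs_add_three _ _ _).trans ?_
  have h5 := (abs_add_le (φ' (g n ε x) * α n ε x * d n ε x) (φ (g n ε x) * δ n ε x))
  linarith

/-- The `ε`-derivative at `0` of `L_ε φ` is of class `C¹`, and differentiation in `x` and `ε`
commute. -/
theorem isC1_response (h : BranchFamily V γ A D M g w d α β δ) (hφ : IsC1 (1 / 2) 1 φ φ')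
    (hφ' : IsC1 (1 / 2) 1 φ' φ'') :
    IsC1 (1 / 2) 1
      (fun x => ∑' n, (φ' (g n 0 x) * α n 0 x * w n 0 x + φ (g n 0 x) * β n 0 x))
      (fun x => ∑' n, ((φ'' (g n 0 x) * α n 0 x * w n 0 x + φ' (g n 0 x) * β n 0 x) * w n 0 x +
        φ' (g n 0 x) * w n 0 x * β n 0 x +
        (φ' (g n 0 x) * α n 0 x * d n 0 x + φ (g n 0 x) * δ n 0 x))) := by
  obtain ⟨B₁, hB₁0, hB₁⟩ := hφ.exists_bound
  obtain ⟨B₂, hB₂0, hB₂⟩ := hφ'.exists_bound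
  obtain ⟨lam, hg⟩ := h.expanding 0 h.zero_mem
  have hA : 0 ≤ A := (abs_nonneg _).trans (h.alpha_le 0 0 h.zero_mem 1 (by norm_num))
  have hD := h.D_nonneg
  set B := max B₁ B₂ with hBdef
  have hB0 : 0 ≤ B := le_max_of_le_left hB₁0
  have hB : ∀ y ∈ Icc (1 / 2 : ℝ) 1, |φ y| ≤ B ∧ |φ' y| ≤ B := fun y hy =>
    ⟨(hB₁ y hy).1.trans (le_max_left _ _), (hB₁ y hy).2.trans (le_max_left _ _)⟩
  have hB' : ∀ y ∈ Icc (1 / 2 : ℝ) 1, |φ' y| ≤ B ∧ |φ'' y| ≤ B := fun y hy =>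
    ⟨(hB₂ y hy).1.trans (le_max_right _ _), (hB₂ y hy).2.trans (le_max_right _ _)⟩
  refine IsC1.tsum (by norm_num) (h.summable.mul_left (B * A + B + B + (B * A * D + B)))
    (fun n => ?_) (fun n x hx => ?_) fun n x hx => h.abs_deriv_deriv_term_le hB hB' n h.zero_mem hx
  · have hgn := hg.isC1 n
    have hm := hg.mapsTo n
    have h1 := (((hφ'.comp hgn hm).mul ((h.isC1_alpha n 0 h.zero_mem).mono half_Icc_subset)).mul
      (hg.isC1' n)).add ((hφ.comp hgn hm).mul (h.isC1_beta n 0 h.zero_mem))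
    refine ⟨fun x hx => (h1.hasDeriv x hx).congr_deriv (by ring), ?_⟩
    exact h1.cont_deriv.congr fun x hx => by ring
  · refine (h.abs_deriv_term_le hB n h.zero_mem hx).trans
      (mul_le_mul_of_nonneg_right ?_ (h.M_nonneg n))
    have : 0 ≤ B * A * D := by positivity
    linarith

/-- `L_ε φ` is differentiable in `ε` at `0`, uniformly on `[1/2, 1]` together with its derivative
in `x`. -/
theorem slope_branchSum (h : BranchFamily V γ A D M g w d α β δ) (hφ : IsC1 (1 / 2) 1 φ φ')
    (hφ' : IsC1 (1 / 2) 1 φ' φ'') :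
    ∀ η > 0, ∀ᶠ ε in 𝓝[≠] 0, ∀ x ∈ Icc (1 / 2 : ℝ) 1,
      |(branchSum (fun n => g n ε) (fun n => w n ε) φ x -
          branchSum (fun n => g n 0) (fun n => w n 0) φ x) / ε -
        ∑' n, (φ' (g n 0 x) * α n 0 x * w n 0 x + φ (g n 0 x) * β n 0 x)| ≤ η ∧
      |(∑' n, (φ' (g n ε x) * w n ε x * w n ε x + φ (g n ε x) * d n ε x) -
          ∑' n, (φ' (g n 0 x) * w n 0 x * w n 0 x + φ (g n 0 x) * d n 0 x)) / ε -
        ∑' n, ((φ'' (g n 0 x) * α n 0 x * w n 0 x + φ' (g n 0 x) * β n 0 x) * w n 0 x +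
          φ' (g n 0 x) * w n 0 x * β n 0 x +
          (φ' (g n 0 x) * α n 0 x * d n 0 x + φ (g n 0 x) * δ n 0 x))| ≤ η := by
  obtain ⟨B₁, hB₁0, hB₁⟩ := hφ.exists_bound
  obtain ⟨B₂, hB₂0, hB₂⟩ := hφ'.exists_bound
  set B := max B₁ B₂ with hBdef
  have hB : ∀ y ∈ Icc (1 / 2 : ℝ) 1, |φ y| ≤ B ∧ |φ' y| ≤ B := fun y hy =>
    ⟨(hB₁ y hy).1.trans (le_max_left _ _), (hB₁ y hy).2.trans (le_max_left _ _)⟩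
  have hB' : ∀ y ∈ Icc (1 / 2 : ℝ) 1, |φ' y| ≤ B ∧ |φ'' y| ≤ B := fun y hy =>
    ⟨(hB₂ y hy).1.trans (le_max_right _ _), (hB₂ y hy).2.trans (le_max_right _ _)⟩
  intro η hη
  have hsub : V ×ˢ Icc (1 / 2 : ℝ) 1 ⊆ V ×ˢ Icc 0 1 := prod_mono_right half_Icc_subset
  have h1 := tsum_slope_sub_le h.isOpen h.zero_mem (isCompact_Icc (a := (1 / 2 : ℝ)) (b := 1))
    (h.summable.mul_left (B * A + B))
    (fun n ε hε x hx => h.deriv_term hφ n hε (half_Icc_subset hx))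
    (fun n => (h.cont_deriv_term hφ n).mono hsub)
    (fun n ε hε x hx => h.abs_deriv_term_le hB n hε hx)
    (fun ε hε x hx => by
      obtain ⟨lam, hg⟩ := h.expanding ε hε
      exact hg.summable_term hφ.continuousOn hx) η hη
  have h2 := tsum_slope_sub_le h.isOpen h.zero_mem (isCompact_Icc (a := (1 / 2 : ℝ)) (b := 1))
    (h.summable.mul_left (B * A + B + B + (B * A * D + B)))
    (fun n ε hε x hx => h.deriv_deriv_term hφ hφ' n hε hx)
    (fun n => h.cont_deriv_deriv_term hφ hφ' n)
    (fun n ε hε x hx => h.abs_deriv_deriv_term_le hB hB' n hε hx)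
    (fun ε hε x hx => by
      obtain ⟨lam, hg⟩ := h.expanding ε hε
      exact Summable.of_norm_bounded (h.summable.mul_left (lam * B + D * B)) fun n =>
        (hg.abs_deriv_term_le hx (hB _ (hg.mapsTo n hx)).1 (hB _ (hg.mapsTo n hx)).2).trans
        (mul_le_mul_of_nonneg_left (h.w_le n ε hε x hx) (by
          have := hg.lam_nonneg
          have := hg.dist_nonneg
          have : 0 ≤ B := le_max_of_le_left hB₁0
          positivity))) η hη
  filter_upwards [h1, h2] with ε hε₁ hε₂ x hx using ⟨hε₁ x hx, hε₂ x hx⟩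

/-- The weighted version of the differentiability of `L_ε φ` in `ε`, on `(0, 1]`. -/
theorem weight_slope_branchSum (h : BranchFamily V γ A D M g w d α β δ)
    (hφ : IsC1 (1 / 2) 1 φ φ') :
    ∀ η > 0, ∀ᶠ ε in 𝓝[≠] 0, ∀ x ∈ Icc (0 : ℝ) 1,
      |x ^ γ * ((branchSum (fun n => g n ε) (fun n => w n ε) φ x -
          branchSum (fun n => g n 0) (fun n => w n 0) φ x) / ε -
        ∑' n, (φ' (g n 0 x) * α n 0 x * w n 0 x + φ (g n 0 x) * β n 0 x))| ≤ η := by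
  obtain ⟨B, hB0, hB⟩ := hφ.exists_bound
  intro η hη
  have hrpow : Continuous fun p : ℝ × ℝ => p.2 ^ γ :=
    (Real.continuous_rpow_const h.gamma_pos.le).comp continuous_snd
  have h1 := tsum_slope_sub_le h.isOpen h.zero_mem (isCompact_Icc (a := (0 : ℝ)) (b := 1))
    (f := fun n ε x => x ^ γ * (φ (g n ε x) * w n ε x))
    (f' := fun n ε x => x ^ γ * (φ' (g n ε x) * α n ε x * w n ε x + φ (g n ε x) * β n ε x))
    (h.summable.mul_left (B * A + B))
    (fun n ε hε x hx => (h.deriv_term hφ n hε hx).const_mul _)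
    (fun n => hrpow.continuousOn.mul (h.cont_deriv_term hφ n))
    (fun n ε hε x hx => h.abs_weight_deriv_term_le hB n hε hx)
    (fun ε hε x hx => Summable.of_norm_bounded (h.summable.mul_left B) fun n =>
      h.abs_weight_term_le (fun y hy => (hB y hy).1) n hε hx) η hη
  filter_upwards [h1] with ε hε x hx
  have h2 := hε x hx
  simp only [tsum_mul_left] at h2
  rwa [← mul_sub, mul_div_assoc, ← mul_sub] at h2

/-- `L_ε u` depends continuously on `ε` at `0`, uniformly on `[1/2, 1]` together with its
derivative in `x`. -/
theorem tendsto_branchSum (h : BranchFamily V γ A D M g w d α β δ) (hu : IsC1 (1 / 2) 1 u u') :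
    ∀ η > 0, ∀ᶠ ε in 𝓝 0, ∀ x ∈ Icc (1 / 2 : ℝ) 1,
      |branchSum (fun n => g n ε) (fun n => w n ε) u x -
          branchSum (fun n => g n 0) (fun n => w n 0) u x| ≤ η ∧
      |∑' n, (u' (g n ε x) * w n ε x * w n ε x + u (g n ε x) * d n ε x) -
          ∑' n, (u' (g n 0 x) * w n 0 x * w n 0 x + u (g n 0 x) * d n 0 x)| ≤ η := by
  obtain ⟨B, hB0, hB⟩ := hu.exists_bound
  intro η hη
  have hsub : V ×ˢ Icc (1 / 2 : ℝ) 1 ⊆ V ×ˢ Icc 0 1 := prod_mono_right half_Icc_subset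
  have h1 := tsum_sub_le h.isOpen h.zero_mem (isCompact_Icc (a := (1 / 2 : ℝ)) (b := 1))
    (f := fun n ε x => u (g n ε x) * w n ε x) (h.summable.mul_left B)
    (fun n => ((h.cont_comp hu.continuousOn n).mul (h.cont_w n)).mono hsub)
    (fun n ε hε x hx => abs_mul_le_of_nonneg (hB _ (h.mapsTo n ε hε (half_Icc_subset hx))).1
      (h.nonneg n ε hε x (half_Icc_subset hx)) (h.w_le n ε hε x hx)) η hη
  have h2 := tsum_sub_le h.isOpen h.zero_mem (isCompact_Icc (a := (1 / 2 : ℝ)) (b := 1))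
    (f := fun n ε x => u' (g n ε x) * w n ε x * w n ε x + u (g n ε x) * d n ε x)
    (h.summable.mul_left (B + D * B))
    (fun n => ((((h.cont_comp hu.cont_deriv n).mul (h.cont_w n)).mul (h.cont_w n)).mono hsub).add
      (((h.cont_comp hu.continuousOn n).mono hsub).mul (h.cont_d n)))
    (fun n ε hε x hx => by
      obtain ⟨lam, hg⟩ := h.expanding ε hε
      refine (hg.abs_deriv_term_le hx (hB _ (hg.mapsTo n hx)).1 (hB _ (hg.mapsTo n hx)).2).trans ?_
      refine mul_le_mul ?_ (h.w_le n ε hε x hx) (hg.nonneg n x hx) ?_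
      · have := mul_le_of_le_one_left hB0 hg.lam_lt.le
        linarith
      · have := mul_nonneg hg.dist_nonneg hB0
        linarith) η hη
  filter_upwards [h1, h2] with ε hε₁ hε₂ x hx using ⟨hε₁ x hx, hε₂ x hx⟩

theorem weight_tendsto_branchSum (h : BranchFamily V γ A D M g w d α β δ)
    (hu : ContinuousOn u (Icc (1 / 2) 1)) :
    ∀ η > 0, ∀ᶠ ε in 𝓝 0, ∀ x ∈ Icc (0 : ℝ) 1,
      |x ^ γ * (branchSum (fun n => g n ε) (fun n => w n ε) u x -
          branchSum (fun n => g n 0) (fun n => w n 0) u x)| ≤ η := by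
  obtain ⟨B, hB⟩ := isCompact_Icc.exists_bound_of_continuousOn hu
  intro η hη
  have hrpow : Continuous fun p : ℝ × ℝ => p.2 ^ γ :=
    (Real.continuous_rpow_const h.gamma_pos.le).comp continuous_snd
  have h1 := tsum_sub_le h.isOpen h.zero_mem (isCompact_Icc (a := (0 : ℝ)) (b := 1))
    (f := fun n ε x => x ^ γ * (u (g n ε x) * w n ε x)) (h.summable.mul_left B)
    (fun n => hrpow.continuousOn.mul ((h.cont_comp hu n).mul (h.cont_w n)))
    (fun n ε hε x hx => h.abs_weight_term_le hB n hε hx) η hη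
  filter_upwards [h1] with ε hε x hx
  have h2 := hε x hx
  simp only [tsum_mul_left] at h2
  rwa [← mul_sub] at h2

theorem abs_weight_branchSum_le (h : BranchFamily V γ A D M g w d α β δ) {B : ℝ}
    (hB : ∀ y ∈ Icc (1 / 2 : ℝ) 1, |u y| ≤ B) {ε : ℝ} (hε : ε ∈ V) {x : ℝ}
    (hx : x ∈ Icc (0 : ℝ) 1) :
    |x ^ γ * branchSum (fun n => g n ε) (fun n => w n ε) u x| ≤ B * ∑' n, M n := by
  rw [branchSum, ← tsum_mul_left, ← tsum_mul_left, ← Real.norm_eq_abs]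
  exact tsum_of_norm_bounded (h.summable.mul_left B).hasSum fun n =>
    h.abs_weight_term_le hB n hε hx

end BranchFamily

end

section

/-! ### Linear response of the induced map and of the full map -/

/-- A series whose terms, multiplied by the weight, are continuous and dominated on `[0, 1]`
converges to a continuous function on `(0, 1]`. -/
theorem continuousOn_tsum_of_weight {γ : ℝ} (hγ : 0 < γ) {f : ℕ → ℝ → ℝ} {M : ℕ → ℝ}
    (hM : Summable M) (hc : ∀ n, ContinuousOn (f n) (Icc 0 1))
    (hf : ∀ n, ∀ x ∈ Icc (0 : ℝ) 1, |x ^ γ * f n x| ≤ M n) :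
    ContinuousOn (fun x => ∑' n, f n x) (Ioc 0 1) := by
  have hpow : ContinuousOn (fun x : ℝ => x ^ γ) (Icc 0 1) :=
    (Real.continuous_rpow_const hγ.le).continuousOn
  have h1 : ContinuousOn (fun x => ∑' n, x ^ γ * f n x) (Ioc 0 1) :=
    (continuousOn_tsum (fun n => hpow.mul (hc n)) hM hf).mono Ioc_subset_Icc_self
  have h2 : ContinuousOn (fun x : ℝ => (x ^ γ)⁻¹) (Ioc 0 1) :=
    (hpow.mono Ioc_subset_Icc_self).inv₀ fun x hx => (Real.rpow_pos_of_pos hx.1 γ).ne'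
  refine (h2.mul h1).congr fun x hx => ?_
  rw [Pi.mul_apply, tsum_mul_left, inv_mul_cancel_left₀ (Real.rpow_pos_of_pos hx.1 γ).ne']

theorem summable_of_weight {γ : ℝ} {f M : ℕ → ℝ} (hM : Summable M) {x : ℝ}
    (hx : 0 < x) (hf : ∀ n, |x ^ γ * f n| ≤ M n) : Summable f :=
  (summable_mul_left_iff (Real.rpow_pos_of_pos hx γ).ne').1 (Summable.of_norm_bounded hM hf)

namespace BranchFamily

variable {V : Set ℝ} {γ A D : ℝ} {M : ℕ → ℝ} {g w d α β δ : ℕ → ℝ → ℝ → ℝ}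
  {u u' v φ φ' φ'' : ℝ → ℝ}

theorem summable_term (h : BranchFamily V γ A D M g w d α β δ)
    (hu : ContinuousOn u (Icc (1 / 2) 1)) {ε : ℝ} (hε : ε ∈ V) {x : ℝ} (hx : x ∈ Ioc (0 : ℝ) 1) :
    Summable fun n => u (g n ε x) * w n ε x := by
  obtain ⟨B, hB⟩ := isCompact_Icc.exists_bound_of_continuousOn hu
  exact summable_of_weight (h.summable.mul_left B) hx.1 fun n =>
    h.abs_weight_term_le hB n hε (Ioc_subset_Icc_self hx)

theorem continuousOn_branchSum (h : BranchFamily V γ A D M g w d α β δ)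
    (hu : ContinuousOn u (Icc (1 / 2) 1)) {ε : ℝ} (hε : ε ∈ V) :
    ContinuousOn (branchSum (fun n => g n ε) (fun n => w n ε) u) (Ioc 0 1) := by
  obtain ⟨B, hB⟩ := isCompact_Icc.exists_bound_of_continuousOn hu
  exact continuousOn_tsum_of_weight h.gamma_pos (h.summable.mul_left B)
    (fun n => (hu.comp (h.isC1 n ε hε).continuousOn (h.mapsTo n ε hε)).mul
      (h.isC1 n ε hε).cont_deriv) fun n x hx => h.abs_weight_term_le hB n hε hx

theorem summable_response (h : BranchFamily V γ A D M g w d α β δ)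
    (hφ : IsC1 (1 / 2) 1 φ φ') {x : ℝ} (hx : x ∈ Ioc (0 : ℝ) 1) :
    Summable fun n => φ' (g n 0 x) * α n 0 x * w n 0 x + φ (g n 0 x) * β n 0 x := by
  obtain ⟨B, hB0, hB⟩ := hφ.exists_bound
  exact summable_of_weight (h.summable.mul_left (B * A + B)) hx.1 fun n =>
    h.abs_weight_deriv_term_le hB n h.zero_mem (Ioc_subset_Icc_self hx)

theorem continuousOn_response (h : BranchFamily V γ A D M g w d α β δ)
    (hφ : IsC1 (1 / 2) 1 φ φ') :
    ContinuousOn (fun x => ∑' n, (φ' (g n 0 x) * α n 0 x * w n 0 x + φ (g n 0 x) * β n 0 x))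
      (Ioc 0 1) := by
  obtain ⟨B, hB0, hB⟩ := hφ.exists_bound
  exact continuousOn_tsum_of_weight h.gamma_pos (h.summable.mul_left (B * A + B))
    (fun n => (h.cont_deriv_term hφ n).comp (f := fun x : ℝ => ((0 : ℝ), x)) (by fun_prop)
      fun x hx => ⟨h.zero_mem, hx⟩)
    fun n x hx => h.abs_weight_deriv_term_le hB n h.zero_mem hx

theorem abs_weight_response_le (h : BranchFamily V γ A D M g w d α β δ) {B : ℝ}
    (hB : ∀ y ∈ Icc (1 / 2 : ℝ) 1, |φ y| ≤ B ∧ |φ' y| ≤ B) {x : ℝ} (hx : x ∈ Icc (0 : ℝ) 1) :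
    |x ^ γ * ∑' n, (φ' (g n 0 x) * α n 0 x * w n 0 x + φ (g n 0 x) * β n 0 x)| ≤
      (B * A + B) * ∑' n, M n := by
  rw [← tsum_mul_left, ← tsum_mul_left, ← Real.norm_eq_abs]
  exact tsum_of_norm_bounded (h.summable.mul_left (B * A + B)).hasSum fun n =>
    h.abs_weight_deriv_term_le hB n h.zero_mem hx

/-- The derivative of `L_ε φ` has zero average, since every `L_ε` preserves the integral. -/
theorem integral_response (h : BranchFamily V γ A D M g w d α β δ) (hφ : IsC1 (1 / 2) 1 φ φ')
    (hφ' : IsC1 (1 / 2) 1 φ' φ'') :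
    ∫ x in Icc (1 / 2 : ℝ) 1,
      ∑' n, (φ' (g n 0 x) * α n 0 x * w n 0 x + φ (g n 0 x) * β n 0 x) = 0 := by
  have hq := h.isC1_response hφ hφ'
  set q : ℝ → ℝ := fun x => ∑' n, (φ' (g n 0 x) * α n 0 x * w n 0 x + φ (g n 0 x) * β n 0 x)
    with hqdef
  have hVmem : ∀ᶠ ε in 𝓝[≠] (0 : ℝ), ε ∈ V := nhdsWithin_le_nhds (h.isOpen.mem_nhds h.zero_mem)
  refine abs_nonpos_iff.1 (le_of_forall_pos_le_add fun η hη => ?_)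
  obtain ⟨ε, hε, hεV⟩ := ((h.slope_branchSum hφ hφ' η hη).and hVmem).exists
  obtain ⟨lam, hg⟩ := h.expanding ε hεV
  obtain ⟨lam₀, hg₀⟩ := h.expanding 0 h.zero_mem
  have hk : IntegrableOn (fun x => (branchSum (fun n => g n ε) (fun n => w n ε) φ x -
      branchSum (fun n => g n 0) (fun n => w n 0) φ x) / ε) (Icc (1 / 2) 1) :=
    (((hg.isC1_branchSum hφ).sub (hg₀.isC1_branchSum hφ)).div_const ε).integrableOn
  have hk0 : ∫ x in Icc (1 / 2 : ℝ) 1, (branchSum (fun n => g n ε) (fun n => w n ε) φ x -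
      branchSum (fun n => g n 0) (fun n => w n 0) φ x) / ε = 0 := by
    rw [integral_div, integral_sub (hg.isC1_branchSum hφ).integrableOn
      (hg₀.isC1_branchSum hφ).integrableOn, hg.integral_branchSum hφ.continuousOn,
      hg₀.integral_branchSum hφ.continuousOn, sub_self, zero_div]
  have h1 := norm_setIntegral_le_of_norm_le_const (μ := volume) (s := Icc (1 / 2 : ℝ) 1)
    (f := fun x => (branchSum (fun n => g n ε) (fun n => w n ε) φ x -
      branchSum (fun n => g n 0) (fun n => w n 0) φ x) / ε - q x) (C := η) (by simp)
    fun x hx => (hε x hx).1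
  rw [integral_sub hk hq.integrableOn, hk0, zero_sub, norm_neg,
    Real.volume_real_Icc_of_le (by norm_num), Real.norm_eq_abs] at h1
  linarith

/-- Linear response of the induced map, in the uniform norm on `[1/2, 1]`. The difference of
`(k_ε - k_0) / ε` and `u`, which solves `u - L_0 u = q` for the derivative `q` of `L_ε k_0`, solves
an equation `v - L_ε v = r_ε` whose right-hand side tends to zero in `C¹`, and the resolvent is
bounded uniformly in `ε`. -/
theorem induced_response (h : BranchFamily V γ A D M g w d α β δ) {k : ℝ → ℝ → ℝ}
    (hkc : ∀ ε ∈ V, ContinuousOn (k ε) (Icc (1 / 2) 1))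
    (hkfix : ∀ ε ∈ V, ∀ x ∈ Icc (1 / 2 : ℝ) 1,
      k ε x = branchSum (fun n => g n ε) (fun n => w n ε) (k ε) x)
    (hk1 : ∀ ε ∈ V, ∫ x in Icc (1 / 2 : ℝ) 1, k ε x = 1)
    (hφ : IsC1 (1 / 2) 1 (k 0) φ') (hφ' : IsC1 (1 / 2) 1 φ' φ'')
    (hu : IsC1 (1 / 2) 1 u u') (hu0 : ∫ x in Icc (1 / 2 : ℝ) 1, u x = 0)
    (huq : ∀ x ∈ Icc (1 / 2 : ℝ) 1, u x - branchSum (fun n => g n 0) (fun n => w n 0) u x =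
      ∑' n, (φ' (g n 0 x) * α n 0 x * w n 0 x + k 0 (g n 0 x) * β n 0 x)) :
    ∀ η > 0, ∀ᶠ ε in 𝓝[≠] 0, ∀ x ∈ Icc (1 / 2 : ℝ) 1,
      |(k ε x - k 0 x) / ε - u x| ≤ η := by
  obtain ⟨lam, hlam0, hlam1, hunif⟩ := h.exists_uniform
  obtain ⟨C, hC, hres⟩ := exists_resolvent_bound (a := (1 / 2 : ℝ)) (b := 1) (by norm_num)
    hlam0 hlam1 h.D_nonneg
  obtain ⟨lam₀, hg₀⟩ := h.expanding 0 h.zero_mem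
  have hq := h.isC1_response hφ hφ'
  intro η hη
  set κ := η / (2 * (C + 1)) with hκ
  have hκ0 : 0 < κ := by positivity
  filter_upwards [h.slope_branchSum hφ hφ' κ hκ0,
    nhdsWithin_le_nhds (h.tendsto_branchSum hu κ hκ0), nhdsWithin_le_nhds hunif,
    nhdsWithin_le_nhds (h.isOpen.mem_nhds h.zero_mem), self_mem_nhdsWithin]
    with ε hs ht hg hεV hε0
  have hLφ := hg.isC1_branchSum hφ
  have hL₀φ := hg₀.isC1_branchSum hφ
  have hLu := hg.isC1_branchSum hu
  have hL₀u := hg₀.isC1_branchSum hu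
  have hdiff := hLφ.sub hL₀φ
  have hdiff0 : ∫ x in Icc (1 / 2 : ℝ) 1, (branchSum (fun n => g n ε) (fun n => w n ε) (k 0) x -
      branchSum (fun n => g n 0) (fun n => w n 0) (k 0) x) = 0 := by
    rw [integral_sub hLφ.integrableOn hL₀φ.integrableOn, hg.integral_branchSum hφ.continuousOn,
      hg₀.integral_branchSum hφ.continuousOn, sub_self]
  -- `k_ε - k_0` is the solution `p` of `p - L_ε p = L_ε k_0 - L_0 k_0`
  obtain ⟨p, p', hp, hp0, hpeq⟩ := hg.exists_resolvent hdiff hdiff0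
  have hkp : ∀ x ∈ Icc (1 / 2 : ℝ) 1, k 0 x + p x = k ε x := by
    have hsum := hφ.add hp
    have hind : EqOn ((Icc (1 / 2 : ℝ) 1).indicator fun x => k 0 x + p x)
        (fun x => k 0 x + p x) (Icc (1 / 2) 1) := fun x hx => indicator_of_mem hx _
    have hae := hg.ae_eq_of_fixed (ContinuousOn.measurable_indicator_Icc hsum.continuousOn)
      (hsum.integrableOn.congr_fun hind.symm measurableSet_Icc)
      ((ae_restrict_mem measurableSet_Icc).mono fun x hx => ?_) (hkc ε hεV) (hkfix ε hεV) ?_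
    · refine Measure.eqOn_Icc_of_ae_eq volume (by norm_num) ?_ hsum.continuousOn (hkc ε hεV)
      filter_upwards [hae, ae_restrict_mem measurableSet_Icc] with x hx hxI
      rw [← hx, hind hxI]
    · rw [hg.branchSum_congr hind hx, hind hx,
        hg.branchSum_add hφ.continuousOn hp.continuousOn hx]
      have h1 := hpeq x hx
      have h2 := hkfix 0 h.zero_mem x hx
      linarith
    · rw [setIntegral_congr_fun measurableSet_Icc hind, hk1 ε hεV,
        integral_add hφ.integrableOn hp.integrableOn, hk1 0 h.zero_mem, hp0, add_zero]
  have hv := (hp.div_const ε).sub hu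
  have hv0 : ∫ x in Icc (1 / 2 : ℝ) 1, (p x / ε - u x) = 0 := by
    rw [integral_sub (hp.div_const ε).integrableOn hu.integrableOn, integral_div, hp0, hu0,
      zero_div, sub_zero]
  have hF := ((hdiff.div_const ε).sub hq).add (hLu.sub hL₀u)
  have hbound := hres _ _ _ hg _ _ _ _ (2 * κ) hv hv0 hF (fun x hx => ?_) fun x hx => ?_
  · intro x hx
    have h1 := hbound x hx
    have h2 : (k ε x - k 0 x) / ε - u x = p x / ε - u x := by
      rw [← hkp x hx, add_sub_cancel_left]
    rw [h2]
    refine h1.trans ?_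
    have h3 : C * (2 * κ) = η * (C / (C + 1)) := by
      rw [hκ]
      field_simp
    rw [h3]
    exact mul_le_of_le_one_right hη.le ((div_le_one (by linarith)).2 (by linarith))
  · constructor
    · refine (abs_add_le _ _).trans ?_
      linarith [(hs x hx).1, (ht x hx).1]
    · refine (abs_add_le _ _).trans ?_
      linarith [(hs x hx).2, (ht x hx).2]
  · rw [hg.branchSum_sub (hp.div_const ε).continuousOn hu.continuousOn hx]
    have h1 : branchSum (fun n => g n ε) (fun n => w n ε) (fun y => p y / ε) x =
        branchSum (fun n => g n ε) (fun n => w n ε) p x / ε := by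
      simp only [branchSum, div_mul_eq_mul_div, tsum_div_const]
    have h2 := huq x hx
    have h3 := hpeq x hx
    rw [h1, ← h2, ← h3]
    ring

/-- Linear response of the full map in the weighted norm. -/
theorem weighted_response (h : BranchFamily V γ A D M g w d α β δ) {k : ℝ → ℝ → ℝ}
    (hkc : ∀ ε ∈ V, ContinuousOn (k ε) (Icc (1 / 2) 1)) (hφ : IsC1 (1 / 2) 1 (k 0) φ')
    (hu : ContinuousOn u (Icc (1 / 2) 1))
    (hlim : ∀ η > 0, ∀ᶠ ε in 𝓝[≠] 0, ∀ x ∈ Icc (1 / 2 : ℝ) 1,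
      |(k ε x - k 0 x) / ε - u x| ≤ η) :
    ∀ η > 0, ∀ᶠ ε in 𝓝[≠] 0, ∀ x ∈ Ioc (0 : ℝ) 1,
      |x ^ γ * ((branchSum (fun n => g n ε) (fun n => w n ε) (k ε) x -
          branchSum (fun n => g n 0) (fun n => w n 0) (k 0) x) / ε -
        (branchSum (fun n => g n 0) (fun n => w n 0) u x +
          ∑' n, (φ' (g n 0 x) * α n 0 x * w n 0 x + k 0 (g n 0 x) * β n 0 x)))| ≤ η := by
  intro η hη
  have hM0 : 0 ≤ ∑' n, M n := tsum_nonneg h.M_nonneg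
  set κ := η / (2 + ∑' n, M n) with hκ
  have hκ0 : 0 < κ := by positivity
  filter_upwards [hlim κ hκ0, h.weight_slope_branchSum hφ κ hκ0,
    nhdsWithin_le_nhds (h.weight_tendsto_branchSum hu κ hκ0),
    nhdsWithin_le_nhds (h.isOpen.mem_nhds h.zero_mem), self_mem_nhdsWithin]
    with ε h1 h2 h3 hεV hε0 x hx
  have hxI := Ioc_subset_Icc_self hx
  have hsk := h.summable_term (hkc ε hεV) hεV hx
  have hs0 := h.summable_term hφ.continuousOn hεV hx
  have hsu := h.summable_term hu hεV hx
  have hlin : branchSum (fun n => g n ε) (fun n => w n ε)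
      (fun y => (k ε y - k 0 y) / ε - u y) x =
      (branchSum (fun n => g n ε) (fun n => w n ε) (k ε) x -
        branchSum (fun n => g n ε) (fun n => w n ε) (k 0) x) / ε -
        branchSum (fun n => g n ε) (fun n => w n ε) u x := by
    simp only [branchSum]
    rw [← hsk.tsum_sub hs0, ← tsum_div_const, ← ((hsk.sub hs0).div_const ε).tsum_sub hsu]
    exact tsum_congr fun n => by ring
  have h4 := h.abs_weight_branchSum_le h1 hεV hxI
  rw [hlin] at h4
  -- linearize in the density, differentiate the operator at `k_0`, and replace `L_ε u` by `L_0 u`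
  have hsplit : ∀ c a₁ a₂ a₃ b₁ b₂ r e : ℝ, c * ((a₁ - a₃) / e - (b₂ + r)) =
      c * ((a₁ - a₂) / e - b₁) + c * ((a₂ - a₃) / e - r) + c * (b₁ - b₂) := by
    intros
    ring
  rw [hsplit _ _ (branchSum (fun n => g n ε) (fun n => w n ε) (k 0) x) _
    (branchSum (fun n => g n ε) (fun n => w n ε) u x)]
  refine (abs_add_three _ _ _).trans ((add_le_add (add_le_add h4 (h2 x hxI))
    (h3 x hxI)).trans_eq ?_)
  rw [hκ]
  field_simp
  ring

end BranchFamily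

end

section

/-! ### The parameter derivatives of the induced map -/

theorem continuousAt_toSpanSingleton {f : ℝ → ℝ → ℝ} {p : ℝ × ℝ}
    (hf : ContinuousAt (fun p : ℝ × ℝ => f p.1 p.2) p) :
    ContinuousAt (fun p : ℝ × ℝ => ContinuousLinearMap.toSpanSingleton ℝ (f p.1 p.2)) p :=
  (ContinuousLinearMap.toSpanSingletonCLE (𝕜 := ℝ) (E := ℝ)).continuous.continuousAt.comp hf

/-- The chain rule along a curve `e ↦ (e, z e)`, from continuous partial derivatives. -/
theorem hasDerivAt_along {f f₁ f₂ : ℝ → ℝ → ℝ} {x z' : ℝ} {z : ℝ → ℝ}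
    (h₁ : ∀ᶠ p in 𝓝 ((0 : ℝ), x), HasDerivAt (fun e => f e p.2) (f₁ p.1 p.2) p.1)
    (h₂ : ∀ᶠ p in 𝓝 ((0 : ℝ), x), HasDerivAt (f p.1) (f₂ p.1 p.2) p.2)
    (c₁ : ContinuousAt (fun p : ℝ × ℝ => f₁ p.1 p.2) (0, x))
    (c₂ : ContinuousAt (fun p : ℝ × ℝ => f₂ p.1 p.2) (0, x))
    (hz0 : z 0 = x) (hz : HasDerivAt z z' 0) :
    HasDerivAt (fun e => f e (z e)) (f₁ 0 x + f₂ 0 x * z') 0 := by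
  have hF := hasStrictFDerivAt_uncurry_coprod (f := f) (u := ((0 : ℝ), x))
    (f₁ := fun e y => ContinuousLinearMap.toSpanSingleton ℝ (f₁ e y))
    (f₂ := fun e y => ContinuousLinearMap.toSpanSingleton ℝ (f₂ e y))
    (h₁.mono fun p hp => hp.hasFDerivAt) (h₂.mono fun p hp => hp.hasFDerivAt)
    (continuousAt_toSpanSingleton c₁) (continuousAt_toSpanSingleton c₂)
  subst hz0
  have h1 := hF.hasFDerivAt.comp_hasDerivAt (f := fun e => (e, z e)) 0
    ((hasDerivAt_id (0 : ℝ)).prodMk hz)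
  refine h1.congr_deriv ?_
  simp [Function.HasUncurry.uncurry, mul_comm]

/-- The implicit function theorem for a real equation with a real parameter. -/
theorem exists_implicit {f f₁ f₂ : ℝ → ℝ → ℝ} {x : ℝ}
    (h₁ : ∀ᶠ p in 𝓝 ((0 : ℝ), x), HasDerivAt (fun e => f e p.2) (f₁ p.1 p.2) p.1)
    (h₂ : ∀ᶠ p in 𝓝 ((0 : ℝ), x), HasDerivAt (f p.1) (f₂ p.1 p.2) p.2)
    (c₁ : ContinuousAt (fun p : ℝ × ℝ => f₁ p.1 p.2) (0, x))
    (c₂ : ContinuousAt (fun p : ℝ × ℝ => f₂ p.1 p.2) (0, x)) (hne : f₂ 0 x ≠ 0) :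
    ∃ z : ℝ → ℝ, z 0 = x ∧ HasDerivAt z (-(f₁ 0 x) / f₂ 0 x) 0 ∧
      ∀ᶠ e in 𝓝 0, f e (z e) = f 0 x := by
  have d₁ : ∀ᶠ p in 𝓝 ((0 : ℝ), x), HasFDerivAt (fun e => f e p.2)
      (ContinuousLinearMap.toSpanSingleton ℝ (f₁ p.1 p.2)) p.1 :=
    h₁.mono fun p hp => hp.hasFDerivAt
  have d₂ : ∀ᶠ p in 𝓝 ((0 : ℝ), x), HasFDerivAt (f p.1 ·)
      (ContinuousLinearMap.toSpanSingleton ℝ (f₂ p.1 p.2)) p.2 :=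
    h₂.mono fun p hp => hp.hasFDerivAt
  have hinv : (ContinuousLinearMap.toSpanSingleton ℝ (f₂ 0 x)).IsInvertible := by
    refine ⟨ContinuousLinearEquiv.unitsEquivAut ℝ (Units.mk0 _ hne), ?_⟩
    ext
    simp
  set z := implicitFunctionOfBivariate (u := ((0 : ℝ), x))
    (f₁ := fun e y => ContinuousLinearMap.toSpanSingleton ℝ (f₁ e y))
    (f₂ := fun e y => ContinuousLinearMap.toSpanSingleton ℝ (f₂ e y)) d₁ d₂
    (continuousAt_toSpanSingleton c₁) (continuousAt_toSpanSingleton c₂) hinv with hz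
  have hz0 : z 0 = x := (eventually_apply_eq_iff_implicitFunctionOfBivariate (u := ((0 : ℝ), x))
    d₁ d₂ (continuousAt_toSpanSingleton c₁) (continuousAt_toSpanSingleton c₂)
    hinv).self_of_nhds.1 rfl
  have heq : ∀ᶠ e in 𝓝 0, f e (z e) = f 0 x :=
    eventually_apply_implicitFunctionOfBivariate (u := ((0 : ℝ), x)) d₁ d₂
      (continuousAt_toSpanSingleton c₁) (continuousAt_toSpanSingleton c₂) hinv
  have hzd : HasDerivAt z (deriv z 0) 0 :=
    (hasStrictFDerivAt_implicitFunctionOfBivariate (u := ((0 : ℝ), x)) d₁ d₂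
      (continuousAt_toSpanSingleton c₁) (continuousAt_toSpanSingleton c₂)
      hinv).hasFDerivAt.differentiableAt.hasDerivAt
  -- differentiating the equation determines the derivative of the solution
  have h0 : f₁ 0 x + f₂ 0 x * deriv z 0 = 0 :=
    (hasDerivAt_along h₁ h₂ c₁ c₂ hz0 hzd).unique
      ((hasDerivAt_const (0 : ℝ) (f 0 x)).congr_of_eventuallyEq heq)
  refine ⟨z, hz0, hzd.congr_deriv ?_, heq⟩
  rw [eq_div_iff hne]
  linarith

/-- The chain rule for `S ∘ g = id`. The map `S` is differentiable at `g x`, since its `deriv` there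
is not the junk value `0`. -/
theorem hasDerivAt_inv_of_leftInverse {S g : ℝ → ℝ} {a b x w : ℝ} (hx : x ∈ Ioo a b)
    (hS : ∀ y ∈ Ioo a b, S (g y) = y) (hg : HasDerivAt g w x) (hne : deriv S (g x) ≠ 0) :
    w ≠ 0 ∧ HasDerivAt S w⁻¹ (g x) := by
  have hSd := (differentiableAt_of_deriv_ne_zero hne).hasDerivAt
  have h1 : deriv S (g x) * w = 1 := by
    refine (hSd.comp x hg).unique ((hasDerivAt_id x).congr_of_eventuallyEq ?_)
    filter_upwards [isOpen_Ioo.mem_nhds hx] with y hy using hS y hy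
  have hw : w ≠ 0 := right_ne_zero_of_mul_eq_one h1
  exact ⟨hw, (eq_inv_of_mul_eq_one_left h1) ▸ hSd⟩

/-- On the image of a branch, the derivatives in `A₀` and `B₀` exist, and `A₀ ∘ g = α`,
`B₀ ∘ g · g' = β`. -/
theorem BranchFamily.coef_eq {V : Set ℝ} {γ A D : ℝ} {M : ℕ → ℝ} {g w d α β δ : ℕ → ℝ → ℝ → ℝ}
    (h : BranchFamily V γ A D M g w d α β δ) {S : ℝ → ℝ → ℝ}
    (hS : ∀ ε ∈ V, ∀ n, ∀ x ∈ Ioo (1 / 2 : ℝ) 1, S ε (g n ε x) = x)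
    (hexp : ∀ ε ∈ V, ∀ n, ∀ x ∈ Ioo (1 / 2 : ℝ) 1, deriv (S ε) (g n ε x) ≠ 0) (n : ℕ) {x : ℝ}
    (hx : x ∈ Ioo (1 / 2 : ℝ) 1) :
    DifferentiableAt ℝ (fun e => S e (g n 0 x)) 0 ∧
      DifferentiableAt ℝ (fun e => deriv (S e) (g n 0 x)) 0 ∧
      coefA S (g n 0 x) = α n 0 x ∧ coefB S (g n 0 x) * w n 0 x = β n 0 x := by
  have hVx : V ×ˢ Ioo (1 / 2 : ℝ) 1 ∈ 𝓝 ((0 : ℝ), x) :=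
    prod_mem_nhds (h.isOpen.mem_nhds h.zero_mem) (isOpen_Ioo.mem_nhds hx)
  have hsub : Ioo (1 / 2 : ℝ) 1 ⊆ Icc 0 1 := Ioo_subset_Icc_self.trans half_Icc_subset
  have hVI : V ×ˢ Icc (0 : ℝ) 1 ∈ 𝓝 ((0 : ℝ), x) := mem_of_superset hVx (prod_mono_right hsub)
  have hVD : V ×ˢ Icc (1 / 2 : ℝ) 1 ∈ 𝓝 ((0 : ℝ), x) :=
    mem_of_superset hVx (prod_mono_right Ioo_subset_Icc_self)
  have hgx : ∀ ε ∈ V, ∀ y ∈ Ioo (1 / 2 : ℝ) 1, HasDerivAt (g n ε) (w n ε y) y := fun ε hε y hy =>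
    ((h.isC1 n ε hε).hasDeriv y (hsub hy)).hasDerivAt
      (Icc_mem_nhds (by linarith [hy.1]) hy.2)
  have hwx : ∀ ε ∈ V, ∀ y ∈ Ioo (1 / 2 : ℝ) 1, HasDerivAt (w n ε) (d n ε y) y := by
    intro ε hε y hy
    obtain ⟨lam, hg⟩ := h.expanding ε hε
    exact ((hg.isC1' n).hasDeriv y (Ioo_subset_Icc_self hy)).hasDerivAt (Icc_mem_nhds hy.1 hy.2)
  have hg₁ : ∀ᶠ p in 𝓝 ((0 : ℝ), x), HasDerivAt (fun e => g n e p.2) (α n p.1 p.2) p.1 :=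
    mem_of_superset hVx fun p hp => h.deriv_g n p.1 hp.1 p.2 (hsub hp.2)
  have hg₂ : ∀ᶠ p in 𝓝 ((0 : ℝ), x), HasDerivAt (g n p.1) (w n p.1 p.2) p.2 :=
    mem_of_superset hVx fun p hp => hgx p.1 hp.1 p.2 hp.2
  have hw₁ : ∀ᶠ p in 𝓝 ((0 : ℝ), x), HasDerivAt (fun e => w n e p.2) (β n p.1 p.2) p.1 :=
    mem_of_superset hVx fun p hp => h.deriv_w n p.1 hp.1 p.2 (hsub hp.2)
  have hw₂ : ∀ᶠ p in 𝓝 ((0 : ℝ), x), HasDerivAt (w n p.1) (d n p.1 p.2) p.2 :=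
    mem_of_superset hVx fun p hp => hwx p.1 hp.1 p.2 hp.2
  have hinv : ∀ ε ∈ V, ∀ y ∈ Ioo (1 / 2 : ℝ) 1,
      w n ε y ≠ 0 ∧ HasDerivAt (S ε) (w n ε y)⁻¹ (g n ε y) := fun ε hε y hy =>
    hasDerivAt_inv_of_leftInverse hy (hS ε hε n) (hgx ε hε y hy) (hexp ε hε n y hy)
  have hw0 : w n 0 x ≠ 0 := (hinv 0 h.zero_mem x hx).1
  obtain ⟨z, hz0, hz, hzeq⟩ := exists_implicit hg₁ hg₂ ((h.cont_alpha n).continuousAt hVI)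
    ((h.cont_w n).continuousAt hVI) hw0
  -- the solution `z` of `g_ε(z) = y` is the value of the map at `y`
  have hnear : ∀ᶠ e in 𝓝 (0 : ℝ), e ∈ V ∧ z e ∈ Ioo (1 / 2 : ℝ) 1 ∧ g n e (z e) = g n 0 x := by
    have hzI : ∀ᶠ e in 𝓝 (0 : ℝ), z e ∈ Ioo (1 / 2 : ℝ) 1 :=
      hz.continuousAt.eventually (isOpen_Ioo.mem_nhds (hz0.symm ▸ hx))
    exact Filter.Eventually.and (h.isOpen.mem_nhds h.zero_mem) (hzI.and hzeq)
  have hSz : (fun e => S e (g n 0 x)) =ᶠ[𝓝 0] z := by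
    filter_upwards [hnear] with e he
    rw [← he.2.2, hS e he.1 n _ he.2.1]
  have hS1 : HasDerivAt (fun e => S e (g n 0 x)) (-(α n 0 x) / w n 0 x) 0 :=
    hz.congr_of_eventuallyEq hSz
  have hS' : (fun e => deriv (S e) (g n 0 x)) =ᶠ[𝓝 0] fun e => (w n e (z e))⁻¹ := by
    filter_upwards [hnear] with e he
    rw [← he.2.2, (hinv e he.1 _ he.2.1).2.deriv]
  have hwz := hasDerivAt_along hw₁ hw₂ ((h.cont_beta n).continuousAt hVI)
    ((h.cont_d n).continuousAt hVD) hz0 hz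
  have hS2 := ((hwz.fun_inv (by simpa [hz0] using hw0)).congr_of_eventuallyEq hS')
  have hS3 : HasDerivAt (deriv (S 0)) (-(d n 0 x * (w n 0 x)⁻¹) / w n 0 x ^ 2) (g n 0 x) := by
    have hSx : S 0 (g n 0 x) = x := hS 0 h.zero_mem n x hx
    have h1 : HasDerivAt (fun y => w n 0 (S 0 y)) (d n 0 x * (w n 0 x)⁻¹) (g n 0 x) := by
      refine HasDerivAt.comp (g n 0 x) ?_ (hinv 0 h.zero_mem x hx).2
      rw [hSx]
      exact hwx 0 h.zero_mem x hx
    have h2 : deriv (S 0) =ᶠ[𝓝 (g n 0 x)] fun y => (w n 0 (S 0 y))⁻¹ := by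
      obtain ⟨lam, hg⟩ := h.expanding 0 h.zero_mem
      have hmono := hg.strictMono n
      have hmem : Ioo (g n 0 (1 / 2)) (g n 0 1) ∈ 𝓝 (g n 0 x) :=
        isOpen_Ioo.mem_nhds ⟨hmono (by norm_num) (Ioo_subset_Icc_self hx) hx.1,
          hmono (Ioo_subset_Icc_self hx) (by norm_num) hx.2⟩
      filter_upwards [hmem] with y hy
      obtain ⟨t, ht, rfl⟩ := intermediate_value_Ioo (by norm_num)
        (hg.isC1 n).continuousOn hy
      rw [hS 0 h.zero_mem n t ht, (hinv 0 h.zero_mem t ht).2.deriv]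
    have h3 := (h1.fun_inv (by rwa [hSx])).congr_of_eventuallyEq h2
    rwa [hSx] at h3
  have hS0 := (hinv 0 h.zero_mem x hx).2.deriv
  refine ⟨hS1.differentiableAt, hS2.differentiableAt, ?_, ?_⟩
  · rw [coefA, hS1.deriv, hS0]
    field_simp
  · rw [coefB, hS1.deriv, hS0, hS2.deriv, hS3.deriv, hz0]
    field_simp
    ring

end

section

/-! ### Bounds from extended suprema -/

theorem abs_le_toReal_of_le {f : ℝ → ℝ} {S : Set ℝ} {x : ℝ} {c : ℝ≥0∞} (hx : x ∈ S)
    (hf : supNorm S f ≤ c) (hc : c ≠ ⊤) : |f x| ≤ c.toReal := by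
  have h1 : ‖f x‖ₑ ≤ c := (le_iSup₂ (f := fun y (_ : y ∈ S) => ‖f y‖ₑ) x hx).trans hf
  rw [Real.enorm_eq_ofReal_abs] at h1
  exact (ENNReal.ofReal_le_iff_le_toReal hc).1 h1

theorem supNorm_le_ofReal {f : ℝ → ℝ} {S : Set ℝ} {c : ℝ} (hf : ∀ x ∈ S, |f x| ≤ c) :
    supNorm S f ≤ ENNReal.ofReal c :=
  iSup₂_le fun x hx => by
    rw [Real.enorm_eq_ofReal_abs]
    exact ENNReal.ofReal_le_ofReal (hf x hx)

theorem exists_bound_of_iSup_lt_top {V S : Set ℝ} {f : ℕ → ℝ → ℝ → ℝ}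
    (h : ⨆ n, ⨆ ε ∈ V, supNorm S (f n ε) < ⊤) :
    ∃ A, 0 ≤ A ∧ ∀ n, ∀ ε ∈ V, ∀ x ∈ S, |f n ε x| ≤ A :=
  ⟨_, ENNReal.toReal_nonneg, fun n ε hε _ hx => abs_le_toReal_of_le hx
    ((le_iSup₂ (f := fun e (_ : e ∈ V) => supNorm S (f n e)) ε hε).trans
      (le_iSup (fun n => ⨆ ε ∈ V, supNorm S (f n ε)) n)) h.ne⟩

theorem exists_summable_bound {V S : Set ℝ} {f : ℕ → ℝ → ℝ → ℝ}
    (h : ∑' n, ⨆ ε ∈ V, supNorm S (f n ε) < ⊤) :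
    ∃ M : ℕ → ℝ, Summable M ∧ (∀ n, 0 ≤ M n) ∧ ∀ n, ∀ ε ∈ V, ∀ x ∈ S, |f n ε x| ≤ M n :=
  ⟨_, ENNReal.summable_toReal h.ne, fun _ => ENNReal.toReal_nonneg, fun n ε hε _ hx =>
    abs_le_toReal_of_le hx (le_iSup₂ (f := fun e (_ : e ∈ V) => supNorm S (f n e)) ε hε)
      (ENNReal.ne_top_of_tsum_ne_top h.ne n)⟩

theorem tendsto_normB_zero {γ : ℝ} {l : Filter ℝ} {f : ℝ → ℝ → ℝ}
    (h : ∀ η > 0, ∀ᶠ ε in l, ∀ x ∈ Ioc (0 : ℝ) 1, |x ^ γ * f ε x| ≤ η) :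
    Tendsto (fun ε => normB γ (f ε)) l (𝓝 0) := by
  rw [ENNReal.tendsto_nhds_zero]
  intro c hc
  rcases eq_or_ne c ⊤ with rfl | hct
  · simp
  · filter_upwards [h c.toReal (ENNReal.toReal_pos hc.ne' hct)] with ε hε
    exact (supNorm_le_ofReal hε).trans_eq (ENNReal.ofReal_toReal hct)

/-! ### The word branches as a family of expanding branches -/

theorem isC1_of_contDiffOn_two {a b : ℝ} (hab : a < b) {f : ℝ → ℝ}
    (h : ContDiffOn ℝ 2 f (Icc a b)) :
    IsC1 a b f (derivWithin f (Icc a b)) ∧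
      IsC1 a b (derivWithin f (Icc a b)) (iteratedDerivWithin 2 f (Icc a b)) := by
  have hu := uniqueDiffOn_Icc hab
  have h2 : iteratedDerivWithin 2 f (Icc a b) =
      derivWithin (derivWithin f (Icc a b)) (Icc a b) := by
    funext x
    rw [iteratedDerivWithin_succ, iteratedDerivWithin_one]
  refine ⟨isC1_of_contDiffOn hab (h.of_le (by norm_num)), ?_⟩
  rw [h2]
  rw [show (2 : WithTop ℕ∞) = 1 + 1 by norm_num, contDiffOn_succ_iff_derivWithin hu] at h
  exact isC1_of_contDiffOn hab h.2.2

theorem IsC1.congr_deriv {a b : ℝ} {u u' v' : ℝ → ℝ} (h : IsC1 a b u u')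
    (he : EqOn v' u' (Icc a b)) : IsC1 a b u v' :=
  ⟨fun x hx => (he hx).symm ▸ h.hasDeriv x hx, h.cont_deriv.congr he⟩

theorem derivWithin_half_eq {f : ℝ → ℝ} (h : ContDiffOn ℝ 1 f (Icc 0 1)) {x : ℝ}
    (hx : x ∈ Icc (1 / 2 : ℝ) 1) :
    derivWithin f (Icc (1 / 2) 1) x = derivWithin f (Icc 0 1) x :=
  ((isC1_of_contDiffOn zero_lt_one h).mono half_Icc_subset).derivWithin_eq (by norm_num) hx

variable {V : Set ℝ} {γ : ℝ} {T T₀ T₁ g₀ g₁ That : ℝ → ℝ → ℝ}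

theorem InducingScheme.twoBranches (hA : InducingScheme V γ T T₀ T₁ g₀ g₁) {ε : ℝ} (hε : ε ∈ V) :
    TwoBranches (T ε) (g₀ ε) (g₁ ε) := by
  obtain ⟨hm₀, hi₀, hr₀⟩ := strictMonoOn_image_eq_of_leftInverse (hA.strictMono₀ ε hε)
    (hA.bijOn₀ ε hε) (hA.inv₀ ε hε)
  obtain ⟨hm₁, hi₁, hr₁⟩ := strictMonoOn_image_eq_of_leftInverse (hA.strictMono₁ ε hε)
    (hA.bijOn₁ ε hε) (hA.inv₁ ε hε)
  refine ⟨hm₀, hi₀, ((hA.comm₀ 1 le_rfl).contDiffOn ε hε).continuousOn, hm₁, hi₁,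
    ((hA.comm₁ 1 le_rfl).contDiffOn ε hε).continuousOn, fun y hy hne => ?_, fun y hy hne => ?_⟩
  · have h1 : g₀ ε y ∈ Icc (0 : ℝ) (1 / 2) := hi₀ ▸ mem_image_of_mem _ hy
    rw [hA.eq_left ε hε _ ⟨h1.1, lt_of_le_of_ne h1.2 hne⟩, hr₀ y hy]
  · have h1 : g₁ ε y ∈ Icc (1 / 2 : ℝ) 1 := hi₁ ▸ mem_image_of_mem _ hy
    rw [hA.eq_right ε hε _ ⟨lt_of_le_of_ne h1.1 (Ne.symm hne), h1.2⟩, hr₁ y hy]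

theorem ExpandingFamily.deriv_ne_zero {a b : ℝ} {g : ℕ → ℝ → ℝ → ℝ}
    (hB : ExpandingFamily V a b That g) {ε : ℝ} (hε : ε ∈ V) (n : ℕ) {x : ℝ} (hx : x ∈ Ioo a b) :
    deriv (That ε) (g n ε x) ≠ 0 := by
  obtain ⟨r, hr, hrS⟩ := hB.expanding ε hε
  exact abs_pos.1 (zero_lt_one.trans (hr.trans_le (hrS n _ ⟨x, hx, rfl⟩)))

/-- The word branches form a `BranchFamily`. The five summable majorants of the hypotheses are added
up to a single sequence. -/
theorem exists_branchFamily (hA : InducingScheme V γ T T₀ T₁ g₀ g₁)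
    (hB : ExpandingFamily V (1 / 2) 1 That (wordBranch g₀ g₁)) :
    ∃ A D M, BranchFamily V γ A D M (wordBranch g₀ g₁)
      (fun n ε x => derivWithin (wordBranch g₀ g₁ n ε) (Icc 0 1) x)
      (fun n ε x => iteratedDerivWithin 2 (wordBranch g₀ g₁ n ε) (Icc (1 / 2) 1) x)
      (fun n ε x => deriv (fun e => wordBranch g₀ g₁ n e x) ε)
      (fun n ε x => deriv (fun e => derivWithin (wordBranch g₀ g₁ n e) (Icc 0 1) x) ε)
      (fun n ε x =>
        deriv (fun e => iteratedDerivWithin 2 (wordBranch g₀ g₁ n e) (Icc (1 / 2) 1) x) ε) := by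
  have hhalf : (1 / 2 : ℝ) < 1 := by norm_num
  obtain ⟨A, -, hAb⟩ := exists_bound_of_iSup_lt_top hA.bound_eps
  obtain ⟨D, hD0, hDb⟩ := exists_bound_of_iSup_lt_top hB.distortion
  obtain ⟨M₁, hM₁, hM₁0, hM₁b⟩ := exists_summable_bound (S := Ioc 0 1) hA.sum_deriv
  obtain ⟨M₂, hM₂, hM₂0, hM₂b⟩ := exists_summable_bound (S := Ioc 0 1) hA.sum_eps_deriv
  obtain ⟨M₃, hM₃, hM₃0, hM₃b⟩ := exists_summable_bound hB.sum_deriv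
  obtain ⟨M₄, hM₄, hM₄0, hM₄b⟩ := exists_summable_bound (hB.sum_eps_deriv 1 (by simp))
  obtain ⟨M₅, hM₅, hM₅0, hM₅b⟩ := exists_summable_bound (hB.sum_eps_deriv 2 (by simp))
  set g := wordBranch g₀ g₁ with hg
  set w : ℕ → ℝ → ℝ → ℝ := fun n ε x => derivWithin (g n ε) (Icc 0 1) x with hw
  set d : ℕ → ℝ → ℝ → ℝ := fun n ε x => iteratedDerivWithin 2 (g n ε) (Icc (1 / 2) 1) x with hd
  have hg1 : ∀ n, ∀ ε ∈ V, ContDiffOn ℝ 1 (g n ε) (Icc 0 1) := fun n ε hε => by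
    simpa using (hA.comm_word n 1 le_rfl).contDiffOn ε hε
  have hg2 : ∀ n, ∀ ε ∈ V, ContDiffOn ℝ 2 (g n ε) (Icc (1 / 2) 1) := fun n ε hε => by
    simpa using (hB.comm n 2 le_rfl).contDiffOn ε hε
  have ha1 : ∀ n, ∀ ε ∈ V, ContDiffOn ℝ 1 (fun x => deriv (fun e => g n e x) ε) (Icc 0 1) :=
    fun n ε hε => by simpa using (hA.comm_word n 1 le_rfl).contDiffOn_eps ε hε
  have ha2 : ∀ n, ∀ ε ∈ V, ContDiffOn ℝ 2 (fun x => deriv (fun e => g n e x) ε) (Icc (1 / 2) 1) :=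
    fun n ε hε => by simpa using (hB.comm n 2 le_rfl).contDiffOn_eps ε hε
  have hwD : ∀ n, ∀ ε ∈ V, EqOn (w n ε) (derivWithin (g n ε) (Icc (1 / 2) 1)) (Icc (1 / 2) 1) :=
    fun n ε hε x hx => (derivWithin_half_eq (hg1 n ε hε) hx).symm
  have hC1 : ∀ n, ∀ ε ∈ V, IsC1 0 1 (g n ε) (w n ε) := fun n ε hε =>
    isC1_of_contDiffOn zero_lt_one (hg1 n ε hε)
  have hC1' : ∀ n, ∀ ε ∈ V, IsC1 (1 / 2) 1 (w n ε) (d n ε) := fun n ε hε =>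
    (isC1_of_contDiffOn_two hhalf (hg2 n ε hε)).2.congr (hwD n ε hε)
  have hcomm1 := fun n => (hA.comm_word n 1 le_rfl).comm
  simp only [iteratedDerivWithin_one] at hcomm1
  have hβ : ∀ n, ∀ ε ∈ V, EqOn (fun x => deriv (fun e => w n e x) ε)
      (derivWithin (fun x => deriv (fun e => g n e x) ε) (Icc 0 1)) (Icc 0 1) :=
    fun n ε hε x hx => (hcomm1 n ε hε x hx).deriv
  have hnonneg : ∀ n, ∀ ε ∈ V, ∀ x ∈ Icc (0 : ℝ) 1, 0 ≤ w n ε x := fun n ε hε x _ => by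
    have hT := hA.twoBranches hε
    exact (hT.strictMono₁.comp (hT.strictMonoOn_iterate n)
      (hT.mapsTo_iterate n)).monotoneOn.derivWithin_nonneg
  have hevent : ∀ n, ∀ ε ∈ V, ∀ x ∈ Icc (1 / 2 : ℝ) 1,
      deriv (fun e => iteratedDerivWithin 1 (g n e) (Icc (1 / 2) 1) x) ε =
        deriv (fun e => w n e x) ε := by
    intro n ε hε x hx
    refine Filter.EventuallyEq.deriv_eq ?_
    filter_upwards [hA.isOpen.mem_nhds hε] with e he
    rw [iteratedDerivWithin_one, hwD n e he hx]
  have hsum : Summable fun n => M₁ n + M₂ n + M₃ n + M₄ n + M₅ n :=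
    (((hM₁.add hM₂).add hM₃).add hM₄).add hM₅
  have hw3 : ∀ n, ∀ ε ∈ V, ∀ x ∈ Icc (1 / 2 : ℝ) 1, w n ε x ≤ M₃ n := fun n ε hε x hx => by
    rw [hwD n ε hε hx]
    exact (le_abs_self _).trans (hM₃b n ε hε x hx)
  have hexp : ∀ ε ∈ V, ∃ lam, ExpandingBranches (1 / 2) 1 lam D (fun n => g n ε)
      (fun n => w n ε) (fun n => d n ε) := by
    intro ε hε
    obtain ⟨r, hr, hrS⟩ := hB.expanding ε hε
    have hr0 : 0 < r := zero_lt_one.trans hr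
    have hint : ∀ n, ∀ x ∈ Ioo (1 / 2 : ℝ) 1,
        w n ε x ≠ 0 ∧ deriv (That ε) (g n ε x) = (w n ε x)⁻¹ := fun n x hx => by
      have hgx : HasDerivAt (g n ε) (w n ε x) x :=
        ((hC1 n ε hε).hasDeriv x (half_Icc_subset (Ioo_subset_Icc_self hx))).hasDerivAt
          (Icc_mem_nhds (by linarith [hx.1]) hx.2)
      have := hasDerivAt_inv_of_leftInverse hx (hB.right_inv ε hε n) hgx
        (hB.deriv_ne_zero hε n hx)
      exact ⟨this.1, this.2.deriv⟩
    -- expansion and distortion pass from the open interval to its closure by continuity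
    have hcl : closure (Ioo (1 / 2 : ℝ) 1) = Icc (1 / 2) 1 := closure_Ioo hhalf.ne
    have hwc : ∀ n, ContinuousOn (w n ε) (closure (Ioo (1 / 2 : ℝ) 1)) := fun n =>
      hcl ▸ (hC1' n ε hε).continuousOn
    have hdc : ∀ n, ContinuousOn (d n ε) (closure (Ioo (1 / 2 : ℝ) 1)) := fun n =>
      hcl ▸ (hC1' n ε hε).cont_deriv
    refine ⟨r⁻¹, {
      lt := hhalf
      mapsTo := hB.mapsTo ε hε
      isC1 := fun n => (hC1 n ε hε).mono half_Icc_subset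
      isC1' := fun n => hC1' n ε hε
      nonneg := fun n x hx => hnonneg n ε hε x (half_Icc_subset hx)
      le := fun n x hx => ?_
      lam_lt := inv_lt_one_of_one_lt₀ hr
      dist_nonneg := hD0
      dist := fun n x hx => ?_
      exists_bound := ⟨M₃, hM₃, fun n x hx => hw3 n ε hε x hx⟩
      strictMono := hB.strictMono ε hε
      disjoint := hB.disjoint ε hε
      cover := hB.cover ε hε }⟩
    · refine le_on_closure (s := Ioo (1 / 2 : ℝ) 1) (fun y hy => ?_) (hwc n) continuousOn_const
        (hcl.symm ▸ hx)
      have h1 := hrS n _ ⟨y, hy, rfl⟩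
      have h2 := hnonneg n ε hε y (half_Icc_subset (Ioo_subset_Icc_self hy))
      rw [(hint n y hy).2, abs_of_nonneg (inv_nonneg.2 h2)] at h1
      exact le_inv_of_le_inv₀ hr0 h1
    · refine le_on_closure (s := Ioo (1 / 2 : ℝ) 1) (fun y hy => ?_) (hdc n).abs
        (continuousOn_const.mul (hwc n)) (hcl.symm ▸ hx)
      have h1 := hDb n ε hε y (Ioo_subset_Icc_self hy)
      have h2 := hnonneg n ε hε y (half_Icc_subset (Ioo_subset_Icc_self hy))
      rwa [← hwD n ε hε (Ioo_subset_Icc_self hy), abs_div, abs_of_nonneg h2,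
        div_le_iff₀ (lt_of_le_of_ne h2 (hint n y hy).1.symm)] at h1
  -- at `x = 0` the weight vanishes, so the bounds on `(0, 1]` hold on `[0, 1]`
  have hweight : ∀ {f : ℝ → ℝ} {m : ℝ}, 0 ≤ m → (∀ x ∈ Ioc (0 : ℝ) 1, |x ^ γ * f x| ≤ m) →
      ∀ x ∈ Icc (0 : ℝ) 1, x ^ γ * |f x| ≤ m := by
    intro f m hm hf x hx
    rcases hx.1.eq_or_lt with rfl | hx0
    · rwa [Real.zero_rpow hA.gamma_pos.ne', zero_mul]
    · have h1 := hf x ⟨hx0, hx.2⟩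
      rwa [abs_mul, abs_of_nonneg (Real.rpow_nonneg hx.1 _)] at h1
  refine ⟨A, D, fun n => M₁ n + M₂ n + M₃ n + M₄ n + M₅ n, {
    isOpen := hA.isOpen
    zero_mem := hA.zero_mem
    gamma_pos := hA.gamma_pos
    mapsTo := fun n ε hε => (hA.twoBranches hε).mapsTo₁.comp ((hA.twoBranches hε).mapsTo_iterate n)
    isC1 := hC1
    isC1_alpha := fun n ε hε =>
      (isC1_of_contDiffOn zero_lt_one (ha1 n ε hε)).congr_deriv (hβ n ε hε)
    isC1_beta := fun n ε hε => ?_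
    deriv_g := fun n ε hε x hx => ?_
    deriv_w := fun n ε hε x hx => (hcomm1 n ε hε x hx).differentiableAt.hasDerivAt
    deriv_d := fun n ε hε x hx => ((hB.comm n 2 le_rfl).comm ε hε x hx).differentiableAt.hasDerivAt
    cont_alpha := fun n => by
      simpa only [iteratedDerivWithin_zero] using (hA.comm_word n 0 zero_le_one).continuousOn
    cont_beta := fun n => by
      simpa only [iteratedDerivWithin_one] using (hA.comm_word n 1 le_rfl).continuousOn
    cont_delta := fun n => (hB.comm n 2 le_rfl).continuousOn
    nonneg := hnonneg
    summable := hsum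
    alpha_le := hAb
    weight_w_le := fun n ε hε x hx => ?_
    weight_beta_le := fun n ε hε x hx => ?_
    w_le := fun n ε hε x hx => ?_
    beta_le := fun n ε hε x hx => ?_
    delta_le := fun n ε hε x hx => ?_
    expanding := hexp }⟩
  · refine ((isC1_of_contDiffOn_two hhalf (ha2 n ε hε)).2.congr fun x hx => ?_).congr_deriv
      fun x hx => ((hB.comm n 2 le_rfl).comm ε hε x hx).deriv
    exact (hβ n ε hε (half_Icc_subset hx)).trans (derivWithin_half_eq (ha1 n ε hε) hx).symm
  · have h1 := (hA.comm_word n 0 zero_le_one).comm ε hε x hx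
    simp only [iteratedDerivWithin_zero] at h1
    exact h1.differentiableAt.hasDerivAt
  · have h1 := hweight (hM₁0 n) (fun y hy => hM₁b n ε hε y hy) x hx
    rw [abs_of_nonneg (hnonneg n ε hε x hx)] at h1
    linarith [hM₂0 n, hM₃0 n, hM₄0 n, hM₅0 n]
  · have h1 := hweight (hM₂0 n) (fun y hy => hM₂b n ε hε y hy) x hx
    linarith [hM₁0 n, hM₃0 n, hM₄0 n, hM₅0 n]
  · linarith [hw3 n ε hε x hx, hM₁0 n, hM₂0 n, hM₄0 n, hM₅0 n]
  · have h1 := hM₄b n ε hε x hx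
    rw [hevent n ε hε x hx] at h1
    linarith [hM₁0 n, hM₂0 n, hM₃0 n, hM₅0 n]
  · linarith [hM₅b n ε hε x hx, hM₁0 n, hM₂0 n, hM₃0 n, hM₄0 n]

end

section

/-! ### The operators of the statement as branch sums -/

/-- A function that `branchSum` fixes on `[1/2, 1]` extends to `[0, 1]` by the same series, so that
`F` has one formula on all of `(0, 1]`. -/
theorem opF_eq_branchSum {g : ℕ → ℝ → ℝ} {Φ : ℝ → ℝ}
    (h : ∀ x ∈ Icc (1 / 2 : ℝ) 1,
      Φ x = branchSum g (fun n => derivWithin (g n) (Icc 0 1)) Φ x) :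
    opF g Φ = branchSum g (fun n => derivWithin (g n) (Icc 0 1)) Φ := by
  funext x
  unfold opF
  by_cases hx : x ∈ Icc (1 / 2 : ℝ) 1
  · rw [indicator_of_mem hx, indicator_of_notMem (notMem_compl_iff.2 hx), add_zero, h x hx]
  · rw [indicator_of_notMem hx, indicator_of_mem (mem_compl hx), zero_add]
    rfl

/-- The equation `u = L u + q` extends the series of `F u + Q φ` from `[0, 1/2)` to `[1/2, 1]`. -/
theorem opF_add_opQ_eq {g : ℕ → ℝ → ℝ → ℝ} {φ u : ℝ → ℝ}
    (h : ∀ x ∈ Icc (1 / 2 : ℝ) 1,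
      u x - branchSum (fun n => g n 0) (fun n => derivWithin (g n 0) (Icc 0 1)) u x =
        ∑' n, termQ g φ n x) (x : ℝ) :
    opF (fun n => g n 0) u x + opQ g φ x =
      branchSum (fun n => g n 0) (fun n => derivWithin (g n 0) (Icc 0 1)) u x +
        ∑' n, termQ g φ n x := by
  unfold opF opQ
  by_cases hx : x ∈ Icc (1 / 2 : ℝ) 1
  · rw [indicator_of_mem hx, indicator_of_notMem (notMem_compl_iff.2 hx),
      indicator_of_notMem (notMem_compl_iff.2 hx), ← h x hx]
    ring
  · rw [indicator_of_notMem hx, indicator_of_mem (mem_compl hx), indicator_of_mem (mem_compl hx),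
      zero_add]
    rfl

theorem transfer_half_eq_branchSum {g : ℕ → ℝ → ℝ} (hg : ∀ n, ContDiffOn ℝ 1 (g n) (Icc 0 1))
    (Φ : ℝ → ℝ) {x : ℝ} (hx : x ∈ Icc (1 / 2 : ℝ) 1) :
    transfer (Icc (1 / 2) 1) g Φ x =
      branchSum g (fun n => derivWithin (g n) (Icc 0 1)) Φ x :=
  tsum_congr fun n => by rw [derivWithin_half_eq (hg n) hx]

theorem memB_of_bound {γ : ℝ} {f : ℝ → ℝ} (hf : ContinuousOn f (Ioc 0 1)) {C : ℝ}
    (hC : ∀ x ∈ Icc (0 : ℝ) 1, |x ^ γ * f x| ≤ C) : MemB γ f :=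
  ⟨hf, (supNorm_le_ofReal fun x hx => hC x (Ioc_subset_Icc_self hx)).trans_lt ENNReal.ofReal_lt_top⟩

/-- Every element of `C¹₀` has exactly one preimage under `I - L` in `C¹₀`. -/
theorem ExpandingBranches.exists_isResolvent {lam D : ℝ} {g d : ℕ → ℝ → ℝ}
    (hg : ExpandingBranches (1 / 2) 1 lam D g (fun n => derivWithin (g n) (Icc 0 1)) d)
    (hgI : ∀ n, ContDiffOn ℝ 1 (g n) (Icc 0 1)) {f : ℝ → ℝ} (hf : MemC10 (1 / 2) 1 f) :
    ∃ u, IsResolvent (1 / 2) 1 g f u ∧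
      ∀ v, IsResolvent (1 / 2) 1 g f v → EqOn v u (Icc (1 / 2) 1) := by
  obtain ⟨u, u', hu, hu0, hufix⟩ := hg.exists_resolvent (isC1_of_contDiffOn hg.lt hf.1) hf.2
  refine ⟨u, ⟨⟨hu.contDiffOn hg.lt, hu0⟩, fun x hx => ?_⟩, fun v hv x hx => ?_⟩
  · rw [transfer_half_eq_branchSum hgI u hx, hufix x hx]
  · obtain ⟨C, -, hC⟩ := exists_resolvent_bound hg.lt hg.lam_nonneg hg.lam_lt hg.dist_nonneg
    have hv1 := isC1_of_contDiffOn hg.lt hv.1.1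
    have hint : ∫ y in Icc (1 / 2 : ℝ) 1, (v y - u y) = 0 := by
      rw [integral_sub hv1.integrableOn hu.integrableOn, hv.1.2, hu0, sub_zero]
    -- the resolvent bound with right-hand side zero
    have h0 := hC g _ d hg (fun y => v y - u y) _ (fun _ => 0) (fun _ => 0) 0 (hv1.sub hu) hint
      ⟨fun y _ => hasDerivWithinAt_const y _ 0, continuousOn_const⟩ (by simp) (fun y hy => ?_) x hx
    · rw [mul_zero] at h0
      exact sub_eq_zero.1 (abs_nonpos_iff.1 h0)
    · rw [hg.branchSum_sub hv1.continuousOn hu.continuousOn hy]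
      have h1 := hv.2 y hy
      rw [transfer_half_eq_branchSum hgI v hy] at h1
      linarith [hufix y hy]

end

end LinearResponse

theorem mainTheorem3 (V : Set ℝ) (γ : ℝ) (T T₀ T₁ g₀ g₁ : ℝ → ℝ → ℝ)
    (hA : LinearResponse.InducingScheme V γ T T₀ T₁ g₀ g₁)
    (That : ℝ → ℝ → ℝ)
    (hThat : ∀ ε x, That ε x = LinearResponse.firstReturn (T ε) (Icc (1 / 2) 1) x)
    (g : ℕ → ℝ → ℝ → ℝ) (hg : g = LinearResponse.wordBranch g₀ g₁)
    (hB : LinearResponse.ExpandingFamily V (1 / 2) 1 That g)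
    -- the invariant densities of the maps and of the induced maps, normalized on `[1/2, 1]`
    (h hhat : ℝ → ℝ → ℝ)
    (hh : ∀ ε ∈ V, LinearResponse.IsInvariantDensity (T ε) (Icc 0 1) (h ε) ∧
      ∫ x in Icc (1 / 2) 1, h ε x = 1)
    (hhhat : ∀ ε ∈ V, LinearResponse.IsInvariantDensity (That ε) (Icc (1 / 2) 1) (hhat ε) ∧
      ContinuousOn (hhat ε) (Icc (1 / 2) 1) ∧ ∫ x in Icc (1 / 2) 1, hhat ε x = 1)
    (hC2 : ContDiffOn ℝ 2 (hhat 0) (Icc (1 / 2) 1))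
    -- `Φ = A₀ ĥ' + B₀ ĥ`
    (Φ : ℝ → ℝ)
    (hΦ : ∀ x, Φ x =
      LinearResponse.coefA That x * derivWithin (hhat 0) (Icc (1 / 2) 1) x +
        LinearResponse.coefB That x * hhat 0 x) :
    -- `h_ε` has a version in `𝓑`, namely `F_ε ĥ_ε`
    (∀ ε ∈ V, LinearResponse.MemB γ (LinearResponse.opF (fun n => g n ε) (hhat ε)) ∧
      h ε =ᵐ[volume.restrict (Icc 0 1)] LinearResponse.opF (fun n => g n ε) (hhat ε)) ∧
    -- `I - L̂` is a bijection of the space of `C¹` functions with zero average onto itself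
    (∀ u, LinearResponse.MemC10 (1 / 2) 1 u → LinearResponse.MemC10 (1 / 2) 1
      (fun x => u x - LinearResponse.transfer (Icc (1 / 2) 1) (fun n => g n 0) u x)) ∧
    (∀ f, LinearResponse.MemC10 (1 / 2) 1 f →
      ∃ u, LinearResponse.IsResolvent (1 / 2) 1 (fun n => g n 0) f u ∧
        ∀ v, LinearResponse.IsResolvent (1 / 2) 1 (fun n => g n 0) f v →
          EqOn v u (Icc (1 / 2) 1)) ∧
    -- the derivatives in `A₀` and `B₀` exist on the branches of the induced map
    (∀ n, ∀ y ∈ g n 0 '' Ioo (1 / 2) 1, DifferentiableAt ℝ (fun e => That e y) 0 ∧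
      DifferentiableAt ℝ (fun e => deriv (That e) y) 0) ∧
    -- `q = L̂ (A₀ ĥ' + B₀ ĥ)`, `u = (I - L̂)⁻¹ q` and `h* = F₀ u + Q ĥ`
    ∃ q u hstar : ℝ → ℝ,
      LinearResponse.MemC10 (1 / 2) 1 q ∧
      (∀ x ∈ Ioo (1 / 2 : ℝ) 1,
        HasSum (fun n => Φ (g n 0 x) * derivWithin (g n 0) (Icc (1 / 2) 1) x) (q x)) ∧
      LinearResponse.IsResolvent (1 / 2) 1 (fun n => g n 0) q u ∧
      LinearResponse.MemB γ hstar ∧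
      Tendsto (fun ε => LinearResponse.normB γ (fun x =>
          (LinearResponse.opF (fun n => g n ε) (hhat ε) x -
            LinearResponse.opF (fun n => g n 0) (hhat 0) x) / ε - hstar x))
        (𝓝[≠] 0) (𝓝 0) ∧
      (∀ x ∈ Ioo (0 : ℝ) (1 / 2),
        Summable (fun n => u (g n 0 x) * derivWithin (g n 0) (Icc 0 1) x) ∧
        Summable (fun n => LinearResponse.termQ g (hhat 0) n x)) ∧
      ∀ x ∈ Ioc (0 : ℝ) 1,
        hstar x = LinearResponse.opF (fun n => g n 0) u x +
          LinearResponse.opQ g (hhat 0) x := by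
  open LinearResponse in
  subst hg
  have hhalf : (1 / 2 : ℝ) < 1 := by norm_num
  obtain ⟨A, D, M, hF⟩ := exists_branchFamily hA hB
  have h0 := hA.zero_mem
  have hgI : ∀ ε ∈ V, ∀ n, ContDiffOn ℝ 1 (wordBranch g₀ g₁ n ε) (Icc 0 1) := fun ε hε n => by
    simpa using (hA.comm_word n 1 le_rfl).contDiffOn ε hε
  obtain ⟨lam, hE⟩ := hF.expanding 0 h0
  have hcont : ∀ ε ∈ V, ContinuousOn (hhat ε) (Icc (1 / 2) 1) := fun ε hε => (hhhat ε hε).2.1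
  have hfix : ∀ ε ∈ V, ∀ x ∈ Icc (1 / 2 : ℝ) 1, hhat ε x =
      branchSum (fun n => wordBranch g₀ g₁ n ε)
        (fun n => derivWithin (wordBranch g₀ g₁ n ε) (Icc 0 1)) (hhat ε) x := fun ε hε => by
    obtain ⟨_, hEε⟩ := hF.expanding ε hε
    exact (hEε.branchSum_eq_self (hB.right_inv ε hε) (hcont ε hε) (hhhat ε hε).1).2
  have hint : ∀ ε ∈ V, ∫ x in Icc (1 / 2 : ℝ) 1, hhat ε x = 1 := fun ε hε => (hhhat ε hε).2.2
  have hopF : ∀ ε ∈ V, opF (fun n => wordBranch g₀ g₁ n ε) (hhat ε) = _ := fun ε hε =>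
    opF_eq_branchSum (hfix ε hε)
  obtain ⟨hφ, hφ'⟩ := isC1_of_contDiffOn_two hhalf hC2
  -- `q`, as the response of the densities of the induced maps at a fixed argument
  set q : ℝ → ℝ := fun x => ∑' n, termQ (wordBranch g₀ g₁) (hhat 0) n x with hq
  have hq1 : MemC10 (1 / 2) 1 q :=
    ⟨(hF.isC1_response hφ hφ').contDiffOn hhalf, hF.integral_response hφ hφ'⟩
  obtain ⟨u, hu, -⟩ := hE.exists_isResolvent (hgI 0 h0) hq1
  have hu1 := isC1_of_contDiffOn hhalf hu.1.1
  have hufix : ∀ x ∈ Icc (1 / 2 : ℝ) 1, u x - branchSum (fun n => wordBranch g₀ g₁ n 0)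
      (fun n => derivWithin (wordBranch g₀ g₁ n 0) (Icc 0 1)) u x = q x := fun x hx => by
    rw [← transfer_half_eq_branchSum (hgI 0 h0) u hx, hu.2 x hx]
  have hstar := opF_add_opQ_eq hufix
  have hcoef := hF.coef_eq hB.right_inv fun ε hε n x hx => hB.deriv_ne_zero hε n hx
  obtain ⟨B₁, -, hB₁⟩ := hu1.exists_bound
  obtain ⟨B₂, -, hB₂⟩ := hφ.exists_bound
  refine ⟨fun ε hε => ⟨?_, ?_⟩, fun v hv => ⟨?_, ?_⟩,
    fun f hf => hE.exists_isResolvent (hgI 0 h0) hf, ?_,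
    q, u, fun x => opF (fun n => wordBranch g₀ g₁ n 0) u x + opQ (wordBranch g₀ g₁) (hhat 0) x,
    hq1, fun x hx => ?_, hu, ?_, tendsto_normB_zero ?_, fun x hx => ?_, fun x _ => rfl⟩
  · rw [hopF ε hε]
    obtain ⟨B, hBk⟩ := isCompact_Icc.exists_bound_of_continuousOn (hcont ε hε)
    exact memB_of_bound (hF.continuousOn_branchSum (hcont ε hε) hε) fun x hx =>
      hF.abs_weight_branchSum_le hBk hε hx
  · obtain ⟨_, hEε⟩ := hF.expanding ε hε
    rw [hopF ε hε]
    exact (hA.twoBranches hε).ae_eq_branchSum (fun _ _ => rfl) hEε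
      (fun n => isC1_of_contDiffOn zero_lt_one (hgI ε hε n)) (hh ε hε).1 (hh ε hε).2 (hcont ε hε)
      (hfix ε hε) (hint ε hε)
  · have hv1 := isC1_of_contDiffOn hhalf hv.1
    exact ((hv1.sub (hE.isC1_branchSum hv1)).contDiffOn hhalf).congr fun x hx => by
      rw [transfer_half_eq_branchSum (hgI 0 h0) v hx]
  · have hv1 := isC1_of_contDiffOn hhalf hv.1
    rw [setIntegral_congr_fun measurableSet_Icc fun x hx => by
      rw [transfer_half_eq_branchSum (hgI 0 h0) v hx],
      integral_sub hv1.integrableOn (hE.isC1_branchSum hv1).integrableOn,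
      hE.integral_branchSum hv1.continuousOn, sub_self]
  · rintro n _ ⟨x, hx, rfl⟩
    exact ⟨(hcoef n hx).1, (hcoef n hx).2.1⟩
  · have hx1 := Ioo_subset_Icc_self hx
    have hs := (hF.summable_response hφ (x := x) ⟨by linarith [hx.1], hx.2.le⟩).hasSum
    refine hs.congr_fun fun n => ?_
    obtain ⟨-, -, h1, h2⟩ := hcoef n hx
    rw [derivWithin_half_eq (hgI 0 h0 n) hx1, hΦ, h1, ← h2]
    ring
  · simp only [hstar]
    refine memB_of_bound (C := B₁ * ∑' n, M n + (B₂ * A + B₂) * ∑' n, M n)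
      ((hF.continuousOn_branchSum hu1.continuousOn h0).add (hF.continuousOn_response hφ))
      fun x hx => ?_
    rw [mul_add]
    exact (abs_add_le _ _).trans (add_le_add
      (hF.abs_weight_branchSum_le (fun y hy => (hB₁ y hy).1) h0 hx)
      (hF.abs_weight_response_le hB₂ hx))
  · intro η hη
    have hind := hF.induced_response hcont hfix hint hφ hφ' hu1 hu.1.2 hufix
    filter_upwards [hF.weighted_response hcont hφ hu1.continuousOn hind η hη,
      nhdsWithin_le_nhds (hA.isOpen.mem_nhds h0)] with ε hε hεV x hx
    simp only [hstar]
    rw [hopF ε hεV, hopF 0 h0]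
    exact hε x hx
  · have hx1 : x ∈ Ioc (0 : ℝ) 1 := ⟨hx.1, by linarith [hx.2]⟩
    exact ⟨hF.summable_term hu1.continuousOn h0 hx1, hF.summable_response hφ hx1⟩
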